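/- Let $k$ be an algebraically closed field of characteristic $0$, $p$ a prime, $\xi\in k^\times$ a fixed primitive $p$-th root of unity, and $V=V_n$ an elementary abelian $p$-group of order $p^n$, viewed as an $n$-dimensional $\mathbb F_p$-vector space with coordinates $x_1,\dots,x_n\in V^*=\mathrm{Hom}(V,\mathbb F_p)$. Let $\omega$ be a $3$-cocycle on $V$ with values in the trivial module $k^\times$. Let $\mathcal C(V,\omega)$ be the fusion category of finite-dimensional $V$-graded $k$-vector spaces with associativity constraint given by $\omega$, let $\mathcal Z(\mathcal C(V,\omega))$ be its center, and let $\mathcal Z(\mathcal C(V,\omega))_{pt}$ be the fusion subcategory generated by the invertible objects of the center. A fusion category is pointed if all its simple objects are invertible. For $v,w\in V$ let $y_j(v,w)\in\mathbb F_p$ be $0$ if $v_j+w_j<p$ and $1$ otherwise, where the coordinates are regarded as elements of $\{0,\dots,p-1\}$ and added as integers (for $p=2$ this represents $x_j^2$). There is a unique $\omega_{alt}\in\bigwedge^3(V^*)$ such that, for some $a_{ijl},s_{ij}\in\mathbb F_p$, $$\omega_{alt}=\sum_{i<j<l}a_{ijl}\,x_i\wedge x_j\wedge x_l,\qquad [\omega]=\Big[\xi^{\sum_{i<j<l}a_{ijl}\,x_i\cup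 x_j\cup x_l}\Big]\cdot\Big[\xi^{\sum_{i,j}s_{ij}\,x_i\cup y_j}\Big]\ \text{ in } H^3(V,k^\times).$$ (For odd $p$ it is the $\bigwedge^3(V^*)$-component of $[\omega]$ in $H^3(V,k^\times)\cong\bigwedge^3(V^*)\oplus \mathrm{Sym}^2(V^*)$; for $p=2$ it is the image of $[\omega]$ under the projection $\pi:H^3(V,k^\times)\to\bigwedge^3(V^*)$ with kernel $\mathrm{Sym}^2(V^*)$.) For $v\in V$ let $\iota_v:\bigwedge^3(V^*)\to\bigwedge^2(V^*)$ be the linear map with $\iota_v(x\wedge y\wedge z)=\langle v,z\rangle x\wedge y-\langle v,y\rangle x\wedge z+\langle v,x\rangle y\wedge z$. Put $\mathrm{Rad}(\phi)=\{v\in V:\iota_v(\phi)=0\}$ for $\phi\in\bigwedge^3(V^*)$, and call $\phi$ non-degenerate if $\mathrm{Rad}(\phi)=0$. Then: 1. There is an isomorphism $\bigwedge^2(V^*)\cong H^2(V,k^\times)$ sending $x\wedge y$ to the class of $(u,v)\mapsto\xi^{x(u)y(v)}$, and under it the class $\beta(v)$ of the $2$-cocycle $\beta_v(x,y)=\dfrac{\omega(v,x,y)\,\omega(x,y,v)}{\omega(x,v,y)}$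 equals $\iota_v(\omega_{alt})$ for every $v\in V$. 2. An element $v\in V$, regarded as a simple object of $\mathcal C(V,\omega)$, is isomorphic to the image of an invertible object of $\mathcal Z(\mathcal C(V,\omega))$ under the forgetful functor if and only if $v\in\mathrm{Rad}(\omega_{alt})$. 3. $\mathcal Z(\mathcal C(V,\omega))$ is pointed if and only if $\omega_{alt}=0$. 4. The full subcategory of $\mathcal Z(\mathcal C(V,\omega))$ of central objects supported in the identity degree is equivalent to $\mathrm{Rep}(V)$ as a braided monoidal category, and $\mathcal Z(\mathcal C(V,\omega))_{pt}$ equals this subcategory $\mathrm{Rep}(V)$ if and only if $\omega_{alt}$ is non-degenerate. -/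

import Mathlib

open CategoryTheory MonoidalCategory
open scoped TensorProduct

universe u

noncomputable section

/-! ### Cocycles with values in a trivial module and their cohomology classes -/

/-- A `2`-cocycle on `G` with values in the abelian group `M` (trivial action), written
multiplicatively. -/
structure TwoCocycle (G M : Type u) [Group G] [CommGroup M] where
  toFun : G → G → M
  cocycle : ∀ x y z, toFun y z * toFun x (y * z) = toFun (x * y) z * toFun x y

/-- A `3`-cocycle on `G` with values in the abelian group `M` (trivial action), written
multiplicatively. -/
structure ThreeCocycle (G M : Type u) [Group G] [CommGroup M] where
  toFun : G → G → G → M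
  cocycle : ∀ x y z w,
    toFun y z w * toFun x (y * z) w * toFun x y z = toFun (x * y) z w * toFun x y (z * w)

/-- The abelian group `M` as a trivial `G`-module. (The ring of scalars is a copy of `ℤ` in the
universe of `G` and `M`, as Mathlib's group cohomology requires.) -/
abbrev trivRep (G M : Type u) [Group G] [CommGroup M] : Rep (ULift.{u} ℤ) G :=
  Rep.trivial (ULift.{u} ℤ) G (Additive M)

section classes

variable {G M : Type u} [Group G] [CommGroup M]

/-- The class in `H²(G, M)` of a `2`-cocycle. -/
def TwoCocycle.cls (μ : TwoCocycle G M) : groupCohomology.H2 (trivRep G M) :=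
  groupCohomology.H2π (trivRep G M) ⟨fun g => Additive.ofMul (μ.toFun g.1 g.2),
    (groupCohomology.mem_cocycles₂_iff (A := trivRep G M) _).2 fun x y z => by
      have h := congrArg Additive.ofMul (μ.cocycle x y z)
      simp only [ofMul_mul] at h
      exact h.symm⟩

theorem ThreeCocycle.d_eq_zero (ω : ThreeCocycle G M) :
    inhomogeneousCochains.d (trivRep G M) 3
      (fun g => Additive.ofMul (ω.toFun (g 0) (g 1) (g 2))) = 0 := by
  funext g
  have h := congrArg Additive.ofMul (ω.cocycle (g 0) (g 1) (g 2) (g 3))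
  simp only [ofMul_mul] at h
  have key : inhomogeneousCochains.d (trivRep G M) 3
      (fun g => Additive.ofMul (ω.toFun (g 0) (g 1) (g 2))) g =
      (Additive.ofMul (ω.toFun (g 1) (g 2) (g 3)) +
        ((-1 : ULift.{u} ℤ) ^ 1 • Additive.ofMul (ω.toFun (g 0 * g 1) (g 2) (g 3)) +
        (-1 : ULift.{u} ℤ) ^ 2 • Additive.ofMul (ω.toFun (g 0) (g 1 * g 2) (g 3)) +
        (-1 : ULift.{u} ℤ) ^ 3 • Additive.ofMul (ω.toFun (g 0) (g 1) (g 2 * g 3)) +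
        (-1 : ULift.{u} ℤ) ^ 4 • Additive.ofMul (ω.toFun (g 0) (g 1) (g 2))) : Additive M) := by
    refine (inhomogeneousCochains.d_hom_apply (trivRep G M) 3 _ g).trans ?_
    refine congrArg₂ (· + ·) rfl ?_
    refine (Fin.sum_univ_four _).trans ?_
    rfl
  rw [key]
  have h3 : (-1 : ULift.{u} ℤ) ^ 3 = -1 := by norm_num
  have h4 : (-1 : ULift.{u} ℤ) ^ 4 = 1 := by norm_num
  rw [h3, h4, pow_one, neg_one_sq, one_smul, one_smul, neg_smul, neg_smul, one_smul, one_smul]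
  have h' := sub_eq_zero.2 h
  refine Eq.trans ?_ h'
  abel

/-- The class in `H³(G, M)` of a `3`-cocycle. -/
def ThreeCocycle.cls (ω : ThreeCocycle G M) : groupCohomology (trivRep G M) 3 :=
  groupCohomology.π (trivRep G M) 3 (groupCohomology.cocyclesMk (A := trivRep G M) _ ω.d_eq_zero)

theorem ThreeCocycle.triangle (ω : ThreeCocycle G M) (a b : G) :
    ω.toFun a 1 b * (ω.toFun 1 1 b)⁻¹ = ω.toFun a 1 1 := by
  have h := ω.cocycle a 1 1 b
  simp only [mul_one, one_mul] at h
  have h' : ω.toFun 1 1 b * ω.toFun a 1 1 = ω.toFun a 1 b := by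
    apply mul_right_cancel (b := ω.toFun a 1 b)
    rw [← h]
    exact mul_right_comm _ _ _
  rw [← h', mul_comm, inv_mul_cancel_left]

end classes

/-- The `2`-cocycle `β_a(x, y) = ω(a, x, y) ω(x, y, a) / ω(x, a, y)` attached to an element `a` of
an abelian group and a `3`-cocycle `ω`. -/
def betaCocycle {G M : Type u} [CommGroup G] [CommGroup M] (ω : ThreeCocycle G M) (a : G) :
    TwoCocycle G M where
  toFun x y := ω.toFun a x y * ω.toFun x y a / ω.toFun x a y
  cocycle x y z := by
    have h1 := congrArg Additive.ofMul (ω.cocycle a x y z)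
    have h2 := congrArg Additive.ofMul (ω.cocycle x a y z)
    have h3 := congrArg Additive.ofMul (ω.cocycle x y a z)
    have h4 := congrArg Additive.ofMul (ω.cocycle x y z a)
    rw [mul_comm x a] at h2
    rw [mul_comm y a, mul_comm a z] at h3
    apply Additive.ofMul.injective
    simp only [ofMul_mul, ofMul_div] at h1 h2 h3 h4 ⊢
    rw [← sub_eq_zero] at h1 h2 h3 h4 ⊢
    have h := congrArg₂ (· - ·) (congrArg₂ (· + ·) (congrArg₂ (· - ·) h1 h2) h3) h4
    simp only [sub_zero, add_zero] at h
    rw [← neg_eq_zero, ← h]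
    abel

/-! ### The category of graded vector spaces twisted by a `3`-cocycle -/

section graded

variable {k G : Type u} [Field k] [Group G] [Fintype G]

/-- An object of `C(G, ω)`: a finite dimensional `G`-graded vector space over `k`. The grading
`X = ⨁ g, X_g` is recorded by the projections `proj g` onto the homogeneous components
`X_g = range (proj g)`, i.e. by a complete family of orthogonal idempotents. The objects and
morphisms do not depend on `ω`; it enters the associativity constraint. -/
structure GrVec (ω : ThreeCocycle G kˣ) where
  carrier : Type u
  [addCommGroup : AddCommGroup carrier]
  [module : Module k carrier]
  [finite : Module.Finite k carrier]
  proj : G → carrier →ₗ[k] carrier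
  proj_self : ∀ g x, proj g (proj g x) = proj g x
  proj_ne : ∀ g h x, g ≠ h → proj g (proj h x) = 0
  sum_proj : ∀ x, ∑ g, proj g x = x

namespace GrVec

attribute [instance] addCommGroup module finite

variable {ω : ThreeCocycle G kˣ}

/-- A morphism of graded vector spaces: a linear map preserving the grading. -/
@[ext]
structure Hom (X Y : GrVec ω) where
  lin : X.carrier →ₗ[k] Y.carrier
  comm : ∀ g x, lin (X.proj g x) = Y.proj g (lin x)

instance : Category (GrVec ω) where
  Hom X Y := Hom X Y
  id X := ⟨LinearMap.id, fun _ _ => rfl⟩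
  comp f g := ⟨g.lin ∘ₗ f.lin, fun h x => by simp [f.comm, g.comm]⟩

@[ext]
theorem hom_ext {X Y : GrVec ω} {f g : X ⟶ Y} (h : f.lin = g.lin) : f = g := Hom.ext h

@[simp] theorem id_lin (X : GrVec ω) : Hom.lin (𝟙 X) = LinearMap.id := rfl

@[simp] theorem comp_lin {X Y Z : GrVec ω} (f : X ⟶ Y) (g : Y ⟶ Z) :
    (f ≫ g).lin = g.lin ∘ₗ f.lin := rfl

instance : Limits.HasZeroMorphisms (GrVec ω) where
  zero X Y := ⟨⟨0, fun _ _ => by simp⟩⟩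
  comp_zero _ _ := by apply hom_ext; exact LinearMap.zero_comp _
  zero_comp _ _ _ f := by apply hom_ext; exact LinearMap.comp_zero _

@[simp] theorem zero_lin (X Y : GrVec ω) : Hom.lin (0 : X ⟶ Y) = 0 := rfl

/-- `x` is homogeneous of degree `g`. -/
def IsHomog {X : GrVec ω} (g : G) (x : X.carrier) : Prop := X.proj g x = x

theorem isHomog_proj (X : GrVec ω) (g : G) (x : X.carrier) : IsHomog g (X.proj g x) :=
  X.proj_self g x

open Classical in
theorem IsHomog.proj_eq {X : GrVec ω} {g : G} {x : X.carrier} (hx : IsHomog g x) (h : G) :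
    X.proj h x = if h = g then x else 0 := by
  split_ifs with e
  · subst e; exact hx
  · rw [← hx]; exact X.proj_ne _ _ _ e

theorem IsHomog.map {X Y : GrVec ω} (f : X ⟶ Y) {g : G} {x : X.carrier} (hx : IsHomog g x) :
    IsHomog g (f.lin x) := by
  unfold IsHomog; rw [← f.comm, hx]

/-- Linear maps which agree on homogeneous elements are equal. -/
theorem lin_ext {X : GrVec ω} {N : Type*} [AddCommGroup N] [Module k N]
    {f f' : X.carrier →ₗ[k] N} (h : ∀ g x, IsHomog g x → f x = f' x) : f = f' := by
  ext x
  rw [← X.sum_proj x, map_sum, map_sum]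
  exact Finset.sum_congr rfl fun g _ => h g _ (X.isHomog_proj g x)

/-- An isomorphism of graded vector spaces from a linear equivalence preserving the grading. -/
def mkIso {X Y : GrVec ω} (e : X.carrier ≃ₗ[k] Y.carrier)
    (h : ∀ g x, IsHomog (X := X) g x → IsHomog (X := Y) g (e x)) : X ≅ Y :=
  have comm : ∀ g x, e (X.proj g x) = Y.proj g (e x) := fun g x => by
    classical
    have : (e : X.carrier →ₗ[k] Y.carrier) ∘ₗ X.proj g = Y.proj g ∘ₗ e :=
      lin_ext fun g' x hx => by
        simp only [LinearMap.comp_apply, LinearEquiv.coe_coe, hx.proj_eq, (h g' x hx).proj_eq]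
        split_ifs <;> simp
    exact LinearMap.congr_fun this x
  { hom := ⟨e, comm⟩
    inv := ⟨e.symm, fun g y => by
      apply e.injective
      change e (e.symm (Y.proj g y)) = e (X.proj g (e.symm y))
      rw [comm, e.apply_symm_apply, e.apply_symm_apply]⟩
    hom_inv_id := by apply hom_ext; ext x; exact e.symm_apply_apply x
    inv_hom_id := by apply hom_ext; ext x; exact e.apply_symm_apply x }

/-- The tensor product: `(X ⊗ Y)_g = ⨁_{ab = g} X_a ⊗ Y_b`. -/
abbrev tensor (X Y : GrVec ω) : GrVec ω where
  carrier := X.carrier ⊗[k] Y.carrier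
  proj g := ∑ a : G, TensorProduct.map (X.proj a) (Y.proj (a⁻¹ * g))
  proj_self g t := by
    induction t with
    | zero => simp
    | add s t hs ht => simp only [map_add, hs, ht]
    | tmul x y =>
      simp only [LinearMap.sum_apply, TensorProduct.map_tmul, map_sum]
      refine Finset.sum_congr rfl fun a _ => ?_
      rw [Finset.sum_eq_single a]
      · rw [X.proj_self, Y.proj_self]
      · intro b _ hb; rw [X.proj_ne _ _ _ hb, TensorProduct.zero_tmul]
      · simp
  proj_ne g h t hgh := by
    induction t with
    | zero => simp
    | add s t hs ht => simp only [map_add, hs, ht, add_zero]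
    | tmul x y =>
      simp only [LinearMap.sum_apply, TensorProduct.map_tmul, map_sum]
      refine Finset.sum_eq_zero fun a _ => Finset.sum_eq_zero fun b _ => ?_
      by_cases hab : b = a
      · subst hab; rw [Y.proj_ne _ _ _ (by simpa using hgh), TensorProduct.tmul_zero]
      · rw [X.proj_ne _ _ _ hab, TensorProduct.zero_tmul]
  sum_proj t := by
    induction t with
    | zero => simp
    | add s t hs ht => simp only [map_add, Finset.sum_add_distrib, hs, ht]
    | tmul x y =>
      simp only [LinearMap.sum_apply, TensorProduct.map_tmul]
      rw [Finset.sum_comm]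
      conv_rhs => rw [← X.sum_proj x, TensorProduct.sum_tmul]
      refine Finset.sum_congr rfl fun a _ => ?_
      rw [← TensorProduct.tmul_sum]
      congr 1
      conv_rhs => rw [← Y.sum_proj y]
      exact Fintype.sum_equiv (Equiv.mulLeft a⁻¹) _ _ fun _ => rfl

theorem IsHomog.tmul {X Y : GrVec ω} {a b : G} {x : X.carrier} {y : Y.carrier}
    (hx : IsHomog a x) (hy : IsHomog b y) : IsHomog (X := tensor X Y) (a * b) (x ⊗ₜ[k] y) := by
  classical
  change (∑ c : G, TensorProduct.map (X.proj c) (Y.proj (c⁻¹ * (a * b)))) (x ⊗ₜ[k] y) = _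
  simp only [LinearMap.sum_apply, TensorProduct.map_tmul]
  rw [Finset.sum_eq_single a]
  · rw [hx, inv_mul_cancel_left, hy]
  · intro c _ hc; rw [hx.proj_eq, if_neg hc, TensorProduct.zero_tmul]
  · simp

theorem tensor_lin_ext {X Y : GrVec ω} {N : Type*} [AddCommGroup N] [Module k N]
    {f f' : (tensor X Y).carrier →ₗ[k] N}
    (h : ∀ a b (x : X.carrier) (y : Y.carrier), IsHomog a x → IsHomog b y →
      f (x ⊗ₜ[k] y) = f' (x ⊗ₜ[k] y)) : f = f' := by
  have : (TensorProduct.mk k X.carrier Y.carrier).compr₂ f =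
      (TensorProduct.mk k X.carrier Y.carrier).compr₂ f' := by
    refine lin_ext fun a x hx => ?_
    refine lin_ext fun b y hy => ?_
    exact h a b x y hx hy
  exact TensorProduct.ext this

theorem tensor_lin_ext₃ {X Y Z : GrVec ω} {N : Type*} [AddCommGroup N] [Module k N]
    {f f' : (tensor (tensor X Y) Z).carrier →ₗ[k] N}
    (h : ∀ a b c (x : X.carrier) (y : Y.carrier) (z : Z.carrier),
      IsHomog a x → IsHomog b y → IsHomog c z →
      f ((x ⊗ₜ[k] y) ⊗ₜ[k] z) = f' ((x ⊗ₜ[k] y) ⊗ₜ[k] z)) : f = f' := by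
  have : (TensorProduct.mk k (tensor X Y).carrier Z.carrier).compr₂ f =
      (TensorProduct.mk k (tensor X Y).carrier Z.carrier).compr₂ f' := by
    refine tensor_lin_ext fun a b x y hx hy => ?_
    refine lin_ext fun c z hz => ?_
    exact h a b c x y z hx hy hz
  exact TensorProduct.ext this

theorem tensor_lin_ext₄ {X Y Z W : GrVec ω} {N : Type*} [AddCommGroup N] [Module k N]
    {f f' : (tensor (tensor (tensor X Y) Z) W).carrier →ₗ[k] N}
    (h : ∀ a b c d (x : X.carrier) (y : Y.carrier) (z : Z.carrier) (w : W.carrier),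
      IsHomog a x → IsHomog b y → IsHomog c z → IsHomog d w →
      f (((x ⊗ₜ[k] y) ⊗ₜ[k] z) ⊗ₜ[k] w) = f' (((x ⊗ₜ[k] y) ⊗ₜ[k] z) ⊗ₜ[k] w)) : f = f' := by
  have : (TensorProduct.mk k (tensor (tensor X Y) Z).carrier W.carrier).compr₂ f =
      (TensorProduct.mk k (tensor (tensor X Y) Z).carrier W.carrier).compr₂ f' := by
    refine tensor_lin_ext₃ fun a b c x y z hx hy hz => ?_
    refine lin_ext fun d w hw => ?_
    exact h a b c d x y z w hx hy hz hw
  exact TensorProduct.ext this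

/-- The tensor product of morphisms. -/
def tensorMap {X X' Y Y' : GrVec ω} (f : X ⟶ X') (g : Y ⟶ Y') : tensor X Y ⟶ tensor X' Y' where
  lin := TensorProduct.map f.lin g.lin
  comm h t := by
    change TensorProduct.map f.lin g.lin
        ((∑ a : G, TensorProduct.map (X.proj a) (Y.proj (a⁻¹ * h))) t) =
      (∑ a : G, TensorProduct.map (X'.proj a) (Y'.proj (a⁻¹ * h))) (TensorProduct.map f.lin g.lin t)
    induction t using TensorProduct.induction_on with
    | zero => simp
    | add s t hs ht => simp only [map_add, hs, ht]
    | tmul x y =>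
      simp only [LinearMap.sum_apply, TensorProduct.map_tmul, map_sum, f.comm, g.comm]

open Classical in
/-- The simple object `g` of `C(G, ω)`: the field `k` placed in degree `g`. -/
abbrev single (ω : ThreeCocycle G kˣ) (g : G) : GrVec ω where
  carrier := k
  proj h := if h = g then LinearMap.id else 0
  proj_self h x := by split_ifs <;> simp
  proj_ne h h' x hh := by
    split_ifs with h1 h2
    · exact absurd (h1.trans h2.symm) hh
    all_goals simp
  sum_proj x := by
    rw [Finset.sum_eq_single g]
    · simp
    · intro b _ hb; simp [hb]
    · simp

theorem isHomog_single (g : G) (c : k) : IsHomog (X := single ω g) g c := by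
  classical
  change (if g = g then LinearMap.id else 0 : k →ₗ[k] k) c = c
  simp

/-- The operator multiplying the component `X_g` by the scalar `s g`. -/
def scale (X : GrVec ω) (s : G → kˣ) : X.carrier →ₗ[k] X.carrier :=
  ∑ g : G, (s g : k) • X.proj g

theorem scale_apply {X : GrVec ω} (s : G → kˣ) {g : G} {x : X.carrier} (hx : IsHomog g x) :
    X.scale s x = (s g : k) • x := by
  classical
  simp only [scale, LinearMap.sum_apply, LinearMap.smul_apply, hx.proj_eq]
  simp

/-- `scale` as a linear automorphism. -/
def scaleEquiv (X : GrVec ω) (s : G → kˣ) : X.carrier ≃ₗ[k] X.carrier :=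
  LinearEquiv.ofLinearMap (X.scale s) (X.scale fun g => (s g)⁻¹)
    (lin_ext fun g x hx => by simp [scale_apply _ hx, smul_smul])
    (lin_ext fun g x hx => by simp [scale_apply _ hx, smul_smul])

theorem scaleEquiv_apply {X : GrVec ω} (s : G → kˣ) {g : G} {x : X.carrier} (hx : IsHomog g x) :
    X.scaleEquiv s x = (s g : k) • x := scale_apply s hx

theorem IsHomog.smul {X : GrVec ω} {g : G} {x : X.carrier} (hx : IsHomog g x) (c : k) :
    IsHomog g (c • x) := by
  unfold IsHomog; rw [map_smul, hx]

/-- The operator on `(X ⊗ Y) ⊗ Z` multiplying `(X_a ⊗ Y_b) ⊗ Z_c` by the scalar `s a b c`. -/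
def scale₃ (X Y Z : GrVec ω) (s : G → G → G → kˣ) :
    (X.carrier ⊗[k] Y.carrier) ⊗[k] Z.carrier →ₗ[k] (X.carrier ⊗[k] Y.carrier) ⊗[k] Z.carrier :=
  ∑ a : G, ∑ b : G, ∑ c : G, (s a b c : k) •
    TensorProduct.map (TensorProduct.map (X.proj a) (Y.proj b)) (Z.proj c)

theorem scale₃_apply {X Y Z : GrVec ω} (s : G → G → G → kˣ) {a b c : G} {x : X.carrier}
    {y : Y.carrier} {z : Z.carrier} (hx : IsHomog a x) (hy : IsHomog b y) (hz : IsHomog c z) :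
    scale₃ X Y Z s ((x ⊗ₜ[k] y) ⊗ₜ[k] z) = (s a b c : k) • ((x ⊗ₜ[k] y) ⊗ₜ[k] z) := by
  classical
  simp only [scale₃, LinearMap.sum_apply, LinearMap.smul_apply, TensorProduct.map_tmul]
  rw [Finset.sum_eq_single a, Finset.sum_eq_single b, Finset.sum_eq_single c]
  · rw [hx, hy, hz]
  · intro d _ hd; rw [hz.proj_eq, if_neg hd]; simp
  · simp
  · intro d _ hd; rw [hy.proj_eq, if_neg hd]; simp
  · simp
  · intro d _ hd; rw [hx.proj_eq, if_neg hd]; simp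
  · simp

/-- `scale₃` as a linear automorphism. -/
def scale₃Equiv (X Y Z : GrVec ω) (s : G → G → G → kˣ) :
    ((X.carrier ⊗[k] Y.carrier) ⊗[k] Z.carrier) ≃ₗ[k] (X.carrier ⊗[k] Y.carrier) ⊗[k] Z.carrier :=
  LinearEquiv.ofLinearMap (scale₃ X Y Z s) (scale₃ X Y Z fun a b c => (s a b c)⁻¹)
    (tensor_lin_ext₃ fun a b c x y z hx hy hz => by
      simp [scale₃_apply _ hx hy hz, smul_smul])
    (tensor_lin_ext₃ fun a b c x y z hx hy hz => by
      simp [scale₃_apply _ hx hy hz, smul_smul])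

/-- The associativity constraint of `C(G, ω)`: on `(X_a ⊗ Y_b) ⊗ Z_c` it is `ω a b c` times the
usual one. -/
def assocEquiv (X Y Z : GrVec ω) :
    (tensor (tensor X Y) Z).carrier ≃ₗ[k] (tensor X (tensor Y Z)).carrier :=
  (scale₃Equiv X Y Z ω.toFun).trans (TensorProduct.assoc k X.carrier Y.carrier Z.carrier)

theorem assocEquiv_apply {X Y Z : GrVec ω} {a b c : G} {x : X.carrier}
    {y : Y.carrier} {z : Z.carrier} (hx : IsHomog a x) (hy : IsHomog b y) (hz : IsHomog c z) :
    assocEquiv X Y Z ((x ⊗ₜ[k] y) ⊗ₜ[k] z) = (ω.toFun a b c : k) • (x ⊗ₜ[k] (y ⊗ₜ[k] z)) := by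
  change TensorProduct.assoc k X.carrier Y.carrier Z.carrier (scale₃ X Y Z ω.toFun _) = _
  rw [scale₃_apply _ hx hy hz, map_smul, TensorProduct.assoc_tmul]

/-- The left unit constraint of `C(G, ω)`; the scalar is `1` if `ω` is normalized. -/
def leftUnitEquiv (X : GrVec ω) : (tensor (single ω 1) X).carrier ≃ₗ[k] X.carrier :=
  (TensorProduct.lid k X.carrier).trans (X.scaleEquiv fun g => (ω.toFun 1 1 g)⁻¹)

/-- The right unit constraint of `C(G, ω)`; the scalar is `1` if `ω` is normalized. -/
def rightUnitEquiv (X : GrVec ω) : (tensor X (single ω 1)).carrier ≃ₗ[k] X.carrier :=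
  (TensorProduct.rid k X.carrier).trans (X.scaleEquiv fun g => ω.toFun g 1 1)

theorem leftUnitEquiv_apply {X : GrVec ω} {g : G} {x : X.carrier} (hx : IsHomog g x) (c : k) :
    leftUnitEquiv X (c ⊗ₜ[k] x) = (((ω.toFun 1 1 g)⁻¹ : kˣ) : k) • c • x := by
  change X.scaleEquiv _ (TensorProduct.lid k X.carrier (c ⊗ₜ[k] x)) = _
  rw [TensorProduct.lid_tmul, scaleEquiv_apply _ (hx.smul c)]

theorem rightUnitEquiv_apply {X : GrVec ω} {g : G} {x : X.carrier} (hx : IsHomog g x) (c : k) :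
    rightUnitEquiv X (x ⊗ₜ[k] c) = (ω.toFun g 1 1 : k) • c • x := by
  change X.scaleEquiv _ (TensorProduct.rid k X.carrier (x ⊗ₜ[k] c)) = _
  rw [TensorProduct.rid_tmul, scaleEquiv_apply _ (hx.smul c)]


instance : MonoidalCategoryStruct (GrVec ω) where
  tensorObj := tensor
  whiskerLeft X _ _ f := tensorMap (𝟙 X) f
  whiskerRight f Y := tensorMap f (𝟙 Y)
  tensorHom f g := tensorMap f g
  tensorUnit := single ω 1
  associator X Y Z := mkIso (assocEquiv X Y Z) (by
    classical
    intro g t ht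
    suffices h : (tensor X (tensor Y Z)).proj g ∘ₗ (assocEquiv X Y Z : _ →ₗ[k] _) =
        (assocEquiv X Y Z : _ →ₗ[k] _) ∘ₗ (tensor (tensor X Y) Z).proj g by
      have := LinearMap.congr_fun h t
      simp only [LinearMap.comp_apply, LinearEquiv.coe_coe] at this
      rw [ht] at this
      exact this
    refine tensor_lin_ext₃ fun a b c x y z hx hy hz => ?_
    simp only [LinearMap.comp_apply, LinearEquiv.coe_coe]
    rw [((hx.tmul hy).tmul hz).proj_eq, assocEquiv_apply hx hy hz, map_smul,
      (hx.tmul (hy.tmul hz)).proj_eq, mul_assoc]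
    split_ifs
    · rw [assocEquiv_apply hx hy hz]
    · simp)
  leftUnitor X := mkIso (leftUnitEquiv X) (by
    classical
    intro g t ht
    suffices h : X.proj g ∘ₗ (leftUnitEquiv X : _ →ₗ[k] _) =
        (leftUnitEquiv X : _ →ₗ[k] _) ∘ₗ (tensor (single ω 1) X).proj g by
      have := LinearMap.congr_fun h t
      simp only [LinearMap.comp_apply, LinearEquiv.coe_coe] at this
      rw [ht] at this
      exact this
    refine tensor_lin_ext fun a b c x hc hx => ?_
    have hc' : IsHomog (X := single ω 1) 1 c := isHomog_single 1 c
    simp only [LinearMap.comp_apply, LinearEquiv.coe_coe]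
    rw [(hc'.tmul hx).proj_eq, leftUnitEquiv_apply hx, map_smul, map_smul, hx.proj_eq, one_mul]
    split_ifs
    · rw [leftUnitEquiv_apply hx]
    · simp)
  rightUnitor X := mkIso (rightUnitEquiv X) (by
    classical
    intro g t ht
    suffices h : X.proj g ∘ₗ (rightUnitEquiv X : _ →ₗ[k] _) =
        (rightUnitEquiv X : _ →ₗ[k] _) ∘ₗ (tensor X (single ω 1)).proj g by
      have := LinearMap.congr_fun h t
      simp only [LinearMap.comp_apply, LinearEquiv.coe_coe] at this
      rw [ht] at this
      exact this
    refine tensor_lin_ext fun a b x c hx hc => ?_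
    have hc' : IsHomog (X := single ω 1) 1 c := isHomog_single 1 c
    simp only [LinearMap.comp_apply, LinearEquiv.coe_coe]
    rw [(hx.tmul hc').proj_eq, rightUnitEquiv_apply hx, map_smul, map_smul, hx.proj_eq, mul_one]
    split_ifs
    · rw [rightUnitEquiv_apply hx]
    · simp)

theorem tensorHom_lin {X X' Y Y' : GrVec ω} (f : X ⟶ X') (g : Y ⟶ Y') :
    Hom.lin (f ⊗ₘ g) = TensorProduct.map f.lin g.lin := rfl

theorem whiskerLeft_lin (X : GrVec ω) {Y Y' : GrVec ω} (g : Y ⟶ Y') :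
    Hom.lin (X ◁ g) = TensorProduct.map LinearMap.id g.lin := rfl

theorem whiskerRight_lin {X X' : GrVec ω} (f : X ⟶ X') (Y : GrVec ω) :
    Hom.lin (f ▷ Y) = TensorProduct.map f.lin LinearMap.id := rfl

theorem associator_hom_lin (X Y Z : GrVec ω) :
    Hom.lin (α_ X Y Z).hom = (assocEquiv X Y Z).toLinearMap := rfl

theorem leftUnitor_hom_lin (X : GrVec ω) :
    Hom.lin (λ_ X).hom = (leftUnitEquiv X).toLinearMap := rfl

theorem rightUnitor_hom_lin (X : GrVec ω) :
    Hom.lin (ρ_ X).hom = (rightUnitEquiv X).toLinearMap := rfl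

instance : MonoidalCategory (GrVec ω) where
  tensorHom_def f g := by
    apply hom_ext
    rw [comp_lin, tensorHom_lin, whiskerLeft_lin, whiskerRight_lin, ← TensorProduct.map_comp]
    rfl
  id_tensorHom_id X Y := by
    apply hom_ext
    rw [tensorHom_lin]
    exact TensorProduct.map_id
  tensorHom_comp_tensorHom f₁ f₂ g₁ g₂ := by
    apply hom_ext
    rw [comp_lin, tensorHom_lin, tensorHom_lin, tensorHom_lin, ← TensorProduct.map_comp]
    rfl
  whiskerLeft_id X Y := by
    apply hom_ext
    exact TensorProduct.map_id
  id_whiskerRight X Y := by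
    apply hom_ext
    exact TensorProduct.map_id
  associator_naturality f g h := by
    apply hom_ext
    refine tensor_lin_ext₃ fun a b c x y z hx hy hz => ?_
    change assocEquiv _ _ _ ((f.lin x ⊗ₜ[k] g.lin y) ⊗ₜ[k] h.lin z) =
      TensorProduct.map f.lin (TensorProduct.map g.lin h.lin) (assocEquiv _ _ _ _)
    rw [assocEquiv_apply (hx.map f) (hy.map g) (hz.map h), assocEquiv_apply hx hy hz, map_smul]
    rfl
  leftUnitor_naturality {X Y} f := by
    apply hom_ext
    refine tensor_lin_ext fun a b c x hc hx => ?_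
    change leftUnitEquiv Y (c ⊗ₜ[k] f.lin x) = f.lin (leftUnitEquiv X (c ⊗ₜ[k] x))
    rw [leftUnitEquiv_apply (hx.map f), leftUnitEquiv_apply hx, map_smul, map_smul]
  rightUnitor_naturality {X Y} f := by
    apply hom_ext
    refine tensor_lin_ext fun a b x c hx hc => ?_
    change rightUnitEquiv Y (f.lin x ⊗ₜ[k] c) = f.lin (rightUnitEquiv X (x ⊗ₜ[k] c))
    rw [rightUnitEquiv_apply (hx.map f), rightUnitEquiv_apply hx, map_smul, map_smul]
  pentagon X Y Z W := by
    apply hom_ext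
    refine tensor_lin_ext₄ fun a b c d x y z w hx hy hz hw => ?_
    change TensorProduct.map LinearMap.id (assocEquiv Y Z W).toLinearMap
        (assocEquiv X (tensor Y Z) W
          (assocEquiv X Y Z ((x ⊗ₜ[k] y) ⊗ₜ[k] z) ⊗ₜ[k] w)) =
      assocEquiv X Y (tensor Z W) (assocEquiv (tensor X Y) Z W (((x ⊗ₜ[k] y) ⊗ₜ[k] z) ⊗ₜ[k] w))
    rw [assocEquiv_apply hx hy hz, assocEquiv_apply (hx.tmul hy) hz hw, ← TensorProduct.smul_tmul',
      map_smul, assocEquiv_apply hx (hy.tmul hz) hw, map_smul, map_smul, map_smul,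
      assocEquiv_apply hx hy (hz.tmul hw), TensorProduct.map_tmul, LinearEquiv.coe_coe,
      assocEquiv_apply hy hz hw, LinearMap.id_apply, TensorProduct.tmul_smul, smul_smul, smul_smul,
      smul_smul]
    congr 1
    have h := congrArg (Units.val) (ω.cocycle a b c d)
    push_cast at h
    linear_combination h
  triangle X Y := by
    apply hom_ext
    refine tensor_lin_ext₃ fun a b c x s y hx hs hy => ?_
    have hs' : IsHomog (X := single ω 1) 1 s := isHomog_single 1 s
    change TensorProduct.map LinearMap.id (leftUnitEquiv Y).toLinearMap
        (assocEquiv X (single ω 1) Y ((x ⊗ₜ[k] s) ⊗ₜ[k] y)) =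
      TensorProduct.map (rightUnitEquiv X).toLinearMap LinearMap.id ((x ⊗ₜ[k] s) ⊗ₜ[k] y)
    rw [assocEquiv_apply hx hs' hy, map_smul, TensorProduct.map_tmul, TensorProduct.map_tmul,
      LinearEquiv.coe_coe, LinearEquiv.coe_coe, leftUnitEquiv_apply hy, rightUnitEquiv_apply hx,
      LinearMap.id_apply, LinearMap.id_apply, ← ω.triangle a c]
    simp only [TensorProduct.tmul_smul, TensorProduct.smul_tmul', smul_smul, Units.val_mul,
      mul_assoc]

instance : Limits.HasZeroMorphisms (Center (GrVec ω)) where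
  zero X Y := ⟨⟨0, fun U => by
    apply hom_ext
    rw [comp_lin, comp_lin, whiskerLeft_lin, whiskerRight_lin, zero_lin,
      TensorProduct.map_zero_left, TensorProduct.map_zero_right, LinearMap.zero_comp,
      LinearMap.comp_zero]⟩⟩
  comp_zero _ _ := by apply Center.ext; exact Limits.comp_zero
  zero_comp _ _ _ _ := by apply Center.ext; exact Limits.zero_comp


variable (ω)

/-- The objects of the center of `C(G, ω)` whose underlying graded vector space is concentrated in
degree `1`, i.e. is a multiple of the unit object. -/
def identitySupported : ObjectProperty (Center (GrVec ω)) :=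
  fun Z => ∀ x, Z.1.proj 1 x = x

instance : (identitySupported ω).IsMonoidal where
  prop_unit := isHomog_single (ω := ω) 1
  prop_tensor X Y hX hY := fun t => by
    have h : (tensor X.1 Y.1).proj 1 = LinearMap.id := tensor_lin_ext fun a b x y _ _ => by
      have := IsHomog.tmul (hX x) (hY y)
      rw [mul_one] at this
      exact this
    exact LinearMap.congr_fun h t

end GrVec

end graded

/-! ### Invertible objects, pointed categories -/

section pointed

variable {C : Type*} [Category C] [MonoidalCategory C]

/-- `X` is invertible with respect to the tensor product. -/
def IsInvertibleObj (X : C) : Prop :=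
  ∃ Y : C, Nonempty (X ⊗ Y ≅ 𝟙_ C) ∧ Nonempty (Y ⊗ X ≅ 𝟙_ C)

variable (C) [Limits.HasZeroMorphisms C]

/-- A (fusion) category is pointed if all its simple objects are invertible. -/
def IsPointedCategory : Prop := ∀ X : C, Simple X → IsInvertibleObj X

/-- The pointed part of a fusion category: the full subcategory of all finite direct sums of
invertible objects. As invertible objects are closed under tensor products and duals, this is the
fusion subcategory generated by the invertible objects. -/
def pointedPart : ObjectProperty C := fun X =>
  ∃ (m : ℕ) (Y : Fin m → C) (B : Limits.Bicone Y),
    (∀ i, IsInvertibleObj (Y i)) ∧ Nonempty B.IsBilimit ∧ Nonempty (X ≅ B.pt)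

end pointed

/-! ### Exterior powers -/

section exterior

variable {F V : Type*} [Field F] [AddCommGroup V] [Module F V]

/-- The decomposable element `x ∧ y` of `⋀² V*`. -/
def wedge₂ (x y : Module.Dual F V) : ⋀[F]^2 (Module.Dual F V) := exteriorPower.ιMulti F 2 ![x, y]

/-- The decomposable element `x ∧ y ∧ z` of `⋀³ V*`. -/
def wedge₃ (x y z : Module.Dual F V) : ⋀[F]^3 (Module.Dual F V) :=
  exteriorPower.ιMulti F 3 ![x, y, z]

theorem wedge₂_add_left (x x' y : Module.Dual F V) :
    wedge₂ (x + x') y = wedge₂ x y + wedge₂ x' y := by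
  have h := (exteriorPower.ιMulti F 2).map_update_add ![x, y] 0 x x'
  have e : ∀ z, Function.update ![x, y] 0 z = ![z, y] := by
    intro z; funext i; fin_cases i <;> rfl
  simp only [e] at h
  exact h

theorem wedge₂_smul_left (c : F) (x y : Module.Dual F V) :
    wedge₂ (c • x) y = c • wedge₂ x y := by
  have h := (exteriorPower.ιMulti F 2).map_update_smul ![x, y] 0 c x
  have e : ∀ z, Function.update ![x, y] 0 z = ![z, y] := by
    intro z; funext i; fin_cases i <;> rfl
  simp only [e] at h
  exact h

theorem wedge₂_self (x : Module.Dual F V) : wedge₂ x x = 0 :=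
  (exteriorPower.ιMulti F 2).map_eq_zero_of_eq ![x, x] (i := 0) (j := 1) rfl (by decide)

theorem wedge₂_add_right (x y y' : Module.Dual F V) :
    wedge₂ x (y + y') = wedge₂ x y + wedge₂ x y' := by
  have h := (exteriorPower.ιMulti F 2).map_update_add ![x, y] 1 y y'
  have e : ∀ z, Function.update ![x, y] 1 z = ![x, z] := by
    intro z; funext i; fin_cases i <;> rfl
  simp only [e] at h
  exact h

theorem wedge₂_smul_right (c : F) (x y : Module.Dual F V) :
    wedge₂ x (c • y) = c • wedge₂ x y := by
  have h := (exteriorPower.ιMulti F 2).map_update_smul ![x, y] 1 c y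
  have e : ∀ z, Function.update ![x, y] 1 z = ![x, z] := by
    intro z; funext i; fin_cases i <;> rfl
  simp only [e] at h
  exact h

theorem wedge₂_swap (x y : Module.Dual F V) : wedge₂ x y = -wedge₂ y x := by
  have h := wedge₂_self (x + y)
  rw [wedge₂_add_left, wedge₂_add_right, wedge₂_add_right, wedge₂_self, wedge₂_self] at h
  rw [zero_add, add_zero] at h
  exact eq_neg_of_add_eq_zero_left h

/-- The alternating map `(x, y, z) ↦ ⟨v, z⟩ x ∧ y - ⟨v, y⟩ x ∧ z + ⟨v, x⟩ y ∧ z`. -/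
def interiorAlt (v : V) : (Module.Dual F V) [⋀^Fin 3]→ₗ[F] ⋀[F]^2 (Module.Dual F V) where
  toFun m := m 2 v • wedge₂ (m 0) (m 1) - m 1 v • wedge₂ (m 0) (m 2) + m 0 v • wedge₂ (m 1) (m 2)
  map_update_add' := @fun inst m i x y => by
    cases Subsingleton.elim inst (instDecidableEqFin 3)
    fin_cases i <;> simp [wedge₂_add_left, wedge₂_add_right, add_smul] <;> abel
  map_update_smul' := @fun inst m i c x => by
    cases Subsingleton.elim inst (instDecidableEqFin 3)
    fin_cases i <;> simp [wedge₂_smul_left, wedge₂_smul_right] <;> module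
  map_eq_zero_of_eq' m i j h hij := by
    have h01 : m 0 = m 1 → m 2 v • wedge₂ (m 0) (m 1) - m 1 v • wedge₂ (m 0) (m 2) +
        m 0 v • wedge₂ (m 1) (m 2) = 0 := fun e => by simp [e, wedge₂_self]
    have h02 : m 0 = m 2 → m 2 v • wedge₂ (m 0) (m 1) - m 1 v • wedge₂ (m 0) (m 2) +
        m 0 v • wedge₂ (m 1) (m 2) = 0 := fun e => by
      simp [e, wedge₂_self, wedge₂_swap (m 1) (m 2)]
    have h12 : m 1 = m 2 → m 2 v • wedge₂ (m 0) (m 1) - m 1 v • wedge₂ (m 0) (m 2) +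
        m 0 v • wedge₂ (m 1) (m 2) = 0 := fun e => by simp [e, wedge₂_self]
    fin_cases i <;> fin_cases j
    exacts [absurd rfl hij, h01 h, h02 h, h01 h.symm, absurd rfl hij, h12 h, h02 h.symm,
      h12 h.symm, absurd rfl hij]

/-- The interior derivation `v ⊗ φ ↦ ι_v φ`, characterized by
`ι_v (x ∧ y ∧ z) = ⟨v, z⟩ x ∧ y - ⟨v, y⟩ x ∧ z + ⟨v, x⟩ y ∧ z`. -/
def interiorDerivation : V →ₗ[F] ⋀[F]^3 (Module.Dual F V) →ₗ[F] ⋀[F]^2 (Module.Dual F V) where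
  toFun v := exteriorPower.alternatingMapLinearEquiv (interiorAlt v)
  map_add' u v := by
    apply exteriorPower.linearMap_ext
    ext m : 1
    simp [interiorAlt, add_smul]
    abel
  map_smul' c v := by
    apply exteriorPower.linearMap_ext
    ext m : 1
    simp [interiorAlt, mul_smul, smul_sub]

theorem interiorDerivation_wedge₃ (v : V) (x y z : Module.Dual F V) :
    interiorDerivation v (wedge₃ x y z) =
      z v • wedge₂ x y - y v • wedge₂ x z + x v • wedge₂ y z := by
  simp [interiorDerivation, wedge₃, interiorAlt]

/-- The radical `Rad φ = {v | ι_v φ = 0}`. -/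
def Rad (φ : ⋀[F]^3 (Module.Dual F V)) : Submodule F V := LinearMap.ker (interiorDerivation.flip φ)

theorem mem_Rad (φ : ⋀[F]^3 (Module.Dual F V)) (v : V) :
    v ∈ Rad φ ↔ interiorDerivation v φ = 0 := Iff.rfl

/-- `φ` is non-degenerate if its radical is zero. -/
def Nondegenerate₃ (φ : ⋀[F]^3 (Module.Dual F V)) : Prop := Rad φ = ⊥

end exterior

/-! ### Cocycles on elementary abelian `p`-groups -/

section elementaryAbelian

variable {p : ℕ} [Fact p.Prime] {k : Type u} [Field k]

/-- The homomorphism `a ↦ ξ ^ a` from `𝔽_p` to `kˣ` given by a primitive `p`-th root of unity. -/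
def rootPow (ξ : kˣ) (a : ZMod p) : kˣ := ξ ^ a.val

theorem rootPow_add {ξ : kˣ} (hξ : IsPrimitiveRoot ξ p) (a b : ZMod p) :
    rootPow ξ (a + b) = rootPow ξ a * rootPow ξ b := by
  rw [rootPow, rootPow, rootPow, ← pow_add, ZMod.val_add, ← pow_eq_pow_mod _ hξ.pow_eq_one]

/-- The carry `{a, b}`: it is `0` if `a + b < p` and `1` if `a + b ≥ p`, where `a` and `b` are
regarded as elements of `{0, …, p - 1}` and added as integers. -/
def carry (a b : ZMod p) : ZMod p := if a.val + b.val < p then 0 else 1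

theorem carry_cocycle (a b c : ZMod p) :
    carry b c + carry a (b + c) = carry (a + b) c + carry a b := by
  have h : ∀ a b : ZMod p, ∃ e : ℕ, carry a b = (e : ZMod p) ∧
      a.val + b.val = (a + b).val + e * p := by
    intro a b
    unfold carry
    split_ifs with hab
    · exact ⟨0, by simp, by rw [ZMod.val_add_of_lt hab]; simp⟩
    · exact ⟨1, by simp, by rw [ZMod.val_add_val_of_le (not_lt.1 hab)]; simp⟩
  obtain ⟨e1, h1, h1'⟩ := h b c
  obtain ⟨e2, h2, h2'⟩ := h a (b + c)
  obtain ⟨e3, h3, h3'⟩ := h (a + b) c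
  obtain ⟨e4, h4, h4'⟩ := h a b
  rw [h1, h2, h3, h4]
  have hp : 0 < p := (Fact.out : p.Prime).pos
  rw [← add_assoc] at h2'
  have : (e1 + e2) * p = (e3 + e4) * p := by rw [add_mul, add_mul]; omega
  exact_mod_cast congrArg (Nat.cast (R := ZMod p)) (Nat.eq_of_mul_eq_mul_right hp this)

variable {V : Type u} [AddCommGroup V] [Module (ZMod p) V]

/-- The `2`-cocycle `(u, v) ↦ ξ ^ (x(u) y(v))` on `V`, for `x, y ∈ V*`. -/
def bilinCocycle {ξ : kˣ} (hξ : IsPrimitiveRoot ξ p) (x y : Module.Dual (ZMod p) V) :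
    TwoCocycle (Multiplicative V) kˣ where
  toFun u v := rootPow ξ (x u.toAdd * y v.toAdd)
  cocycle u v w := by
    simp only [← rootPow_add hξ, toAdd_mul, map_add]
    congr 1
    ring

variable {n : ℕ} (b : Module.Basis (Fin n) (ZMod p) V)

/-- The `3`-cocycle `(u, v, w) ↦ ξ ^ (∑_{i < j < l} a i j l * u_i v_j w_l)` on `V`, i.e. the image
in `kˣ` of `∑_{i < j < l} a i j l * x_i ∪ x_j ∪ x_l`; here `v_i = x_i(v)` are the coordinates of
`v` in the basis `b`. -/
def altCocycle {ξ : kˣ} (hξ : IsPrimitiveRoot ξ p) (a : Fin n → Fin n → Fin n → ZMod p) :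
    ThreeCocycle (Multiplicative V) kˣ where
  toFun u v w := rootPow ξ (∑ i, ∑ j, ∑ l, if i < j ∧ j < l then
    a i j l * (b.coord i u.toAdd * b.coord j v.toAdd * b.coord l w.toAdd) else 0)
  cocycle u v w z := by
    simp only [← rootPow_add hξ, toAdd_mul, map_add, ← Finset.sum_add_distrib]
    congr 1
    refine Finset.sum_congr rfl fun i _ => Finset.sum_congr rfl fun j _ =>
      Finset.sum_congr rfl fun l _ => ?_
    split_ifs
    · ring
    · simp

/-- The `3`-cocycle `(u, v, w) ↦ ξ ^ (∑_{i, j} s i j * u_i {v_j, w_j})` on `V`, i.e. the image in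
`kˣ` of `∑_{i, j} s i j * x_i ∪ y_j`, where `y_j` is the class of the `2`-cocycle
`(v, w) ↦ {v_j, w_j}` (for `p = 2` this is `x_j ^ 2`). -/
def symCocycle {ξ : kˣ} (hξ : IsPrimitiveRoot ξ p) (s : Fin n → Fin n → ZMod p) :
    ThreeCocycle (Multiplicative V) kˣ where
  toFun u v w := rootPow ξ (∑ i, ∑ j,
    s i j * (b.coord i u.toAdd * carry (b.coord j v.toAdd) (b.coord j w.toAdd)))
  cocycle u v w z := by
    simp only [← rootPow_add hξ, toAdd_mul, map_add, ← Finset.sum_add_distrib]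
    congr 1
    refine Finset.sum_congr rfl fun i _ => Finset.sum_congr rfl fun j _ => ?_
    linear_combination -(s i j * b.coord i u.toAdd) *
      carry_cocycle (b.coord j v.toAdd) (b.coord j w.toAdd) (b.coord j z.toAdd)

/-- `φ` is the alternating part of the class `c`: the class `c ∈ H³(V, kˣ)` is the sum of the class of
`∑_{i < j < l} a i j l * x_i ∪ x_j ∪ x_l` and a class in the span of the `x_i ∪ y_j`, and
`φ = ∑_{i < j < l} a i j l * x_i ∧ x_j ∧ x_l`. For odd `p` this says that `φ` is the `⋀³ V*`
component of `c` in `H³(V, kˣ) = ⋀³ V* ⊕ Sym² V*`; for `p = 2` (where `y_j = x_j ^ 2`) it says that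
`φ` is the image of `c` under the projection of `H³(V, kˣ)` to `⋀³ V*` with kernel `Sym² V*`. -/
def IsAltPart {ξ : kˣ} (hξ : IsPrimitiveRoot ξ p)
    (c : groupCohomology (trivRep (Multiplicative V) kˣ) 3)
    (φ : ⋀[ZMod p]^3 (Module.Dual (ZMod p) V)) : Prop :=
  ∃ (a : Fin n → Fin n → Fin n → ZMod p) (s : Fin n → Fin n → ZMod p),
    c = (altCocycle b hξ a).cls + (symCocycle b hξ s).cls ∧
    φ = ∑ i, ∑ j, ∑ l, if i < j ∧ j < l then
      a i j l • wedge₃ (b.coord i) (b.coord j) (b.coord l) else 0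

end elementaryAbelian

end

/-! The theorem has a categorical half, valid for any finite abelian group `G`, and a cohomological
half, special to `V`.

Categorical half. By naturality a half-braiding on `Z` is determined by its values on the simple
objects `x`, that is by operators `T_x` on `Z`. They preserve degrees because `G` is abelian, and
monoidality of the half-braiding says `T_y T_x = β_v(x, y) T_{xy}` on `Z_v`. So a central object is
a family, indexed by `v`, of projective representations with multiplier `β_v`. Invertible objects
are the one-dimensional ones, and degree `v` supports one exactly when `β_v` is a coboundary. Every
degree supports a simple object, found inside the twisted regular representation, so the center is
pointed iff all `β_v` are coboundaries. In degree `1` the multiplier is always a coboundary, and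
dividing by its trivialization gives `Rep(G)`. The carriers are `centerOp_mul`,
`CentralAction.toCenter`, `isInvertibleObj_centerSingle` and `exists_simple_concentrated`.

Cohomological half. A symmetric `2`-cocycle with values in the divisible group `kˣ` is a coboundary,
since the corresponding abelian extension splits. Hence a `2`-cocycle is determined up to coboundary
by its commutator pairing, and `⋀² V* ≅ H²(V, kˣ)`. On `x_i ∪ x_j ∪ x_l` the cocycle `β_v` is
literally `ι_v`, while on `x_i ∪ y_j` it is symmetric, hence trivial.

The remaining point is that these cocycles exhaust `H³`, which is a count
(`exists_cls_eq_alt_add_sym`). Dimension shifting along `0 → M → Coind → Coind → M → 0` for the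
kernel of one coordinate bounds `|H³|` by `p` to the number of triples `i < j < l` plus the number
of pairs `i ≤ j`. As many explicit classes are distinguished by two invariants: the alternation of a
`3`-cocycle and its product over the multiples of a vector. The alternation also makes the
alternating part unique. -/

noncomputable section

/-! ### Cocycles modulo coboundaries -/

section classes

variable {G M : Type u} [Group G] [CommGroup M]

instance : Mul (TwoCocycle G M) where
  mul μ ν :=
    { toFun x y := μ.toFun x y * ν.toFun x y
      cocycle x y z := by
        rw [mul_mul_mul_comm, μ.cocycle, ν.cocycle, mul_mul_mul_comm] }

instance : Mul (ThreeCocycle G M) where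
  mul μ ν :=
    { toFun x y z := μ.toFun x y z * ν.toFun x y z
      cocycle x y z w := by
        have h := congrArg₂ (· * ·) (μ.cocycle x y z w) (ν.cocycle x y z w)
        rw [mul_mul_mul_comm, mul_mul_mul_comm (μ.toFun y z w)] at h
        rw [h, mul_mul_mul_comm] }

@[simp] theorem TwoCocycle.mul_toFun (μ ν : TwoCocycle G M) (x y : G) :
    (μ * ν).toFun x y = μ.toFun x y * ν.toFun x y := rfl

@[simp] theorem ThreeCocycle.mul_toFun (μ ν : ThreeCocycle G M) (x y z : G) :
    (μ * ν).toFun x y z = μ.toFun x y z * ν.toFun x y z := rfl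

theorem TwoCocycle.cls_mul (μ ν : TwoCocycle G M) : (μ * ν).cls = μ.cls + ν.cls := by
  refine Eq.trans ?_ (map_add (groupCohomology.H2π (trivRep G M)).hom _ _)
  rfl

theorem ThreeCocycle.cls_mul (μ ν : ThreeCocycle G M) : (μ * ν).cls = μ.cls + ν.cls := by
  refine Eq.trans ?_ (map_add (groupCohomology.π (trivRep G M) 3).hom _ _)
  refine congrArg (groupCohomology.π (trivRep G M) 3).hom ?_
  -- Cocycles inject into cochains, so additivity can be checked on the underlying functions.
  apply (ModuleCat.mono_iff_injective (groupCohomology.iCocycles (trivRep G M) 3)).1 inferInstance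
  refine (groupCohomology.iCocycles_mk _ _).trans ?_
  refine Eq.trans ?_ (map_add (groupCohomology.iCocycles (trivRep G M) 3).hom _ _).symm
  exact (congrArg₂ (· + ·) (groupCohomology.iCocycles_mk _ μ.d_eq_zero)
    (groupCohomology.iCocycles_mk _ ν.d_eq_zero)).symm

theorem TwoCocycle.cls_eq_iff (μ ν : TwoCocycle G M) :
    μ.cls = ν.cls ↔ ∃ f : G → M, ∀ x y, μ.toFun x y = ν.toFun x y * (f y * f x / f (x * y)) := by
  unfold TwoCocycle.cls
  rw [groupCohomology.H2π_eq_iff]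
  constructor
  · rintro ⟨f, hf⟩
    let f' : G → M := fun g => Additive.toMul (show Additive M from f g)
    refine ⟨f', fun x y => ?_⟩
    have h : f' y / f' (x * y) * f' x = μ.toFun x y / ν.toFun x y := congrFun hf (x, y)
    rw [← div_mul_eq_mul_div, h, mul_div_cancel]
  · rintro ⟨f, hf⟩
    refine ⟨fun g => Additive.ofMul (f g), ?_⟩
    funext ⟨x, y⟩
    change Additive.ofMul (f y) - Additive.ofMul (f (x * y)) + Additive.ofMul (f x) =
      Additive.ofMul (μ.toFun x y) - Additive.ofMul (ν.toFun x y)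
    rw [hf]
    simp only [ofMul_mul, ofMul_div]
    abel

theorem TwoCocycle.exists_cls_eq (c : groupCohomology.H2 (trivRep G M)) :
    ∃ μ : TwoCocycle G M, μ.cls = c := by
  induction c using groupCohomology.H2_induction_on with
  | h x =>
    refine ⟨⟨fun g h => (x.1 (g, h)).toMul, fun a b c => ?_⟩, rfl⟩
    have h := (groupCohomology.mem_cocycles₂_iff (A := trivRep G M) _).1 x.2 a b c
    exact (congrArg Additive.toMul h).symm

/-- Extracts an explicit `2`-cochain `η` from an equality of classes. Every invariant of classes in
`H³` below is checked by showing that the contribution of `η` cancels. -/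
theorem ThreeCocycle.exists_of_cls_eq {μ ν : ThreeCocycle G M} (h : μ.cls = ν.cls) :
    ∃ η : G → G → M, ∀ x y z, μ.toFun x y z =
      ν.toFun x y z * (η y z * η x (y * z) / (η (x * y) z * η x y)) := by
  have h0 : groupCohomology.π (trivRep G M) 3
      (groupCohomology.cocyclesMk (A := trivRep G M) _ μ.d_eq_zero -
       groupCohomology.cocyclesMk (A := trivRep G M) _ ν.d_eq_zero) = 0 := by
    rw [map_sub]; exact sub_eq_zero.2 h
  obtain ⟨η, hη⟩ : ∃ η : (Fin 2 → G) → Additive M,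
    inhomogeneousCochains.d (trivRep G M) 2 η =
      (fun g => Additive.ofMul (μ.toFun (g 0) (g 1) (g 2))) -
      (fun g => Additive.ofMul (ν.toFun (g 0) (g 1) (g 2))) := by
    -- Cohomology is the cokernel of the map from `2`-cochains to `3`-cocycles, so a cocycle of
    -- class zero lifts to a `2`-cochain.
    let S := ShortComplex.mk _ _ ((groupCohomology.inhomogeneousCochains (trivRep G M)).toCycles_comp_homologyπ 2 3)
    have hS : S.Exact := S.exact_of_g_is_cokernel
      ((groupCohomology.inhomogeneousCochains (trivRep G M)).homologyIsCokernel 2 3 (by simp))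
    obtain ⟨η, hη⟩ := (ShortComplex.moduleCat_exact_iff S).1 hS _ h0
    refine ⟨η, ?_⟩
    have h1 := congrArg (groupCohomology.iCocycles (trivRep G M) 3).hom hη
    have h2 : (groupCohomology.iCocycles (trivRep G M) 3).hom (S.f.hom η) =
        inhomogeneousCochains.d (trivRep G M) 2 η := by
      rw [← groupCohomology.inhomogeneousCochains.d_def,
        ← (groupCohomology.inhomogeneousCochains (trivRep G M)).toCycles_i]
      rfl
    rw [← h2, h1]
    refine (map_sub (groupCohomology.iCocycles (trivRep G M) 3).hom _ _).trans ?_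
    exact (congrArg₂ (· - ·) (groupCohomology.iCocycles_mk _ μ.d_eq_zero)
      (groupCohomology.iCocycles_mk _ ν.d_eq_zero))
  refine ⟨fun x y => (η ![x, y]).toMul, fun x y z => ?_⟩
  have key : (η ![y, z] + ((-1 : ULift.{u} ℤ) ^ 1 • η ![x * y, z] +
      (-1 : ULift.{u} ℤ) ^ 2 • η ![x, y * z] + (-1 : ULift.{u} ℤ) ^ 3 • η ![x, y]) : Additive M) =
      Additive.ofMul (μ.toFun x y z) - Additive.ofMul (ν.toFun x y z) := by
    refine Eq.trans ?_ (congrFun hη ![x, y, z])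
    refine Eq.trans ?_ (inhomogeneousCochains.d_hom_apply (trivRep G M) 2 _ ![x, y, z]).symm
    refine congrArg₂ (· + ·) (congrArg η ?_) ?_
    · funext i; fin_cases i <;> rfl
    refine Eq.trans ?_ (Fin.sum_univ_three _).symm
    refine congrArg₂ (· + ·) (congrArg₂ (· + ·) ?_ ?_) ?_
    all_goals
      refine congrArg₂ (· • ·) rfl (congrArg η ?_)
      funext i; fin_cases i <;> rfl
  have h3 : (-1 : ULift.{u} ℤ) ^ 3 = -1 := by norm_num
  rw [h3, pow_one, neg_one_sq, one_smul, neg_smul, neg_smul, one_smul, one_smul] at key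
  have h2 := congrArg Additive.toMul key
  simp only [toMul_add, toMul_sub, toMul_ofMul, toMul_neg] at h2
  rw [← div_eq_iff_eq_mul', ← h2]
  apply Additive.ofMul.injective
  simp only [ofMul_mul, ofMul_div, ofMul_inv]
  abel

end classes

/-! ### Symmetric `2`-cocycles with divisible values -/

section symmetric

variable {G M : Type*} [CommGroup G] [CommGroup M]

/-- The underlying set of the extension of `G` by `M` attached to a symmetric `2`-cocycle. -/
@[ext]
structure SymmExtension (μ : G → G → M) where
  fst : M
  snd : G

theorem cocycle_one_left {μ : G → G → M}
    (hμ : ∀ x y z, μ y z * μ x (y * z) = μ (x * y) z * μ x y) (x : G) : μ 1 x = μ 1 1 := by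
  have h := hμ 1 1 x
  simp only [one_mul] at h
  exact mul_left_cancel h

/-- The group law of the extension attached to a symmetric `2`-cocycle. -/
abbrev SymmExtension.commGroup {μ : G → G → M}
    (hμ : ∀ x y z, μ y z * μ x (y * z) = μ (x * y) z * μ x y) (hs : ∀ x y, μ x y = μ y x) :
    CommGroup (SymmExtension μ) :=
  letI : Mul (SymmExtension μ) := ⟨fun a b => ⟨a.1 * b.1 * μ a.2 b.2, a.2 * b.2⟩⟩
  -- Since `μ` is not assumed normalized, the neutral element carries the correction `(μ 1 1)⁻¹`.
  letI : One (SymmExtension μ) := ⟨⟨(μ 1 1)⁻¹, 1⟩⟩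
  letI : Inv (SymmExtension μ) := ⟨fun a => ⟨a.1⁻¹ * (μ 1 1)⁻¹ * (μ a.2⁻¹ a.2)⁻¹, a.2⁻¹⟩⟩
  { Group.ofLeftAxioms (G := SymmExtension μ)
      (fun a b c => by
        apply SymmExtension.ext
        · change a.1 * b.1 * μ a.2 b.2 * c.1 * μ (a.2 * b.2) c.2 =
            a.1 * (b.1 * c.1 * μ b.2 c.2) * μ a.2 (b.2 * c.2)
          have h := hμ a.2 b.2 c.2
          calc _ = a.1 * b.1 * c.1 * (μ (a.2 * b.2) c.2 * μ a.2 b.2) := by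
                apply Additive.ofMul.injective; simp only [ofMul_mul]; abel
            _ = _ := by
                rw [← h]; apply Additive.ofMul.injective; simp only [ofMul_mul]; abel
        · exact mul_assoc _ _ _)
      (fun a => by
        apply SymmExtension.ext
        · change (μ 1 1)⁻¹ * a.1 * μ 1 a.2 = a.1
          rw [cocycle_one_left hμ a.2, mul_right_comm, inv_mul_cancel, one_mul]
        · exact one_mul _)
      (fun a => by
        apply SymmExtension.ext
        · change a.1⁻¹ * (μ 1 1)⁻¹ * (μ a.2⁻¹ a.2)⁻¹ * a.1 * μ a.2⁻¹ a.2 = (μ 1 1)⁻¹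
          apply Additive.ofMul.injective; simp only [ofMul_mul, ofMul_inv]; abel
        · exact inv_mul_cancel _) with
    mul_comm := fun a b => by
      apply SymmExtension.ext
      · change a.1 * b.1 * μ a.2 b.2 = b.1 * a.1 * μ b.2 a.2
        rw [hs, mul_comm a.1]
      · exact mul_comm _ _ }

/-- A symmetric `2`-cocycle with values in a divisible group is a coboundary. -/
theorem exists_coboundary_of_symm (hM : Module.Baer ℤ (Additive M)) {μ : G → G → M}
    (hμ : ∀ x y z, μ y z * μ x (y * z) = μ (x * y) z * μ x y) (hs : ∀ x y, μ x y = μ y x) :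
    ∃ f : G → M, ∀ x y, μ x y = f y * f x / f (x * y) := by
  let _ := SymmExtension.commGroup hμ hs
  have mul_def : ∀ a b : SymmExtension μ, a * b = ⟨a.1 * b.1 * μ a.2 b.2, a.2 * b.2⟩ :=
    fun _ _ => rfl
  let i : M →* SymmExtension μ := MonoidHom.mk' (fun a => ⟨a * (μ 1 1)⁻¹, 1⟩) fun a b => by
    rw [mul_def]
    apply SymmExtension.ext
    · apply Additive.ofMul.injective; simp only [ofMul_mul, ofMul_inv]; abel
    · exact (one_mul _).symm
  have hi : Function.Injective i.toAdditive := fun a b h => by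
    have h' : a.toMul * (μ 1 1)⁻¹ = b.toMul * (μ 1 1)⁻¹ := congrArg (fun z => SymmExtension.fst z.toMul) h
    exact congrArg Additive.ofMul (mul_right_cancel h' : a.toMul = b.toMul)
  -- The extension is abelian because `μ` is symmetric, so injectivity of `M` over `ℤ` gives a
  -- retraction onto `M`.
  obtain ⟨r, hr⟩ : ∃ r : Additive (SymmExtension μ) →+ Additive M,
      r.comp i.toAdditive = AddMonoidHom.id (Additive M) :=
    hM.extension_property_addMonoidHom i.toAdditive hi (AddMonoidHom.id (Additive M))
  let r' : SymmExtension μ →* M := MonoidHom.toAdditive.symm r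
  have hr' : ∀ a, r' (i a) = a := fun a => DFunLike.congr_fun hr (Additive.ofMul a)
  -- In the extension `(1, x)(1, y) = i(μ x y)(1, xy)`. Applying the retraction exhibits `μ` as the
  -- coboundary of `g ↦ r'(1, g)`.
  refine ⟨fun g => r' ⟨1, g⟩, fun x y => ?_⟩
  rw [eq_div_iff_mul_eq', mul_comm, ← hr' (μ x y), ← map_mul, ← map_mul, mul_comm (SymmExtension.mk 1 y),
    mul_comm (SymmExtension.mk 1 (x * y))]
  congr 1
  rw [mul_def, mul_def]
  apply SymmExtension.ext
  · change μ x y * (μ 1 1)⁻¹ * 1 * μ 1 (x * y) = 1 * 1 * μ x y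
    rw [cocycle_one_left hμ (x * y)]; simp
  · exact one_mul _

/-- The ratio `μ x z / μ z x` is the commutator of lifts of `x` and `z` in the central extension,
hence multiplicative in `x`. Concretely, the cocycle relations at `(x, y, z)`, `(z, x, y)` and `(x,
z, y)` are combined. -/
theorem cocycle_comm_mul_left {μ : G → G → M}
    (hμ : ∀ x y z, μ y z * μ x (y * z) = μ (x * y) z * μ x y) (x y z : G) :
    μ (x * y) z / μ z (x * y) = (μ x z / μ z x) * (μ y z / μ z y) := by
  have h1 := congrArg Additive.ofMul (hμ x y z)
  have h2 := congrArg Additive.ofMul (hμ z x y)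
  have h3 := congrArg Additive.ofMul (hμ x z y)
  rw [mul_comm z y] at h3
  rw [mul_comm z x] at h2
  apply Additive.ofMul.injective
  simp only [ofMul_mul, ofMul_div] at h1 h2 h3 ⊢
  rw [← sub_eq_zero] at h1 h2 h3 ⊢
  have h := congrArg₂ (· - ·) (congrArg₂ (· + ·) h1 h2) h3
  simp only [sub_zero, add_zero] at h
  rw [← neg_eq_zero, ← h]
  abel

end symmetric

/-- Roots exist in an algebraically closed field, so `kˣ` is divisible, and divisible abelian groups
are injective by Baer's criterion. -/
theorem baer_units (k : Type*) [Field k] [IsAlgClosed k] [CharZero k] :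
    Module.Baer ℤ (Additive kˣ) := by
  let _ : DivisibleBy (Additive kˣ) ℕ := divisibleByOfSMulRightSurj _ _ fun {n} hn a => by
    obtain ⟨z, hz⟩ := IsAlgClosed.exists_pow_nat_eq (a.toMul : k) (Nat.pos_of_ne_zero hn)
    have hz0 : z ≠ 0 := by
      rintro rfl
      rw [zero_pow hn] at hz
      exact a.toMul.ne_zero hz.symm
    exact ⟨Additive.ofMul (Units.mk0 z hz0), Units.ext hz⟩
  let _ : DivisibleBy (Additive kˣ) ℤ := AddGroup.divisibleByIntOfDivisibleByNat _
  exact Module.Baer.of_divisible _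

/-! ### Characters and `2`-cocycles of an elementary abelian group -/

section coordinates

variable {p : ℕ} [Fact p.Prime] {k : Type*} [Field k]

theorem rootPow_zero (ξ : kˣ) : rootPow ξ (0 : ZMod p) = 1 := by simp [rootPow]

theorem rootPow_neg {ξ : kˣ} (hξ : IsPrimitiveRoot ξ p) (a : ZMod p) :
    rootPow ξ (-a) = (rootPow ξ a)⁻¹ :=
  eq_inv_of_mul_eq_one_left (by rw [← rootPow_add hξ, neg_add_cancel, rootPow_zero])

theorem rootPow_sub {ξ : kˣ} (hξ : IsPrimitiveRoot ξ p) (a b : ZMod p) :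
    rootPow ξ (a - b) = rootPow ξ a / rootPow ξ b := by
  rw [sub_eq_add_neg, rootPow_add hξ, rootPow_neg hξ, div_eq_mul_inv]

theorem rootPow_injective {ξ : kˣ} (hξ : IsPrimitiveRoot ξ p) :
    Function.Injective (rootPow ξ : ZMod p → kˣ) := fun _ _ h =>
  ZMod.val_injective p (hξ.pow_inj (ZMod.val_lt _) (ZMod.val_lt _) h)

theorem exists_rootPow_eq {ξ : kˣ} (hξ : IsPrimitiveRoot ξ p) {z : kˣ} (hz : z ^ p = 1) :
    ∃ a : ZMod p, rootPow ξ a = z := by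
  have : NeZero p := ⟨(Fact.out : p.Prime).ne_zero⟩
  have hξ' : IsPrimitiveRoot (ξ : k) p := IsPrimitiveRoot.coe_units_iff.2 hξ
  obtain ⟨i, hi, h⟩ := hξ'.eq_pow_of_pow_eq_one (ξ := (z : k))
    (by rw [← Units.val_pow_eq_pow_val, hz, Units.val_one])
  refine ⟨i, Units.ext ?_⟩
  rw [rootPow, ZMod.val_cast_of_lt hi]
  exact_mod_cast h

/-- `rootPow` as a homomorphism. -/
def rootPowHom {ξ : kˣ} (hξ : IsPrimitiveRoot ξ p) : Multiplicative (ZMod p) →* kˣ :=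
  MonoidHom.mk' (fun a => rootPow ξ a.toAdd) fun _ _ => rootPow_add hξ _ _

variable {G : Type*} [CommGroup G] {n : ℕ} (e : G ≃* Multiplicative (Fin n → ZMod p))

/-- The coordinates on an elementary abelian group. -/
def coordinate (i : Fin n) (g : G) : ZMod p := (e g).toAdd i

@[simp] theorem coordinate_mul (i : Fin n) (g h : G) :
    coordinate e i (g * h) = coordinate e i g + coordinate e i h := by
  simp [coordinate]

/-- The basis of an elementary abelian group dual to the coordinates. -/
def basisElement (i : Fin n) : G := e.symm (Multiplicative.ofAdd (Pi.single i 1))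

theorem coordinate_basisElement (i j : Fin n) :
    coordinate e i (basisElement e j) = if i = j then 1 else 0 := by
  simp [coordinate, basisElement, Pi.single_apply]

theorem pow_prime_eq_one (e : G ≃* Multiplicative (Fin n → ZMod p)) (g : G) : g ^ p = 1 := by
  apply e.injective
  rw [map_pow, map_one]
  apply Multiplicative.toAdd.injective
  funext i
  simp

theorem hom_eq_of_basisElement {M : Type*} [CommGroup M] {f g : G →* M}
    (h : ∀ i, f (basisElement e i) = g (basisElement e i)) : f = g := by
  have key : (MonoidHom.toAdditiveRight (f.comp e.symm.toMonoidHom)) =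
      (MonoidHom.toAdditiveRight (g.comp e.symm.toMonoidHom)) := by
    refine AddMonoidHom.functions_ext _ _ _ fun i x => ?_
    have hx : (Pi.single i x : Fin n → ZMod p) = x.val • Pi.single i 1 := by
      funext j
      by_cases hj : j = i
      · subst hj; simp
      · simp [hj]
    rw [hx, map_nsmul, map_nsmul]
    congr 1
    exact congrArg Additive.ofMul (h i)
  ext x
  have := DFunLike.congr_fun key (e x).toAdd
  have h' : Additive.ofMul (f (e.symm (e x))) = Additive.ofMul (g (e.symm (e x))) := this
  simpa using h'

/-- The homomorphism `x ↦ ξ ^ ∑ i, c i * x_i`. -/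
def coordinateHom {ξ : kˣ} (hξ : IsPrimitiveRoot ξ p) (c : Fin n → ZMod p) : G →* kˣ :=
  MonoidHom.mk' (fun g => rootPow ξ (∑ i, c i * coordinate e i g)) fun g h => by
    rw [← rootPow_add hξ, ← Finset.sum_add_distrib]
    simp [mul_add]

theorem coordinateHom_basisElement {ξ : kˣ} (hξ : IsPrimitiveRoot ξ p) (c : Fin n → ZMod p)
    (i : Fin n) : coordinateHom e hξ c (basisElement e i) = rootPow ξ (c i) := by
  simp [coordinateHom, coordinate_basisElement]

/-- The group has exponent `p`, so a character takes `p`-th roots of unity on the basis, and these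
are powers of `ξ`. -/
theorem exists_coordinateHom_eq {ξ : kˣ} (hξ : IsPrimitiveRoot ξ p) (χ : G →* kˣ) :
    ∃ c : Fin n → ZMod p, χ = coordinateHom e hξ c := by
  have h : ∀ i, ∃ a : ZMod p, rootPow ξ a = χ (basisElement e i) := fun i =>
    exists_rootPow_eq hξ (by rw [← map_pow, pow_prime_eq_one e, map_one])
  choose c hc using h
  refine ⟨c, hom_eq_of_basisElement e fun i => ?_⟩
  rw [coordinateHom_basisElement, hc]

variable [IsAlgClosed k] [CharZero k]

/-- Every `2`-cocycle on an elementary abelian group is cohomologous to the exponential of an upper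
triangular bilinear form. -/
theorem exists_bilinear_normal_form {ξ : kˣ} (hξ : IsPrimitiveRoot ξ p) {μ : G → G → kˣ}
    (hμ : ∀ x y z, μ y z * μ x (y * z) = μ (x * y) z * μ x y) :
    ∃ (c : Fin n → Fin n → ZMod p) (f : G → kˣ), ∀ x y, μ x y =
      rootPow ξ (∑ i, ∑ j, if i < j then c i j * (coordinate e i x * coordinate e j y) else 0) *
        (f y * f x / f (x * y)) := by
  -- The commutator pairing of `μ`: an alternating bicharacter, whose matrix `c` in the basis is
  -- antisymmetric with zero diagonal.
  let κ : G → G →* kˣ := fun y => MonoidHom.mk' (fun x => μ x y / μ y x) fun x x' =>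
    cocycle_comm_mul_left hμ x x' y
  have hκ : ∀ x y, κ y x = μ x y / μ y x := fun _ _ => rfl
  have hκs : ∀ x y, κ y x = (κ x y)⁻¹ := fun x y => by rw [hκ, hκ, inv_div]
  have h : ∀ i, ∃ c : Fin n → ZMod p, κ (basisElement e i) = coordinateHom e hξ c := fun i =>
    exists_coordinateHom_eq e hξ _
  choose c hc using h
  have hca : ∀ i j, c i j = - c j i := fun i j => by
    apply rootPow_injective hξ
    rw [rootPow_neg hξ, ← coordinateHom_basisElement e hξ, ← coordinateHom_basisElement e hξ,
      ← hc, ← hc, hκs]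
  -- For `p = 2` antisymmetry does not give this; it holds because `κ x x = 1`.
  have hcd : ∀ i, c i i = 0 := fun i => by
    apply rootPow_injective hξ
    rw [rootPow_zero, ← coordinateHom_basisElement e hξ, ← hc, hκ, div_self']
  have hκc : ∀ x y, κ y x = rootPow ξ (∑ i, ∑ j, c j i * (coordinate e i x * coordinate e j y)) := by
    intro x y
    let κ' : G →* kˣ := MonoidHom.mk' (fun y => κ y x) fun y y' => by
      rw [hκs, map_mul, mul_inv, ← hκs, ← hκs]
    have : κ' = coordinateHom e hξ (fun j => ∑ i, c j i * coordinate e i x) := by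
      refine hom_eq_of_basisElement e fun j => ?_
      rw [coordinateHom_basisElement]
      change κ (basisElement e j) x = _
      rw [hc]
      rfl
    change κ' y = _
    rw [this]
    change rootPow ξ _ = _
    congr 1
    rw [Finset.sum_comm]
    refine Finset.sum_congr rfl fun j _ => ?_
    rw [Finset.sum_mul]
    exact Finset.sum_congr rfl fun i _ => by ring
  -- The part of the commutator form above the diagonal. Its antisymmetrization is `κ`, so `μ / ξ ^
  -- B` is symmetric; no division by `2` occurs.
  let B : G → G → ZMod p := fun x y =>
    ∑ i, ∑ j, if i < j then c j i * (coordinate e i x * coordinate e j y) else 0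
  have hB1 : ∀ x y z, B (x * y) z = B x z + B y z := fun x y z => by
    simp only [B, coordinate_mul, ← Finset.sum_add_distrib]
    refine Finset.sum_congr rfl fun i _ => Finset.sum_congr rfl fun j _ => ?_
    split_ifs <;> ring
  have hB2 : ∀ x y z, B x (y * z) = B x y + B x z := fun x y z => by
    simp only [B, coordinate_mul, ← Finset.sum_add_distrib]
    refine Finset.sum_congr rfl fun i _ => Finset.sum_congr rfl fun j _ => ?_
    split_ifs <;> ring
  have hBκ : ∀ x y, κ y x = rootPow ξ (B x y - B y x) := fun x y => by
    rw [hκc]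
    congr 1
    have : B y x = ∑ i, ∑ j, if j < i then c i j * (coordinate e j y * coordinate e i x) else 0 := by
      rw [Finset.sum_comm]
    rw [this]
    simp only [B, ← Finset.sum_sub_distrib]
    refine Finset.sum_congr rfl fun i _ => Finset.sum_congr rfl fun j _ => ?_
    rcases lt_trichotomy i j with hij | hij | hij
    · rw [if_pos hij, if_neg hij.not_gt, sub_zero]
    · subst hij; simp [hcd]
    · rw [if_neg hij.not_gt, if_pos hij, hca j i]; ring
  obtain ⟨f, hf⟩ := exists_coboundary_of_symm (baer_units k) (μ := fun x y => μ x y / rootPow ξ (B x y))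
    (fun x y z => by
      simp only [hB1, hB2, rootPow_add hξ]
      rw [div_mul_div_comm, hμ, div_mul_div_comm]
      congr 1
      apply Additive.ofMul.injective; simp only [ofMul_mul]; abel)
    (fun x y => by
      have := hBκ x y
      rw [hκ, rootPow_sub hξ, div_eq_div_iff_mul_eq_mul] at this
      rw [div_eq_div_iff_mul_eq_mul, this, mul_comm])
  exact ⟨fun i j => c j i, f, fun x y => by rw [← hf, mul_div_cancel]⟩

end coordinates

/-! ### Dimension shifting through a coinduced module -/

section exactness

/-- Any `b` differs from a chosen preimage of `g b` by an element of the range of `f`, so `A × C`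
surjects onto `B`. The default value of `Function.invFun` outside the range of `g` is harmless. -/
theorem finite_and_card_le_of_exact {A B C : Type*} [AddCommGroup A] [AddCommGroup B]
    [AddCommGroup C] (f : A →+ B) (g : B →+ C) (h : ∀ b, g b = 0 → ∃ a, f a = b) [Finite A]
    [Finite C] : Finite B ∧ Nat.card B ≤ Nat.card A * Nat.card C := by
  have hs : Function.Surjective fun x : A × C => f x.1 + Function.invFun g x.2 := fun b => by
    obtain ⟨a, ha⟩ := h (b - Function.invFun g (g b)) (by
      rw [map_sub, Function.invFun_eq (f := g) ⟨b, rfl⟩, sub_self])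
    exact ⟨(a, g b), by simp [ha]⟩
  refine ⟨Finite.of_surjective _ hs, ?_⟩
  rw [← Nat.card_prod]
  exact Nat.card_le_card_of_surjective _ hs

variable {p : ℕ} [NeZero p] {A : Type*} [AddCommGroup A]

theorem zmod_sum_range (F : ZMod p → A) : ∑ j ∈ Finset.range p, F j = ∑ a, F a := by
  refine Finset.sum_nbij' (fun j => (j : ZMod p)) ZMod.val ?_ ?_ ?_ ?_ ?_
  · simp
  · intro a _; exact Finset.mem_range.2 (ZMod.val_lt a)
  · intro j hj; exact ZMod.val_cast_of_lt (Finset.mem_range.1 hj)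
  · intro a _; exact ZMod.natCast_zmod_val a
  · simp

/-- Discrete integration: `H` is given by partial sums over the representatives `0, …, p - 1`. The
vanishing of the total sum is what makes the step from `p - 1` back to `0` correct. -/
theorem zmod_exists_difference {F : ZMod p → A} (h : ∑ a, F a = 0) :
    ∃ H : ZMod p → A, ∀ a, H (a + 1) - H a = F a := by
  refine ⟨fun a => ∑ j ∈ Finset.range a.val, F j, fun a => ?_⟩
  obtain ⟨m, hm, rfl⟩ : ∃ m < p, (m : ZMod p) = a := ⟨a.val, ZMod.val_lt a, ZMod.natCast_zmod_val a⟩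
  have h1 : ((m : ZMod p) + 1) = ((m + 1 : ℕ) : ZMod p) := by push_cast; rfl
  simp only [h1, ZMod.val_cast_of_lt hm]
  rcases Nat.lt_or_ge (m + 1) p with hlt | hge
  · rw [ZMod.val_cast_of_lt hlt, Finset.sum_range_succ, add_sub_cancel_left]
  · have hp : m + 1 = p := by omega
    rw [hp, ZMod.natCast_self, ZMod.val_zero, Finset.sum_range_zero, zero_sub]
    rw [← zmod_sum_range, show Finset.range p = Finset.range (m + 1) by rw [hp],
      Finset.sum_range_succ] at h
    exact neg_eq_of_add_eq_zero_right h

theorem zmod_eq_of_add_one {A : Type*} {H : ZMod p → A} (h : ∀ a, H (a + 1) = H a) (a : ZMod p) :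
    H a = H 0 := by
  rw [← ZMod.natCast_zmod_val a]
  induction a.val with
  | zero => simp
  | succ m ih => rw [Nat.cast_succ, h, ih]

end exactness

section counting

variable {G M : Type u} [CommGroup G] [CommGroup M] {p : ℕ} [NeZero p]
  (c : G →* Multiplicative (ZMod p))

/-- The representation coinduced from the trivial representation of the kernel of `c`. -/
abbrev coindKer (M : Type u) [CommGroup M] : Rep (ULift.{u} ℤ) G :=
  Rep.coind c.ker.subtype (trivRep c.ker M)

variable {c}

/-- Elements of the coinduced module are invariant under left translation by `c.ker`, so they are
functions on the quotient `ZMod p`. -/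
theorem coindKer_apply_eq (f : coindKer c M) {g h : G} (hgh : c g = c h) : f.1 g = f.1 h := by
  have hk : g * h⁻¹ ∈ c.ker := by rw [MonoidHom.mem_ker, map_mul, map_inv, hgh, mul_inv_cancel]
  have h1 := f.2 ⟨g * h⁻¹, hk⟩ h
  have h2 : c.ker.subtype ⟨g * h⁻¹, hk⟩ * h = g := inv_mul_cancel_right g h
  rw [h2] at h1
  exact h1

/-- A function on the quotient as an element of the coinduced representation. -/
def coindKerMk (F : ZMod p → Additive M) : coindKer c M :=
  ⟨fun g => F (c g).toAdd, fun s h => by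
    have h1 : c (c.ker.subtype s * h) = c h := by
      rw [map_mul, show c (c.ker.subtype s) = 1 from s.2, one_mul]
    change F _ = F _
    rw [h1]⟩

/-- The constant functions in the coinduced representation. -/
def coindKerConst : trivRep G M ⟶ coindKer c M :=
  Rep.ofHom
    { toFun m := coindKerMk fun _ => m
      map_add' _ _ := rfl
      map_smul' _ _ := rfl
      isIntertwining' _ := rfl }

variable (hc : Function.Surjective c)

/-- An element of the coinduced representation as a function on the quotient. -/
def coindKerFun (f : coindKer c M) (a : ZMod p) : Additive M :=
  f.1 (Function.surjInv hc (Multiplicative.ofAdd a))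

theorem coindKerFun_eq (f : coindKer c M) (g : G) : coindKerFun hc f (c g).toAdd = f.1 g :=
  coindKer_apply_eq f (Function.surjInv_eq hc _)

theorem coindKerFun_ρ (f : coindKer c M) (g : G) (a : ZMod p) :
    coindKerFun hc ((coindKer c M).ρ g f) a = coindKerFun hc f (a + (c g).toAdd) := by
  refine coindKer_apply_eq f ?_
  rw [map_mul, Function.surjInv_eq hc, Function.surjInv_eq hc]
  rfl

/-- The sum over the cosets of the kernel. -/
def coindKerSum : coindKer c M ⟶ trivRep G M :=
  Rep.ofHom
    { toFun f := ∑ a : ZMod p, coindKerFun hc f a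
      map_add' f f' := Finset.sum_add_distrib
      map_smul' r f := (Finset.smul_sum (r := r) (f := coindKerFun hc f)).symm
      isIntertwining' g := by
        apply LinearMap.ext
        intro f
        change ∑ a : ZMod p, coindKerFun hc ((coindKer c M).ρ g f) a = ∑ a, coindKerFun hc f a
        rw [Finset.sum_congr rfl fun a _ => coindKerFun_ρ hc f g a]
        exact Fintype.sum_equiv (Equiv.addRight (c g).toAdd) _ _ fun _ => rfl }

/-- The difference operator on the coinduced representation. -/
def coindKerDiff : coindKer c M ⟶ coindKer c M :=
  -- A lift of the generator `1` acts by the shift `a ↦ a + 1` of the argument. It is an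
  -- endomorphism of the representation because `G` is commutative.
  Rep.applyAsHom (coindKer c M) (Function.surjInv hc (Multiplicative.ofAdd 1)) - 𝟙 _

theorem coindKerFun_diff (f : coindKer c M) (a : ZMod p) :
    coindKerFun hc ((coindKerDiff hc).hom f) a = coindKerFun hc f (a + 1) - coindKerFun hc f a := by
  refine (congrArg (· - coindKerFun hc f a) (coindKerFun_ρ hc f
    (Function.surjInv hc (Multiplicative.ofAdd 1)) a)).trans ?_
  rw [Function.surjInv_eq hc]
  rfl

theorem coindKerFun_injective : Function.Injective (coindKerFun hc : coindKer c M → _) := by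
  intro f f' h
  apply Subtype.ext
  funext g
  rw [← coindKerFun_eq hc, ← coindKerFun_eq hc, h]

theorem coindKerFun_mk (F : ZMod p → Additive M) : coindKerFun hc (coindKerMk F) = F := by
  funext a
  change F (c (Function.surjInv hc _)).toAdd = F a
  rw [Function.surjInv_eq hc]
  rfl

theorem coindKerConst_comp_diff :
    (coindKerConst : trivRep G M ⟶ coindKer c M) ≫ coindKerDiff hc = 0 := by
  apply Rep.hom_ext
  apply Representation.IntertwiningMap.ext
  apply LinearMap.ext
  intro m
  apply coindKerFun_injective hc
  funext a
  refine (coindKerFun_diff hc _ a).trans ?_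
  exact sub_self (G := Additive M) m

theorem coindKerDiff_comp_sum :
    (coindKerDiff hc : coindKer c M ⟶ coindKer c M) ≫ coindKerSum hc = 0 := by
  apply Rep.hom_ext
  apply Representation.IntertwiningMap.ext
  apply LinearMap.ext
  intro f
  change ∑ a : ZMod p, coindKerFun hc ((coindKerDiff hc).hom f) a = 0
  rw [Finset.sum_congr rfl fun a _ => coindKerFun_diff hc f a]
  rw [Finset.sum_sub_distrib, sub_eq_zero]
  exact Fintype.sum_equiv (Equiv.addRight 1) _ _ fun _ => rfl

theorem Rep.exact_of_forall {R H : Type u} [CommRing R] [Group H] (X : ShortComplex (Rep.{u} R H))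
    (h : ∀ x : X.X₂, X.g.hom x = 0 → ∃ y : X.X₁, X.f.hom y = x) : X.Exact := by
  rw [← X.exact_map_iff_of_faithful (forget₂ (Rep.{u} R H) (ModuleCat R)),
    ShortComplex.moduleCat_exact_iff]
  exact h

/-- A function on `ZMod p` invariant under `a ↦ a + 1` is constant. -/
theorem coindKer_exact₁ :
    (ShortComplex.mk (coindKerConst : trivRep G M ⟶ coindKer c M) (coindKerDiff hc)
      (coindKerConst_comp_diff hc)).Exact := by
  refine Rep.exact_of_forall _ fun f hf => ?_
  have h1 : ∀ a, coindKerFun hc f (a + 1) = coindKerFun hc f a := fun a =>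
    sub_eq_zero.1 ((coindKerFun_diff hc f a).symm.trans (congrArg (coindKerFun hc · a) hf))
  refine ⟨show Additive M from coindKerFun hc f 0, coindKerFun_injective hc ?_⟩
  refine (coindKerFun_mk hc fun _ => coindKerFun hc f 0).trans ?_
  funext a
  exact (zmod_eq_of_add_one h1 a).symm

/-- A function on `ZMod p` with zero sum is a difference. With `coindKer_exact₁` this gives the
exact sequence `0 → M → Coind → Coind → M → 0`. -/
theorem coindKer_exact₂ :
    (ShortComplex.mk (coindKerDiff hc : coindKer c M ⟶ coindKer c M) (coindKerSum hc)
      (coindKerDiff_comp_sum hc)).Exact := by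
  refine Rep.exact_of_forall _ fun f hf => ?_
  obtain ⟨H, hH⟩ := zmod_exists_difference (F := coindKerFun hc f) hf
  refine ⟨coindKerMk H, coindKerFun_injective hc ?_⟩
  funext a
  refine (coindKerFun_diff hc _ a).trans ?_
  rw [coindKerFun_mk]
  exact hH a

theorem coindKerConst_mono : Mono (coindKerConst : trivRep G M ⟶ coindKer c M) := by
  rw [Rep.mono_iff_injective]
  intro a b h
  exact congrFun (congrArg Subtype.val h) 1

theorem coindKerSum_epi : Epi (coindKerSum hc : coindKer c M ⟶ trivRep G M) := by
  rw [Rep.epi_iff_surjective]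
  intro m
  refine ⟨coindKerMk (Pi.single (M := fun _ => Additive M) 0 m), ?_⟩
  change ∑ a : ZMod p, coindKerFun hc (coindKerMk (Pi.single (M := fun _ => Additive M) 0 m)) a = m
  rw [coindKerFun_mk]
  exact Finset.sum_pi_single' 0 m Finset.univ |>.trans (if_pos (Finset.mem_univ _))

/-- The four-term sequence is cut at the kernel `Q` of the sum map; this is the half `0 → Q → Coind
→ M → 0`, and `coindKer_shortExact₁` is the half `0 → M → Coind → Q → 0`. -/
theorem coindKer_shortExact₂ :
    (ShortComplex.mk (Limits.kernel.ι (coindKerSum hc : coindKer c M ⟶ trivRep G M))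
      (coindKerSum hc) (Limits.kernel.condition _)).ShortExact where
  exact := ShortComplex.exact_of_f_is_kernel _ (Limits.kernelIsKernel _)
  mono_f := inferInstance
  epi_g := coindKerSum_epi hc

theorem coindKer_shortExact₁ :
    (ShortComplex.mk (coindKerConst : trivRep G M ⟶ coindKer c M)
      (Limits.kernel.lift (coindKerSum hc) (coindKerDiff hc) (coindKerDiff_comp_sum hc))
      (by rw [← cancel_mono (Limits.kernel.ι _), Category.assoc, Limits.kernel.lift_ι,
            coindKerConst_comp_diff, Limits.zero_comp])).ShortExact where
  exact := by
    -- Comparison with the complex of `coindKer_exact₁`: the identity on the first two terms and the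
    -- inclusion of `Q` on the third. As the latter is mono, exactness transfers.
    let φ : (ShortComplex.mk (coindKerConst : trivRep G M ⟶ coindKer c M)
      (Limits.kernel.lift (coindKerSum hc) (coindKerDiff hc) (coindKerDiff_comp_sum hc))
      (by rw [← cancel_mono (Limits.kernel.ι _), Category.assoc, Limits.kernel.lift_ι,
            coindKerConst_comp_diff, Limits.zero_comp])) ⟶
      (ShortComplex.mk (coindKerConst : trivRep G M ⟶ coindKer c M) (coindKerDiff hc)
      (coindKerConst_comp_diff hc)) :=
      { τ₁ := 𝟙 _, τ₂ := 𝟙 _, τ₃ := Limits.kernel.ι _ }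
    have : Epi φ.τ₁ := inferInstanceAs (Epi (𝟙 _))
    have : IsIso φ.τ₂ := inferInstanceAs (IsIso (𝟙 _))
    have : Mono φ.τ₃ := inferInstanceAs (Mono (Limits.kernel.ι _))
    exact (ShortComplex.exact_iff_of_epi_of_isIso_of_mono φ).2 (coindKer_exact₁ hc)
  mono_f := coindKerConst_mono
  epi_g := (ShortComplex.exact_iff_epi_kernel_lift _).1 (coindKer_exact₂ hc)

/-- Shapiro's lemma. -/
theorem finite_and_card_coindKer (i : ℕ) [Finite (groupCohomology (trivRep c.ker M) i)] :
    Finite (groupCohomology (coindKer c M) i) ∧ Nat.card (groupCohomology (coindKer c M) i) =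
      Nat.card (groupCohomology (trivRep c.ker M) i) := by
  let E := (groupCohomology.coindIso (trivRep c.ker M) i).toLinearEquiv.toEquiv
  exact ⟨Finite.of_equiv _ E.symm, Nat.card_congr E⟩

/-- The portion `Hⁱ(X₃) → Hⁱ⁺¹(X₁) → Hⁱ⁺¹(X₂)` of the long exact sequence. -/
theorem finite_and_card_of_shortExact {H : Type u} [Group H] {R : Type u} [CommRing R]
    {X : ShortComplex (Rep.{u} R H)} (hX : X.ShortExact) (i : ℕ)
    [Finite (groupCohomology X.X₃ i)] [Finite (groupCohomology X.X₂ (i + 1))] :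
    Finite (groupCohomology X.X₁ (i + 1)) ∧ Nat.card (groupCohomology X.X₁ (i + 1)) ≤
      Nat.card (groupCohomology X.X₃ i) * Nat.card (groupCohomology X.X₂ (i + 1)) :=
  finite_and_card_le_of_exact
    (groupCohomology.mapShortComplex₁ hX (i := i) rfl).f.hom.toAddMonoidHom
    (groupCohomology.mapShortComplex₁ hX (i := i) rfl).g.hom.toAddMonoidHom
    ((ShortComplex.moduleCat_exact_iff _).1 (groupCohomology.mapShortComplex₁_exact hX rfl))

-- With `K = ker c`, one half of the sequence bounds `|H²(G, Q)|` by `|H¹(G, M)| |H²(K, M)|`, the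
-- other bounds `|H³(G, M)|` by `|H²(G, Q)| |H³(K, M)|`.
include hc in
theorem finite_and_card_H3_le [Finite (groupCohomology (trivRep G M) 1)]
    [Finite (groupCohomology (trivRep c.ker M) 2)] [Finite (groupCohomology (trivRep c.ker M) 3)] :
    Finite (groupCohomology (trivRep G M) 3) ∧ Nat.card (groupCohomology (trivRep G M) 3) ≤
      Nat.card (groupCohomology (trivRep G M) 1) * Nat.card (groupCohomology (trivRep c.ker M) 2) *
        Nat.card (groupCohomology (trivRep c.ker M) 3) := by
  obtain ⟨f2, c2⟩ := finite_and_card_coindKer (c := c) (M := M) 2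
  obtain ⟨f3, c3⟩ := finite_and_card_coindKer (c := c) (M := M) 3
  obtain ⟨fQ, cQ⟩ := finite_and_card_of_shortExact (coindKer_shortExact₂ (M := M) hc) 1
  obtain ⟨fG, cG⟩ := finite_and_card_of_shortExact (coindKer_shortExact₁ (M := M) hc) 2
  refine ⟨fG, cG.trans ?_⟩
  rw [c3]
  rw [c2] at cQ
  exact Nat.mul_le_mul_right _ cQ

end counting

/-! ### Upper bounds for the orders of `H¹`, `H²` and `H³` -/

section numbers

/-- The number of pairs `i < j` in `Fin n`. -/
def numPairs (n : ℕ) : ℕ := ∑ i : Fin n, ∑ j : Fin n, if i < j then 1 else 0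

/-- The number of pairs `i ≤ j` in `Fin n`. -/
def numSymPairs (n : ℕ) : ℕ := ∑ i : Fin n, ∑ j : Fin n, if i ≤ j then 1 else 0

/-- The number of triples `i < j < l` in `Fin n`. -/
def numTriples (n : ℕ) : ℕ :=
  ∑ i : Fin n, ∑ j : Fin n, ∑ l : Fin n, if i < j ∧ j < l then 1 else 0

/-- Pairs containing the index `0` are split off, as are the triples in `numTriples_succ`. The
summands match the exponents contributed by `H¹(G)` and `H²(K)` in `finite_and_card_H3_le`. -/
theorem numSymPairs_succ (n : ℕ) : numSymPairs (n + 1) = n + 1 + numSymPairs n := by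
  simp only [numSymPairs, Fin.sum_univ_succ, Fin.succ_le_succ_iff, Fin.zero_le, if_true,
    Fin.le_zero_iff, Fin.succ_ne_zero, if_false, zero_add]
  simp [add_comm]

theorem numTriples_succ (n : ℕ) : numTriples (n + 1) = numPairs n + numTriples n := by
  simp only [numTriples, numPairs, Fin.sum_univ_succ, Fin.succ_lt_succ_iff, Fin.succ_pos,
    Fin.not_lt_zero, true_and, false_and, and_false, if_false, Finset.sum_const_zero, zero_add]

theorem card_pairs (n : ℕ) : Fintype.card {x : Fin n × Fin n // x.1 < x.2} = numPairs n := by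
  rw [Fintype.card_subtype, Finset.card_filter, Fintype.sum_prod_type, numPairs]

theorem card_symPairs (n : ℕ) : Fintype.card {x : Fin n × Fin n // x.1 ≤ x.2} = numSymPairs n := by
  rw [Fintype.card_subtype, Finset.card_filter, Fintype.sum_prod_type, numSymPairs]

theorem card_triples (n : ℕ) :
    Fintype.card {x : Fin n × Fin n × Fin n // x.1 < x.2.1 ∧ x.2.1 < x.2.2} = numTriples n := by
  rw [Fintype.card_subtype, Finset.card_filter, Fintype.sum_prod_type, numTriples]
  simp only [Fintype.sum_prod_type]

end numbers

section bounds

variable {p : ℕ} [Fact p.Prime] {k : Type u} [Field k] {G : Type u} [CommGroup G] {n : ℕ}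
  (e : G ≃* Multiplicative (Fin n → ZMod p)) {ξ : kˣ} (hξ : IsPrimitiveRoot ξ p)

/-- The exponential of an upper triangular bilinear form, as a `2`-cocycle. -/
def upperCocycle (c : Fin n → Fin n → ZMod p) : TwoCocycle G kˣ where
  toFun x y :=
    rootPow ξ (∑ i, ∑ j, if i < j then c i j * (coordinate e i x * coordinate e j y) else 0)
  cocycle x y z := by
    simp only [← rootPow_add hξ, coordinate_mul, ← Finset.sum_add_distrib]
    congr 1
    refine Finset.sum_congr rfl fun i _ => Finset.sum_congr rfl fun j _ => ?_
    split_ifs <;> ring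

theorem card_fun_zmod (p : ℕ) (ι : Type*) [Fintype ι] :
    Nat.card (ι → ZMod p) = p ^ Fintype.card ι := by
  rw [Nat.card_fun, Nat.card_zmod, Nat.card_eq_fintype_card]

include e hξ in
theorem finite_and_card_H1_le : Finite (groupCohomology (trivRep G kˣ) 1) ∧
    Nat.card (groupCohomology (trivRep G kˣ) 1) ≤ p ^ n := by
  have : NeZero p := ⟨(Fact.out : p.Prime).ne_zero⟩
  let F : (Fin n → ZMod p) → groupCohomology (trivRep G kˣ) 1 := fun c =>
    (groupCohomology.H1IsoOfIsTrivial (trivRep G kˣ)).inv.hom (coordinateHom e hξ c).toAdditive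
  have hF : Function.Surjective F := fun x => by
    let χ : Additive G →+ Additive kˣ :=
      (groupCohomology.H1IsoOfIsTrivial (trivRep G kˣ)).hom.hom x
    obtain ⟨c, hc⟩ := exists_coordinateHom_eq e hξ (MonoidHom.toAdditive.symm χ)
    refine ⟨c, ?_⟩
    have h1 : (coordinateHom e hξ c).toAdditive = χ := by rw [← hc]; rfl
    change (groupCohomology.H1IsoOfIsTrivial (trivRep G kˣ)).inv.hom _ = _
    rw [h1]
    exact (groupCohomology.H1IsoOfIsTrivial (trivRep G kˣ)).hom_inv_id_apply x
  refine ⟨Finite.of_surjective F hF, (Nat.card_le_card_of_surjective F hF).trans ?_⟩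
  rw [card_fun_zmod, Fintype.card_fin]

variable [IsAlgClosed k] [CharZero k]

theorem exists_upperCocycle_cls_eq (x : groupCohomology.H2 (trivRep G kˣ)) :
    ∃ c : Fin n → Fin n → ZMod p, x = (upperCocycle e hξ c).cls := by
  obtain ⟨μ, rfl⟩ := TwoCocycle.exists_cls_eq x
  obtain ⟨c, f, h⟩ := exists_bilinear_normal_form e hξ μ.cocycle
  exact ⟨c, (TwoCocycle.cls_eq_iff _ _).2 ⟨f, h⟩⟩

include e hξ in
theorem finite_and_card_H2_le : Finite (groupCohomology (trivRep G kˣ) 2) ∧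
    Nat.card (groupCohomology (trivRep G kˣ) 2) ≤ p ^ numPairs n := by
  have : NeZero p := ⟨(Fact.out : p.Prime).ne_zero⟩
  let F : ({x : Fin n × Fin n // x.1 < x.2} → ZMod p) → groupCohomology (trivRep G kˣ) 2 :=
    fun c => (upperCocycle e hξ fun i j => if h : i < j then c ⟨(i, j), h⟩ else 0).cls
  have hF : Function.Surjective F := fun x => by
    obtain ⟨c, rfl⟩ := exists_upperCocycle_cls_eq e hξ x
    refine ⟨fun x => c x.1.1 x.1.2, ?_⟩
    refine (TwoCocycle.cls_eq_iff _ _).2 ⟨1, fun x y => ?_⟩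
    simp only [upperCocycle, Pi.one_apply, mul_one, div_one]
    congr 1
    refine Finset.sum_congr rfl fun i _ => Finset.sum_congr rfl fun j _ => ?_
    split_ifs <;> rfl
  refine ⟨Finite.of_surjective F hF, (Nat.card_le_card_of_surjective F hF).trans ?_⟩
  rw [card_fun_zmod, card_pairs]

/-- The zeroth coordinate as a homomorphism. -/
def headHom {n : ℕ} (e : G ≃* Multiplicative (Fin (n + 1) → ZMod p)) : G →* Multiplicative (ZMod p) :=
  MonoidHom.mk' (fun g => Multiplicative.ofAdd (coordinate e 0 g)) fun g h => by
    rw [coordinate_mul, ofAdd_add]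

theorem headHom_surjective {n : ℕ} (e : G ≃* Multiplicative (Fin (n + 1) → ZMod p)) :
    Function.Surjective (headHom e) := fun a =>
  ⟨e.symm (Multiplicative.ofAdd fun _ => a.toAdd), by simp [headHom, coordinate]⟩

/-- The remaining coordinates on the kernel of the zeroth coordinate. -/
def kerHeadEquiv {n : ℕ} (e : G ≃* Multiplicative (Fin (n + 1) → ZMod p)) :
    (headHom e).ker ≃* Multiplicative (Fin n → ZMod p) :=
  MulEquiv.ofBijective
    (show (headHom e).ker →* Multiplicative (Fin n → ZMod p) from
      { toFun g := Multiplicative.ofAdd fun i : Fin n => coordinate e i.succ g.1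
        map_one' := by
          apply Multiplicative.toAdd.injective
          funext i
          simp [coordinate]
        map_mul' g h := by
          apply Multiplicative.toAdd.injective
          funext i
          exact coordinate_mul e _ _ _ })
    ⟨fun g h hgh => by
      apply Subtype.ext
      apply e.injective
      apply Multiplicative.toAdd.injective
      funext i
      refine Fin.cases ?_ (fun j => ?_) i
      · exact congrArg Multiplicative.toAdd (g.2.trans h.2.symm)
      · exact congrFun (congrArg Multiplicative.toAdd hgh) j,
    fun a => ⟨⟨e.symm (Multiplicative.ofAdd (Fin.cons 0 a.toAdd)), by
      rw [MonoidHom.mem_ker]; simp [headHom, coordinate]⟩, by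
        apply Multiplicative.toAdd.injective
        funext i
        change coordinate e i.succ (e.symm _) = _
        simp [coordinate]⟩⟩

end bounds

/-- Induction on `n`, splitting off the zeroth coordinate. The group is quantified inside the
induction because the hypothesis is applied to the kernel of that coordinate. The bound is attained,
as `exists_cls_eq_alt_add_sym` shows. -/
theorem finite_and_card_H3_le_pow {p : ℕ} [Fact p.Prime] {k : Type u} [Field k] [IsAlgClosed k]
    [CharZero k] {ξ : kˣ} (hξ : IsPrimitiveRoot ξ p) (n : ℕ) :
    ∀ (G : Type u) [CommGroup G] (_ : G ≃* Multiplicative (Fin n → ZMod p)),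
      Finite (groupCohomology (trivRep G kˣ) 3) ∧
      Nat.card (groupCohomology (trivRep G kˣ) 3) ≤ p ^ (numTriples n + numSymPairs n) := by
  have : NeZero p := ⟨(Fact.out : p.Prime).ne_zero⟩
  induction n with
  | zero =>
    intro G _ e
    have : Subsingleton G := e.toEquiv.subsingleton
    have h := isZero_groupCohomology_succ_of_subsingleton (trivRep G kˣ) 2
    have : Subsingleton (groupCohomology (trivRep G kˣ) 3) := ModuleCat.subsingleton_of_isZero h
    refine ⟨inferInstance, ?_⟩
    rw [Nat.card_of_subsingleton 0]
    exact Nat.one_le_pow _ _ (NeZero.pos p)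
  | succ n ih =>
    intro G _ e
    obtain ⟨f1, c1⟩ := finite_and_card_H1_le e hξ
    obtain ⟨f2, c2⟩ := finite_and_card_H2_le (kerHeadEquiv e) hξ
    obtain ⟨f3, c3⟩ := ih (headHom e).ker (kerHeadEquiv e)
    obtain ⟨f, c⟩ := finite_and_card_H3_le (M := kˣ) (headHom_surjective e)
    refine ⟨f, c.trans ((Nat.mul_le_mul (Nat.mul_le_mul c1 c2) c3).trans_eq ?_)⟩
    rw [← pow_add, ← pow_add, numTriples_succ, numSymPairs_succ]
    congr 1
    ring

/-! ### The isomorphism `⋀² V* ≅ H²(V, kˣ)` -/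

section secondCohomology

variable {p : ℕ} [Fact p.Prime] {k : Type u} [Field k]
  {V : Type u} [AddCommGroup V] [Module (ZMod p) V] {ξ : kˣ} (hξ : IsPrimitiveRoot ξ p)

@[ext]
theorem TwoCocycle.ext {G M : Type u} [Group G] [CommGroup M] {μ ν : TwoCocycle G M}
    (h : ∀ x y, μ.toFun x y = ν.toFun x y) : μ = ν := by
  cases μ; cases ν; congr; funext x y; exact h x y

/-- The `2`-cocycle `(u, v) ↦ ξ ^ B(u, v)` attached to a bilinear form `B`. -/
def formCocycle (B : V →ₗ[ZMod p] V →ₗ[ZMod p] ZMod p) : TwoCocycle (Multiplicative V) kˣ where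
  toFun u v := rootPow ξ (B u.toAdd v.toAdd)
  cocycle u v w := by
    simp only [← rootPow_add hξ, toAdd_mul, map_add, LinearMap.add_apply]
    congr 1
    ring

/-- The class of `formCocycle`, as a homomorphism. -/
def formClass : (V →ₗ[ZMod p] V →ₗ[ZMod p] ZMod p) →+
    groupCohomology.H2 (trivRep (Multiplicative V) kˣ) :=
  AddMonoidHom.mk' (fun B => (formCocycle hξ B).cls) fun B B' => by
    rw [← TwoCocycle.cls_mul]
    congr 1
    exact TwoCocycle.ext fun _ _ => rootPow_add hξ _ _

theorem bilinCocycle_cls (x y : Module.Dual (ZMod p) V) :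
    (bilinCocycle hξ x y).cls = formClass hξ (x.smulRight y) := by
  change _ = (formCocycle hξ _).cls
  congr 1

variable {n : ℕ} (b : Module.Basis (Fin n) (ZMod p) V)

/-- The coordinates of `V` in a basis, as an isomorphism of multiplicative groups. -/
def coordEquiv : Multiplicative V ≃* Multiplicative (Fin n → ZMod p) :=
  AddEquiv.toMultiplicative b.equivFun.toAddEquiv

/-- An upper triangular bilinear form. -/
def upperForm (c : Fin n → Fin n → ZMod p) : V →ₗ[ZMod p] V →ₗ[ZMod p] ZMod p :=
  ∑ i, ∑ j, if i < j then c i j • (b.coord i).smulRight (b.coord j) else 0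

theorem upperForm_apply (c : Fin n → Fin n → ZMod p) (u v : V) :
    upperForm b c u v = ∑ i, ∑ j, if i < j then c i j * (b.coord i u * b.coord j v) else 0 := by
  simp only [upperForm, LinearMap.sum_apply]
  refine Finset.sum_congr rfl fun i _ => Finset.sum_congr rfl fun j _ => ?_
  split_ifs <;> simp

theorem upperCocycle_cls (c : Fin n → Fin n → ZMod p) :
    (upperCocycle (coordEquiv b) hξ c).cls = formClass hξ (upperForm b c) := by
  change _ = (formCocycle hξ _).cls
  congr 1
  refine TwoCocycle.ext fun u v => ?_
  change rootPow ξ _ = rootPow ξ _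
  rw [upperForm_apply]
  rfl

/-- Both vectors are expanded in the dual basis; diagonal terms vanish and terms below the diagonal
are folded, with a sign, onto those above it. -/
theorem wedge₂_eq_sum (x y : Module.Dual (ZMod p) V) :
    ∃ c : Fin n → Fin n → ZMod p, wedge₂ x y =
      ∑ i, ∑ j, if i < j then c i j • wedge₂ (b.coord i) (b.coord j) else 0 := by
  have hx : ∀ z : Module.Dual (ZMod p) V, z = ∑ i, z (b i) • b.coord i := fun z => by
    refine b.ext fun j => ?_
    simp
  have hsum_left : ∀ (s : Finset (Fin n)) (f : Fin n → Module.Dual (ZMod p) V) (z),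
      wedge₂ (∑ i ∈ s, f i) z = ∑ i ∈ s, wedge₂ (f i) z := fun s f z =>
    map_sum (AddMonoidHom.mk' (fun x => wedge₂ x z) fun _ _ => wedge₂_add_left _ _ _) f s
  have hsum_right : ∀ (s : Finset (Fin n)) (f : Fin n → Module.Dual (ZMod p) V) (z),
      wedge₂ z (∑ i ∈ s, f i) = ∑ i ∈ s, wedge₂ z (f i) := fun s f z =>
    map_sum (AddMonoidHom.mk' (fun x => wedge₂ z x) fun _ _ => wedge₂_add_right _ _ _) f s
  refine ⟨fun i j => x (b i) * y (b j) - x (b j) * y (b i), ?_⟩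
  have h1 : wedge₂ x y = ∑ i, ∑ j, (x (b i) * y (b j)) • wedge₂ (b.coord i) (b.coord j) := by
    conv_lhs => rw [hx x, hx y]
    rw [hsum_left]
    refine Finset.sum_congr rfl fun i _ => ?_
    rw [hsum_right]
    refine Finset.sum_congr rfl fun j _ => ?_
    rw [wedge₂_smul_left, wedge₂_smul_right, smul_smul]
  have h2 : ∑ i, ∑ j, (if j < i then (x (b i) * y (b j)) • wedge₂ (b.coord i) (b.coord j) else 0) =
      ∑ i, ∑ j, if i < j then -((x (b j) * y (b i)) • wedge₂ (b.coord i) (b.coord j)) else 0 := by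
    rw [Finset.sum_comm]
    refine Finset.sum_congr rfl fun i _ => Finset.sum_congr rfl fun j _ => ?_
    rw [wedge₂_swap (b.coord j), smul_neg]
  have h3 : ∀ i j, (x (b i) * y (b j)) • wedge₂ (b.coord i) (b.coord j) =
      (if i < j then (x (b i) * y (b j)) • wedge₂ (b.coord i) (b.coord j) else 0) +
      (if j < i then (x (b i) * y (b j)) • wedge₂ (b.coord i) (b.coord j) else 0) := by
    intro i j
    rcases lt_trichotomy i j with h | h | h
    · rw [if_pos h, if_neg h.not_gt, add_zero]
    · subst h; simp [wedge₂_self]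
    · rw [if_neg h.not_gt, if_pos h, zero_add]
  rw [h1, Finset.sum_congr rfl fun i _ => Finset.sum_congr rfl fun j _ => h3 i j]
  simp only [Finset.sum_add_distrib]
  rw [h2]
  simp only [← Finset.sum_add_distrib]
  refine Finset.sum_congr rfl fun i _ => Finset.sum_congr rfl fun j _ => ?_
  split_ifs
  · exact ((sub_smul _ _ _).trans (sub_eq_add_neg _ _)).symm
  · rw [add_zero]

theorem exteriorSquare_eq_sum (w : ⋀[ZMod p]^2 (Module.Dual (ZMod p) V)) :
    ∃ c : Fin n → Fin n → ZMod p, w =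
      ∑ i, ∑ j, if i < j then c i j • wedge₂ (b.coord i) (b.coord j) else 0 := by
  have hw : w ∈ Submodule.span (ZMod p)
      (Set.range (exteriorPower.ιMulti (ZMod p) 2 (M := Module.Dual (ZMod p) V))) := by
    rw [exteriorPower.ιMulti_span]; trivial
  induction hw using Submodule.span_induction with
  | mem w hw =>
    obtain ⟨m, rfl⟩ := hw
    have : m = ![m 0, m 1] := by funext i; fin_cases i <;> rfl
    rw [this]
    exact wedge₂_eq_sum b (m 0) (m 1)
  | zero => exact ⟨0, by simp⟩
  | add w w' _ _ h h' =>
    obtain ⟨c, rfl⟩ := h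
    obtain ⟨c', rfl⟩ := h'
    refine ⟨c + c', ?_⟩
    simp only [← Finset.sum_add_distrib]
    refine Finset.sum_congr rfl fun i _ => Finset.sum_congr rfl fun j _ => ?_
    split_ifs <;> simp [add_smul]
  | smul r w _ h =>
    obtain ⟨c, rfl⟩ := h
    refine ⟨r • c, ?_⟩
    simp only [Finset.smul_sum]
    refine Finset.sum_congr rfl fun i _ => Finset.sum_congr rfl fun j _ => ?_
    split_ifs <;> simp [mul_smul]

theorem TwoCocycle.cls_eq_zero_iff {G M : Type u} [Group G] [CommGroup M] (μ : TwoCocycle G M) :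
    μ.cls = 0 ↔ ∃ f : G → M, ∀ x y, μ.toFun x y = f y * f x / f (x * y) := by
  let ν : TwoCocycle G M := ⟨fun _ _ => 1, fun _ _ _ => rfl⟩
  have hν : ν.cls = 0 := by
    -- The constant cocycle `1` is its own square, so its class equals its double and is zero.
    have h := TwoCocycle.cls_mul ν ν
    have h1 : ν * ν = ν := TwoCocycle.ext fun _ _ => one_mul 1
    rw [h1] at h
    exact left_eq_add.1 h
  rw [← hν, TwoCocycle.cls_eq_iff]
  simp only [ν, one_mul]

variable [IsAlgClosed k] [CharZero k]

/-- Applied to `x ⊗ x`, this is the alternating property needed to descend to `⋀²`, also for `p =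
2`. -/
theorem formClass_eq_zero_of_symm {B : V →ₗ[ZMod p] V →ₗ[ZMod p] ZMod p}
    (hB : ∀ u v, B u v = B v u) : formClass hξ B = 0 :=
  (TwoCocycle.cls_eq_zero_iff _).2 (exists_coboundary_of_symm (baer_units k)
    (formCocycle hξ B).cocycle fun _ _ => congrArg (rootPow ξ) (hB _ _))

include hξ b in
-- Makes `H²` a vector space over `ZMod p`, so that the universal property of the exterior square
-- applies to it.
theorem nsmul_H2_eq_zero (c : groupCohomology.H2 (trivRep (Multiplicative V) kˣ)) : p • c = 0 := by
  obtain ⟨c, rfl⟩ := exists_upperCocycle_cls_eq (coordEquiv b) hξ c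
  rw [upperCocycle_cls, ← map_nsmul, ← Nat.cast_smul_eq_nsmul (ZMod p),
    CharP.cast_eq_zero, zero_smul, map_zero]

-- Over the prime field additive maps are linear, so a biadditive alternating map into a group
-- killed by `p` suffices. The module structure on `H` stays internal to the proof.
omit [IsAlgClosed k] [CharZero k] in
theorem exists_exteriorSquare_lift {H : Type*} [AddCommGroup H] (hH : ∀ h : H, p • h = 0)
    {W : Type*} [AddCommGroup W] [Module (ZMod p) W] (D : W → W → H)
    (hl : ∀ x x' y, D (x + x') y = D x y + D x' y) (hr : ∀ x y y', D x (y + y') = D x y + D x y')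
    (hd : ∀ x, D x x = 0) :
    ∃ L : ⋀[ZMod p]^2 W →+ H, ∀ x y, L (exteriorPower.ιMulti (ZMod p) 2 ![x, y]) = D x y := by
  let _ : Module (ZMod p) H := AddCommGroup.zmodModule hH
  let A : W [⋀^Fin 2]→ₗ[ZMod p] H :=
    { toFun m := D (m 0) (m 1)
      map_update_add' := @fun inst m i x y => by
        cases Subsingleton.elim inst (instDecidableEqFin 2)
        fin_cases i
        · exact hl x y (m 1)
        · exact hr (m 0) x y
      map_update_smul' := @fun inst m i c x => by
        cases Subsingleton.elim inst (instDecidableEqFin 2)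
        fin_cases i
        · exact ZMod.map_smul (AddMonoidHom.mk' (fun x => D x (m 1)) fun _ _ => hl _ _ _) c x
        · exact ZMod.map_smul (AddMonoidHom.mk' (fun x => D (m 0) x) fun _ _ => hr _ _ _) c x
      map_eq_zero_of_eq' m i j h hij := by
        have h01 : m 0 = m 1 := by
          fin_cases i <;> fin_cases j
          exacts [absurd rfl hij, h, h.symm, absurd rfl hij]
        change D (m 0) (m 1) = 0
        rw [h01, hd] }
  exact ⟨(exteriorPower.alternatingMapLinearEquiv A).toAddMonoidHom, fun x y =>
    exteriorPower.alternatingMapLinearEquiv_apply_ιMulti A ![x, y]⟩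

include b in
/-- The isomorphism `⋀² V* ≅ H²(V, kˣ)`. -/
theorem exists_exteriorSquare_equiv_H2 :
    ∃ Θ : ⋀[ZMod p]^2 (Module.Dual (ZMod p) V) ≃+
        groupCohomology.H2 (trivRep (Multiplicative V) kˣ),
      ∀ x y, Θ (wedge₂ x y) = formClass hξ (x.smulRight y) := by
  obtain ⟨L, hL⟩ := exists_exteriorSquare_lift (nsmul_H2_eq_zero hξ b)
    (fun x y : Module.Dual (ZMod p) V => formClass hξ (x.smulRight y))
    (fun x x' y => by rw [← map_add]; congr 1; ext u v; simp [add_mul])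
    (fun x y y' => by rw [← map_add]; congr 1; ext u v; simp)
    (fun x => formClass_eq_zero_of_symm hξ fun u v => by simp [mul_comm])
  have hLs : ∀ c : Fin n → Fin n → ZMod p,
      L (∑ i, ∑ j, if i < j then c i j • wedge₂ (b.coord i) (b.coord j) else 0) =
        (upperCocycle (coordEquiv b) hξ c).cls := fun c => by
    rw [upperCocycle_cls]
    simp only [upperForm, map_sum]
    refine Finset.sum_congr rfl fun i _ => Finset.sum_congr rfl fun j _ => ?_
    split_ifs
    · rw [← ZMod.natCast_zmod_val (c i j), Nat.cast_smul_eq_nsmul, Nat.cast_smul_eq_nsmul,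
        map_nsmul, map_nsmul]
      exact congrArg _ (hL _ _)
    · rw [map_zero, map_zero]
  refine ⟨AddEquiv.ofBijective L ⟨?_, ?_⟩, hL⟩
  · rw [injective_iff_map_eq_zero]
    intro w hw
    obtain ⟨c, rfl⟩ := exteriorSquare_eq_sum b w
    have hw' := (hLs c).symm.trans hw
    obtain ⟨f, hf⟩ := (TwoCocycle.cls_eq_zero_iff _).1 hw'
    refine Finset.sum_eq_zero fun i _ => Finset.sum_eq_zero fun j _ => ?_
    split_ifs with hij
    · have h1 := hf (basisElement (coordEquiv b) i) (basisElement (coordEquiv b) j)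
      have h2 := hf (basisElement (coordEquiv b) j) (basisElement (coordEquiv b) i)
      rw [mul_comm (basisElement (coordEquiv b) j), mul_comm (f (basisElement (coordEquiv b) i)), ← h1] at h2
      have h3 := rootPow_injective hξ h2
      simp only [coordinate_basisElement] at h3
      rw [Finset.sum_eq_zero, Finset.sum_eq_single i, Finset.sum_eq_single j] at h3
      · simp [hij] at h3
        rw [← h3, zero_smul]
      · intro l _ hl; simp [hl]
      · simp
      · intro l _ hl
        refine Finset.sum_eq_zero fun m _ => ?_
        simp [hl]
      · simp
      · intro l _
        refine Finset.sum_eq_zero fun m _ => ?_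
        by_cases h1 : l = j
        · subst h1
          by_cases h2 : m = i
          · subst h2; simp [hij.not_gt]
          · simp [h2]
        · simp [h1]
    · rfl
  · intro x
    obtain ⟨c, rfl⟩ := exists_upperCocycle_cls_eq (coordEquiv b) hξ x
    exact ⟨_, hLs c⟩

end secondCohomology

/-! ### Alternation of `3`-cocycles and the classes of `β_a` -/

section alternation

variable {G M : Type u} [CommGroup G] [CommGroup M]

/-- The alternation of a `3`-cocycle. -/
def ThreeCocycle.alternation (ω : ThreeCocycle G M) (u v w : G) : M :=
  (betaCocycle ω u).toFun v w / (betaCocycle ω u).toFun w v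

/-- The alternation is the signed product of `ω` over the six orders of its arguments. Since `G` is
commutative, every value of `η` occurs in it with both signs. -/
theorem ThreeCocycle.alternation_eq {ω ω' : ThreeCocycle G M} {η : G → G → M}
    (h : ∀ x y z, ω.toFun x y z =
      ω'.toFun x y z * (η y z * η x (y * z) / (η (x * y) z * η x y))) (u v w : G) :
    ω.alternation u v w = ω'.alternation u v w := by
  simp only [alternation, betaCocycle, h]
  rw [mul_comm v u, mul_comm w u, mul_comm w v]
  apply Additive.ofMul.injective
  simp only [ofMul_mul, ofMul_div]
  abel

theorem ThreeCocycle.alternation_mul (ω ω' : ThreeCocycle G M) (u v w : G) :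
    (ω * ω').alternation u v w = ω.alternation u v w * ω'.alternation u v w := by
  simp only [alternation, betaCocycle, mul_toFun]
  apply Additive.ofMul.injective
  simp only [ofMul_mul, ofMul_div]
  abel

theorem betaCocycle_cls_eq {ω ω' : ThreeCocycle G M} {η : G → G → M}
    (h : ∀ x y z, ω.toFun x y z =
      ω'.toFun x y z * (η y z * η x (y * z) / (η (x * y) z * η x y))) (a : G) :
    (betaCocycle ω a).cls = (betaCocycle ω' a).cls := by
  -- Changing `ω` by the coboundary of `η` changes `β_a` by the coboundary of the commutator of `η`
  -- with `a`.
  refine (TwoCocycle.cls_eq_iff _ _).2 ⟨fun x => η x a / η a x, fun x y => ?_⟩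
  simp only [betaCocycle, h]
  rw [mul_comm x a, mul_comm y a]
  apply Additive.ofMul.injective
  simp only [ofMul_mul, ofMul_div]
  abel

theorem betaCocycle_mul_cls (ω ω' : ThreeCocycle G M) (a : G) :
    (betaCocycle (ω * ω') a).cls = (betaCocycle ω a).cls + (betaCocycle ω' a).cls := by
  rw [← TwoCocycle.cls_mul]
  congr 1
  refine TwoCocycle.ext fun x y => ?_
  simp only [betaCocycle, ThreeCocycle.mul_toFun, TwoCocycle.mul_toFun]
  apply Additive.ofMul.injective
  simp only [ofMul_mul, ofMul_div]
  abel

end alternation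

/-! ### Generators of `H³(V, kˣ)` and the alternating part -/

section elementaryAbelian

variable {p : ℕ} [Fact p.Prime] {k : Type u} [Field k]
  {V : Type u} [AddCommGroup V] [Module (ZMod p) V] {n : ℕ} (b : Module.Basis (Fin n) (ZMod p) V)
  {ξ : kˣ} (hξ : IsPrimitiveRoot ξ p)

variable (p) in
/-- The product of the values of `ω` over the multiples of an element. -/
def ThreeCocycle.cyclicProduct {M : Type u} [CommGroup M]
    (ω : ThreeCocycle (Multiplicative V) M) (v : V) : M :=
  have : NeZero p := ⟨(Fact.out : p.Prime).ne_zero⟩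
  ∏ m : ZMod p, ω.toFun (Multiplicative.ofAdd v) (Multiplicative.ofAdd (m • v))
    (Multiplicative.ofAdd v)

theorem carry_comm (a c : ZMod p) : carry a c = carry c a := by
  unfold carry; rw [add_comm]

theorem sum_carry_zero : ∑ m : ZMod p, carry (m * 0) (0 : ZMod p) = 0 := by
  refine Finset.sum_eq_zero fun m _ => ?_
  simp [carry, (Fact.out : p.Prime).pos]

/-- Adding `1` produces a carry only at `m = p - 1`. -/
theorem sum_carry_one [NeZero p] : ∑ m : ZMod p, carry (m * 1) (1 : ZMod p) = 1 := by
  have h1 : (1 : ZMod p).val = 1 := ZMod.val_one'' (Fact.out : p.Prime).one_lt.ne'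
  have hp : p - 1 + 1 = p := Nat.sub_add_cancel (Fact.out : p.Prime).one_le
  have h2 : (((p - 1 : ℕ) : ZMod p)).val = p - 1 := ZMod.val_cast_of_lt (by omega)
  rw [Finset.sum_eq_single ((p - 1 : ℕ) : ZMod p)]
  · rw [carry, h1, mul_one, h2, hp, if_neg (lt_irrefl _)]
  · intro m _ hm
    rw [carry, h1, mul_one, if_pos]
    have := ZMod.val_lt m
    refine lt_of_le_of_ne this fun h => hm ?_
    rw [← ZMod.natCast_zmod_val m]
    congr 1
    omega
  · simp

/-- In `β_a` the terms `x_i {y_j, a_j}` and `x_i {a_j, y_j}` cancel because carries are symmetric.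
What is left, `a_i {x_j, y_j}`, is symmetric in `x` and `y`, hence a coboundary. -/
theorem symCocycle_beta_cls [IsAlgClosed k] [CharZero k] (s : Fin n → Fin n → ZMod p)
    (a : Multiplicative V) : (betaCocycle (symCocycle b hξ s) a).cls = 0 := by
  rw [TwoCocycle.cls_eq_zero_iff]
  refine exists_coboundary_of_symm (baer_units k) (betaCocycle _ a).cocycle fun x y => ?_
  simp only [betaCocycle, symCocycle, ← rootPow_add hξ, ← rootPow_sub hξ,
    ← Finset.sum_add_distrib, ← Finset.sum_sub_distrib]
  congr 1
  refine Finset.sum_congr rfl fun i _ => Finset.sum_congr rfl fun j _ => ?_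
  simp only [carry_comm (b.coord j x.toAdd) (b.coord j a.toAdd),
    carry_comm (b.coord j y.toAdd) (b.coord j a.toAdd),
    carry_comm (b.coord j y.toAdd) (b.coord j x.toAdd)]
  ring

/-- The three factors of `β_v` insert `v` into the first, third and (inverted) middle slot of `x_i ∪
x_j ∪ x_l`; these are the three terms of `ι_v`. The identity already holds for cocycles, with the
form `B` below. -/
theorem altCocycle_beta_cls (a : Fin n → Fin n → Fin n → ZMod p)
    {Θ : ⋀[ZMod p]^2 (Module.Dual (ZMod p) V) ≃+
        groupCohomology.H2 (trivRep (Multiplicative V) kˣ)}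
    (hΘ : ∀ x y, Θ (wedge₂ x y) = formClass hξ (x.smulRight y)) (v : V) :
    (betaCocycle (altCocycle b hξ a) (Multiplicative.ofAdd v)).cls =
      Θ (interiorDerivation v (∑ i, ∑ j, ∑ l, if i < j ∧ j < l then
      a i j l • wedge₃ (b.coord i) (b.coord j) (b.coord l) else 0)) := by
  let B : V →ₗ[ZMod p] V →ₗ[ZMod p] ZMod p := ∑ i, ∑ j, ∑ l, if i < j ∧ j < l then
    a i j l • (b.coord l v • (b.coord i).smulRight (b.coord j) -
      b.coord j v • (b.coord i).smulRight (b.coord l) +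
      b.coord i v • (b.coord j).smulRight (b.coord l)) else 0
  have hsmul : ∀ (c : ZMod p) w B, Θ w = formClass hξ B → Θ (c • w) = formClass hξ (c • B) := by
    intro c w B h
    rw [← ZMod.natCast_zmod_val c, Nat.cast_smul_eq_nsmul, Nat.cast_smul_eq_nsmul,
      map_nsmul, map_nsmul, h]
  have hsub : ∀ B B', formClass hξ (V := V) (B - B') = formClass hξ B - formClass hξ B' :=
    fun B B' => eq_sub_of_add_eq
      (((formClass hξ).map_add _ _).symm.trans (congrArg _ (sub_add_cancel B B')))
  have h1 : Θ (interiorDerivation v (∑ i, ∑ j, ∑ l, if i < j ∧ j < l then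
      a i j l • wedge₃ (b.coord i) (b.coord j) (b.coord l) else 0)) = formClass hξ B := by
    simp only [B, map_sum]
    refine Finset.sum_congr rfl fun i _ => Finset.sum_congr rfl fun j _ =>
      Finset.sum_congr rfl fun l _ => ?_
    split_ifs
    · rw [map_smul, interiorDerivation_wedge₃]
      apply hsmul
      rw [map_add, map_sub, (formClass hξ).map_add, hsub]
      exact congrArg₂ (· + ·) (congrArg₂ (· - ·) (hsmul _ _ _ (hΘ _ _)) (hsmul _ _ _ (hΘ _ _)))
        (hsmul _ _ _ (hΘ _ _))
    · rw [map_zero, map_zero, map_zero]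
  rw [h1]
  change _ = (formCocycle hξ B).cls
  congr 1
  refine TwoCocycle.ext fun x y => ?_
  simp only [betaCocycle, altCocycle, formCocycle, ← rootPow_add hξ, ← rootPow_sub hξ,
    ← Finset.sum_add_distrib, ← Finset.sum_sub_distrib, B, LinearMap.sum_apply]
  congr 1
  refine Finset.sum_congr rfl fun i _ => Finset.sum_congr rfl fun j _ =>
      Finset.sum_congr rfl fun l _ => ?_
  split_ifs
  · simp
    ring
  · simp

theorem symCocycle_alternation (s : Fin n → Fin n → ZMod p) (u v w : Multiplicative V) :
    (symCocycle b hξ s).alternation u v w = 1 := by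
  rw [ThreeCocycle.alternation, div_eq_one]
  simp only [betaCocycle, symCocycle, ← rootPow_add hξ, ← rootPow_sub hξ,
    ← Finset.sum_add_distrib, ← Finset.sum_sub_distrib]
  congr 1
  refine Finset.sum_congr rfl fun i _ => Finset.sum_congr rfl fun j _ => ?_
  simp only [carry_comm (b.coord j v.toAdd) (b.coord j u.toAdd),
    carry_comm (b.coord j w.toAdd) (b.coord j u.toAdd),
    carry_comm (b.coord j w.toAdd) (b.coord j v.toAdd)]
  ring

/-- Of the six orders of three basis vectors only the increasing one contributes, so the alternation
reads off the coefficients. -/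
theorem altCocycle_alternation (a : Fin n → Fin n → Fin n → ZMod p) {i j l : Fin n}
    (hij : i < j) (hjl : j < l) :
    (altCocycle b hξ a).alternation (Multiplicative.ofAdd (b i)) (Multiplicative.ofAdd (b j))
      (Multiplicative.ofAdd (b l)) = rootPow ξ (a i j l) := by
  have key : ∀ i' j' l' : Fin n, rootPow ξ (∑ x, ∑ y, ∑ z, if x < y ∧ y < z then
    a x y z * (b.coord x (b i') * b.coord y (b j') * b.coord z (b l')) else 0) =
      if i' < j' ∧ j' < l' then rootPow ξ (a i' j' l') else 1 := by
    intro i' j' l'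
    rw [Finset.sum_eq_single i', Finset.sum_eq_single j', Finset.sum_eq_single l']
    · split_ifs
      · simp
      · exact rootPow_zero ξ
    · intro z _ hz; simp [hz.symm]
    · simp
    · intro y _ hy
      exact Finset.sum_eq_zero fun z _ => by simp [Finsupp.single_apply, hy.symm]
    · simp
    · intro x _ hx
      refine Finset.sum_eq_zero fun y _ => Finset.sum_eq_zero fun z _ => by
        simp [Finsupp.single_apply, hx.symm]
    · simp
  simp only [ThreeCocycle.alternation, betaCocycle, altCocycle, toAdd_ofAdd, key]
  simp [hij, hjl, hij.not_gt, hjl.not_gt, (hij.trans hjl).not_gt]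

/-- The coboundary of `η` at `(v, mv, v)` is `η(mv, v) η(v, (m+1)v) / (η((m+1)v, v) η(v, mv))`, and
its product over the cyclic variable `m` telescopes. -/
theorem ThreeCocycle.cyclicProduct_eq {M : Type u} [CommGroup M]
    {ω ω' : ThreeCocycle (Multiplicative V) M} {η : Multiplicative V → Multiplicative V → M}
    (h : ∀ x y z, ω.toFun x y z =
      ω'.toFun x y z * (η y z * η x (y * z) / (η (x * y) z * η x y))) (v : V) :
    ω.cyclicProduct p v = ω'.cyclicProduct p v := by
  have : NeZero p := ⟨(Fact.out : p.Prime).ne_zero⟩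
  have h1 : ∀ m : ZMod p, Multiplicative.ofAdd v * Multiplicative.ofAdd (m • v) =
      Multiplicative.ofAdd ((m + 1) • v) := fun m => by
    rw [← ofAdd_add, add_smul, one_smul, add_comm]
  have h2 : ∀ m : ZMod p, Multiplicative.ofAdd (m • v) * Multiplicative.ofAdd v =
      Multiplicative.ofAdd ((m + 1) • v) := fun m => by rw [mul_comm, h1]
  have h3 : ∀ f : ZMod p → M, ∏ m, f (m + 1) = ∏ m, f m := fun f =>
    Fintype.prod_equiv (Equiv.addRight 1) _ _ fun _ => rfl
  simp only [cyclicProduct, h, h1, h2]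
  rw [Finset.prod_mul_distrib, Finset.prod_div_distrib, Finset.prod_mul_distrib,
    Finset.prod_mul_distrib,
    h3 fun m => η (Multiplicative.ofAdd v) (Multiplicative.ofAdd (m • v)),
    h3 fun m => η (Multiplicative.ofAdd (m • v)) (Multiplicative.ofAdd v), div_self', mul_one]

/-- The carries of `m v_j` and `v_j`, summed over `m`, give `v_j` when `v_j` is `0` or `1`. So the
cyclic product evaluates the quadratic form of `s` at such vectors, which is all that
`upper_eq_zero_of_form` requires. -/
theorem symCocycle_cyclicProduct (s : Fin n → Fin n → ZMod p) {v : V}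
    (hv : ∀ i, b.coord i v = 0 ∨ b.coord i v = 1) :
    (symCocycle b hξ s).cyclicProduct p v =
      rootPow ξ (∑ i, ∑ j, s i j * (b.coord i v * b.coord j v)) := by
  have : NeZero p := ⟨(Fact.out : p.Prime).ne_zero⟩
  have h1 : ∀ f : ZMod p → ZMod p, ∏ m, rootPow ξ (f m) = rootPow ξ (∑ m, f m) := fun f =>
    (map_prod (rootPowHom hξ) (fun m => Multiplicative.ofAdd (f m)) Finset.univ).symm.trans
      (congrArg (rootPowHom hξ) (ofAdd_sum Finset.univ f).symm)
  simp only [ThreeCocycle.cyclicProduct, symCocycle, h1]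
  congr 1
  rw [Finset.sum_comm]
  refine Finset.sum_congr rfl fun i _ => ?_
  rw [Finset.sum_comm]
  refine Finset.sum_congr rfl fun j _ => ?_
  rw [← Finset.mul_sum, ← Finset.mul_sum]
  congr 2
  simp only [toAdd_ofAdd, map_smul, smul_eq_mul]
  rcases hv j with h | h
  · rw [h, sum_carry_zero]
  · rw [h, sum_carry_one]

theorem altCocycle_eq_of_alternation {a a' : Fin n → Fin n → Fin n → ZMod p}
    (h : ∀ u v w, (altCocycle b hξ a).alternation u v w = (altCocycle b hξ a').alternation u v w)
    {i j l : Fin n} (hij : i < j) (hjl : j < l) : a i j l = a' i j l := by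
  apply rootPow_injective hξ
  rw [← altCocycle_alternation b hξ a hij hjl, h, altCocycle_alternation b hξ a' hij hjl]

theorem alternation_of_cls_eq {ω : ThreeCocycle (Multiplicative V) kˣ}
    {a : Fin n → Fin n → Fin n → ZMod p} {s : Fin n → Fin n → ZMod p}
    (h : ω.cls = (altCocycle b hξ a).cls + (symCocycle b hξ s).cls) (u v w : Multiplicative V) :
    ω.alternation u v w = (altCocycle b hξ a).alternation u v w := by
  rw [← ThreeCocycle.cls_mul] at h
  obtain ⟨η, hη⟩ := ThreeCocycle.exists_of_cls_eq h
  rw [ThreeCocycle.alternation_eq hη, ThreeCocycle.alternation_mul, symCocycle_alternation, mul_one]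

/-- An upper triangular matrix is determined by its quadratic form. -/
theorem upper_eq_zero_of_form {s : Fin n → Fin n → ZMod p} (hs : ∀ i j, j < i → s i j = 0)
    (h : ∀ v : V, (∀ i, b.coord i v = 0 ∨ b.coord i v = 1) →
      ∑ i, ∑ j, s i j * (b.coord i v * b.coord j v) = 0) : s = 0 := by
  have hc : ∀ i j, b.coord i (b j) = if i = j then 1 else 0 := fun i j => by
    simp [Finsupp.single_apply, eq_comm]
  have hd : ∀ i, s i i = 0 := fun i => by
    have := h (b i) fun j => by rw [hc]; split_ifs <;> simp
    simpa [hc] using this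
  funext i j
  rcases lt_trichotomy i j with hij | hij | hij
  · have h1 := h (b i + b j) fun l => by
      rw [map_add, hc, hc]
      by_cases h1 : l = i
      · subst h1; simp [hij.ne]
      · by_cases h2 : l = j
        · subst h2; simp [hij.ne']
        · simp [h1, h2]
    simp only [map_add, hc, mul_add, add_mul, Finset.sum_add_distrib] at h1
    simpa [hd, hs j i hij] using h1
  · subst hij; exact hd i
  · exact hs i j hij

variable [IsAlgClosed k] [CharZero k]

/-- Proved by counting: the coefficients on triples `i < j < l` and pairs `i ≤ j` inject into `H³`,
and their number is the upper bound for `|H³|`, so the injection is bijective. -/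
theorem exists_cls_eq_alt_add_sym (c : groupCohomology (trivRep (Multiplicative V) kˣ) 3) :
    ∃ (a : Fin n → Fin n → Fin n → ZMod p) (s : Fin n → Fin n → ZMod p),
      c = (altCocycle b hξ a).cls + (symCocycle b hξ s).cls := by
  have : NeZero p := ⟨(Fact.out : p.Prime).ne_zero⟩
  let α : ({x : Fin n × Fin n × Fin n // x.1 < x.2.1 ∧ x.2.1 < x.2.2} → ZMod p) →
      Fin n → Fin n → Fin n → ZMod p :=
    fun f i j l => if h : i < j ∧ j < l then f ⟨(i, j, l), h⟩ else 0
  let σ : ({x : Fin n × Fin n // x.1 ≤ x.2} → ZMod p) → Fin n → Fin n → ZMod p :=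
    fun f i j => if h : i ≤ j then f ⟨(i, j), h⟩ else 0
  let F : ({x : Fin n × Fin n × Fin n // x.1 < x.2.1 ∧ x.2.1 < x.2.2} → ZMod p) ×
      ({x : Fin n × Fin n // x.1 ≤ x.2} → ZMod p) →
      groupCohomology (trivRep (Multiplicative V) kˣ) 3 := fun f =>
    (altCocycle b hξ (α f.1)).cls + (symCocycle b hξ (σ f.2)).cls
  obtain ⟨hfin, hcard⟩ := finite_and_card_H3_le_pow hξ n (Multiplicative V) (coordEquiv b)
  have hF : Function.Injective F := by
    rintro ⟨f, g⟩ ⟨f', g'⟩ h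
    have h' : (altCocycle b hξ (α f)).cls + (symCocycle b hξ (σ g)).cls =
      (altCocycle b hξ (α f')).cls + (symCocycle b hξ (σ g')).cls := h
    have halt : ∀ u v w, (altCocycle b hξ (α f)).alternation u v w =
        (altCocycle b hξ (α f')).alternation u v w := fun u v w => by
      rw [← alternation_of_cls_eq b hξ
        (ω := altCocycle b hξ (α f) * symCocycle b hξ (σ g)) (ThreeCocycle.cls_mul _ _),
        alternation_of_cls_eq b hξ ((ThreeCocycle.cls_mul _ _).trans h')]
    have hff : f = f' := by
      funext ⟨⟨i, j, l⟩, hij, hjl⟩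
      have h1 := altCocycle_eq_of_alternation b hξ halt hij hjl
      simpa [α, show i < j from hij, show j < l from hjl] using h1
    subst hff
    -- The alternation has identified the alternating coefficients; their classes cancel, and two
    -- symmetric classes remain to be separated by cyclic products.
    rw [add_right_inj] at h'
    obtain ⟨η, hη⟩ := ThreeCocycle.exists_of_cls_eq h'
    have hg : σ g - σ g' = 0 := by
      refine upper_eq_zero_of_form b ?_ fun v hv => ?_
      · intro i j hij
        simp [σ, hij.not_ge]
      · have h1 := ThreeCocycle.cyclicProduct_eq (p := p) hη v
        rw [symCocycle_cyclicProduct b hξ _ hv, symCocycle_cyclicProduct b hξ _ hv] at h1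
        have h2 := sub_eq_zero.2 (rootPow_injective hξ h1)
        simp only [← Finset.sum_sub_distrib, ← sub_mul] at h2
        exact h2
    have hgg : g = g' := by
      funext ⟨⟨i, j⟩, hij⟩
      have h1 := congrFun (congrFun (sub_eq_zero.1 hg) i) j
      simpa [σ, show i ≤ j from hij] using h1
    rw [hgg]
  obtain ⟨f, rfl⟩ := (hF.bijective_of_nat_card_le (by
    rw [Nat.card_prod, card_fun_zmod, card_fun_zmod, card_triples, card_symPairs, ← pow_add]
    exact hcard)).2 c
  exact ⟨_, _, rfl⟩

/-- The alternating part of a class in `H³(V, kˣ)` exists, is unique, and computes the classes of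
the cocycles `β_v`. -/
theorem exists_altPart (ω : ThreeCocycle (Multiplicative V) kˣ) :
    ∃ φ : ⋀[ZMod p]^3 (Module.Dual (ZMod p) V),
      (∀ ψ, IsAltPart b hξ ω.cls ψ ↔ ψ = φ) ∧
      ((∀ u v w, ω.alternation u v w = 1) → φ = 0) ∧
      (∃ Θ : ⋀[ZMod p]^2 (Module.Dual (ZMod p) V) ≃+
          groupCohomology.H2 (trivRep (Multiplicative V) kˣ),
        (∀ x y, Θ (wedge₂ x y) = (bilinCocycle hξ x y).cls) ∧
        ∀ v : V, (betaCocycle ω (Multiplicative.ofAdd v)).cls = Θ (interiorDerivation v φ)) := by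
  obtain ⟨a, s, h⟩ := exists_cls_eq_alt_add_sym b hξ ω.cls
  obtain ⟨Θ, hΘ⟩ := exists_exteriorSquare_equiv_H2 (V := V) hξ b
  refine ⟨∑ i, ∑ j, ∑ l, if i < j ∧ j < l then
      a i j l • wedge₃ (b.coord i) (b.coord j) (b.coord l) else 0, fun ψ => ⟨?_, ?_⟩, ?_,
      Θ, fun x y => ?_, fun v => ?_⟩
  · rintro ⟨a', s', h', rfl⟩
    refine Finset.sum_congr rfl fun i _ => Finset.sum_congr rfl fun j _ =>
      Finset.sum_congr rfl fun l _ => ?_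
    split_ifs with hijl
    · rw [altCocycle_eq_of_alternation b hξ (a := a') (a' := a) (fun u v w => by
        rw [← alternation_of_cls_eq b hξ h', alternation_of_cls_eq b hξ h]) hijl.1 hijl.2]
    · rfl
  · rintro rfl
    exact ⟨a, s, h, rfl⟩
  -- A trivial alternation forces all coefficients to vanish. This later gives `φ = 0` from the
  -- triviality of all `β_v`.
  · intro h1
    refine Finset.sum_eq_zero fun i _ => Finset.sum_eq_zero fun j _ =>
      Finset.sum_eq_zero fun l _ => ?_
    split_ifs with hijl
    · have h2 := altCocycle_alternation b hξ a hijl.1 hijl.2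
      rw [← alternation_of_cls_eq b hξ h, h1, ← rootPow_zero (p := p)] at h2
      rw [← rootPow_injective hξ h2, zero_smul]
    · rfl
  · rw [bilinCocycle_cls, hΘ]
  · rw [← altCocycle_beta_cls b hξ a hΘ]
    rw [← ThreeCocycle.cls_mul] at h
    obtain ⟨η, hη⟩ := ThreeCocycle.exists_of_cls_eq h
    rw [betaCocycle_cls_eq hη, betaCocycle_mul_cls, symCocycle_beta_cls, add_zero]

end elementaryAbelian

/-! ### The center of `C(G, ω)` in terms of projective actions -/

namespace GrVec

variable {k G : Type u} [Field k] [CommGroup G] [Fintype G] {ω : ThreeCocycle G kˣ}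

/-- A homogeneous vector of degree `x` as a morphism from the simple object `x`. -/
def ofHomog {U : GrVec ω} {x : G} {u : U.carrier} (hu : IsHomog x u) : single ω x ⟶ U where
  lin := LinearMap.toSpanSingleton k U.carrier u
  comm g c := by
    classical
    refine Eq.trans ?_ (map_smul (U.proj g) c u).symm
    rw [(isHomog_single x c).proj_eq, hu.proj_eq, LinearMap.toSpanSingleton_apply]
    split_ifs
    · rfl
    · rw [zero_smul, smul_zero]

theorem tensor_lin_ext₃' {X Y Z : GrVec ω} {N : Type*} [AddCommGroup N] [Module k N]
    {f f' : (tensor X (tensor Y Z)).carrier →ₗ[k] N}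
    (h : ∀ a b c (x : X.carrier) (y : Y.carrier) (z : Z.carrier),
      IsHomog a x → IsHomog b y → IsHomog c z →
      f (x ⊗ₜ[k] (y ⊗ₜ[k] z)) = f' (x ⊗ₜ[k] (y ⊗ₜ[k] z))) : f = f' := by
  have : (TensorProduct.mk k X.carrier (tensor Y Z).carrier).compr₂ f =
      (TensorProduct.mk k X.carrier (tensor Y Z).carrier).compr₂ f' := by
    refine lin_ext fun a x hx => ?_
    refine tensor_lin_ext fun b c y z hy hz => ?_
    exact h a b c x y z hx hy hz
  exact TensorProduct.ext this

/-- The half-braiding of `Z` with the simple object `x`, as an operator on `Z`. -/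
def centerOp (Z : Center (GrVec ω)) (x : G) : Z.1.carrier ≃ₗ[k] Z.1.carrier :=
  LinearEquiv.ofLinearMap
    ((TensorProduct.lid k Z.1.carrier).toLinearMap ∘ₗ (Z.2.β (single ω x)).hom.lin ∘ₗ
      (TensorProduct.rid k Z.1.carrier).symm.toLinearMap)
    ((TensorProduct.rid k Z.1.carrier).toLinearMap ∘ₗ (Z.2.β (single ω x)).inv.lin ∘ₗ
      (TensorProduct.lid k Z.1.carrier).symm.toLinearMap)
    (by
      have h := congrArg Hom.lin (Z.2.β (single ω x)).inv_hom_id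
      ext z
      have h' := LinearMap.congr_fun h ((TensorProduct.lid k Z.1.carrier).symm z)
      simp only [LinearMap.comp_apply, LinearEquiv.coe_coe, LinearEquiv.symm_apply_apply]
      rw [comp_lin] at h'
      erw [h']
      exact LinearEquiv.apply_symm_apply _ _)
    (by
      have h := congrArg Hom.lin (Z.2.β (single ω x)).hom_inv_id
      ext z
      have h' := LinearMap.congr_fun h ((TensorProduct.rid k Z.1.carrier).symm z)
      simp only [LinearMap.comp_apply, LinearEquiv.coe_coe, LinearEquiv.symm_apply_apply]
      rw [comp_lin] at h'
      erw [h']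
      exact LinearEquiv.apply_symm_apply _ _)

theorem halfBraiding_single (Z : Center (GrVec ω)) (x : G) (z : Z.1.carrier) :
    (Z.2.β (single ω x)).hom.lin (z ⊗ₜ[k] (1 : k)) = (1 : k) ⊗ₜ[k] centerOp Z x z := by
  apply (TensorProduct.lid k Z.1.carrier).injective
  refine Eq.trans ?_ ((TensorProduct.lid_tmul _ _).trans (one_smul _ _)).symm
  rfl

/-- Naturality along the morphism `single ω x ⟶ U` picking out `u` reduces the half-braiding with
`U` to the one with a simple object. -/
theorem halfBraiding_apply (Z : Center (GrVec ω)) {U : GrVec ω} {x : G} {u : U.carrier}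
    (hu : IsHomog x u) (z : Z.1.carrier) :
    (Z.2.β U).hom.lin (z ⊗ₜ[k] u) = u ⊗ₜ[k] centerOp Z x z := by
  have h := LinearMap.congr_fun (congrArg Hom.lin (Z.2.naturality (ofHomog hu))) (z ⊗ₜ[k] (1 : k))
  rw [comp_lin, comp_lin, LinearMap.comp_apply, LinearMap.comp_apply, halfBraiding_single] at h
  change (Z.2.β U).hom.lin (z ⊗ₜ[k] ((1 : k) • u)) = ((1 : k) • u) ⊗ₜ[k] _ at h
  rwa [one_smul] at h

/-- The half-braiding sends degree `v * x` to degree `v * x`, and stripping off `x` on the other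
side leaves `v` because `G` is commutative. -/
theorem centerOp_homog (Z : Center (GrVec ω)) (x : G) {v : G} {z : Z.1.carrier}
    (hz : IsHomog v z) : IsHomog v (centerOp Z x z) := by
  have h1 : IsHomog (X := tensor Z.1 (single ω x)) (v * x) (z ⊗ₜ[k] (1 : k)) :=
    hz.tmul (isHomog_single x 1)
  have h2 := IsHomog.map (Z.2.β (single ω x)).hom h1
  rw [halfBraiding_single] at h2
  change (∑ a : G, TensorProduct.map ((single ω x).proj a) (Z.1.proj (a⁻¹ * (v * x))))
    ((1 : k) ⊗ₜ[k] centerOp Z x z) = (1 : k) ⊗ₜ[k] centerOp Z x z at h2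
  classical
  rw [LinearMap.sum_apply, Finset.sum_eq_single x] at h2
  · rw [TensorProduct.map_tmul, isHomog_single x 1, mul_comm v x, inv_mul_cancel_left] at h2
    have h3 := congrArg (TensorProduct.lid k Z.1.carrier) h2
    rwa [TensorProduct.lid_tmul, TensorProduct.lid_tmul, one_smul, one_smul] at h3
  · intro c _ hc
    rw [TensorProduct.map_tmul, (isHomog_single x (1 : k)).proj_eq, if_neg hc,
      TensorProduct.zero_tmul]
  · simp

theorem assoc_inv_apply {X Y Z : GrVec ω} {a b c : G} {x : X.carrier} {y : Y.carrier}
    {z : Z.carrier} (hx : IsHomog a x) (hy : IsHomog b y) (hz : IsHomog c z) :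
    (α_ X Y Z).inv.lin (x ⊗ₜ[k] (y ⊗ₜ[k] z)) =
      ((ω.toFun a b c)⁻¹ : kˣ).1 • ((x ⊗ₜ[k] y) ⊗ₜ[k] z) := by
  change (assocEquiv X Y Z).symm _ = _
  rw [LinearEquiv.symm_apply_eq, map_smul, assocEquiv_apply hx hy hz, smul_smul, Units.inv_mul,
    one_smul]

theorem assoc_hom_apply {X Y Z : GrVec ω} {a b c : G} {x : X.carrier} {y : Y.carrier}
    {z : Z.carrier} (hx : IsHomog a x) (hy : IsHomog b y) (hz : IsHomog c z) :
    (α_ X Y Z).hom.lin ((x ⊗ₜ[k] y) ⊗ₜ[k] z) =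
      (ω.toFun a b c : k) • (x ⊗ₜ[k] (y ⊗ₜ[k] z)) := assocEquiv_apply hx hy hz

theorem comp_lin_apply {X Y Z : GrVec ω} (f : X ⟶ Y) (g : Y ⟶ Z) (x : X.carrier) :
    (f ≫ g).lin x = g.lin (f.lin x) := rfl

theorem whiskerLeft_lin_tmul (X : GrVec ω) {Y Y' : GrVec ω} (g : Y ⟶ Y') (x : X.carrier)
    (y : Y.carrier) : Hom.lin (X ◁ g) (x ⊗ₜ[k] y) = x ⊗ₜ[k] g.lin y := rfl

theorem whiskerRight_lin_tmul {X X' : GrVec ω} (f : X ⟶ X') (Y : GrVec ω) (x : X.carrier)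
    (y : Y.carrier) : Hom.lin (f ▷ Y) (x ⊗ₜ[k] y) = f.lin x ⊗ₜ[k] y := rfl

/-- The composite of two half-braidings in the monoidality axiom, evaluated on homogeneous
vectors. -/
theorem monoidal_rhs_apply {X U U' : GrVec ω} (f : X ⊗ U ⟶ U ⊗ X) (f' : X ⊗ U' ⟶ U' ⊗ X)
    (T : G → X.carrier → X.carrier) (hT : ∀ x v z, IsHomog v z → IsHomog (X := X) v (T x z))
    {v x y : G} {z : X.carrier} {u : U.carrier} {u' : U'.carrier}
    (hf : ∀ z, f.lin (z ⊗ₜ[k] u) = u ⊗ₜ[k] T x z) (hf' : ∀ z, f'.lin (z ⊗ₜ[k] u') = u' ⊗ₜ[k] T y z)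
    (hz : IsHomog v z) (hu : IsHomog x u) (hu' : IsHomog y u') :
    ((α_ _ _ _).inv ≫ (f ▷ U') ≫ (α_ _ _ _).hom ≫ (U ◁ f') ≫ (α_ _ _ _).inv).lin
      (z ⊗ₜ[k] (u ⊗ₜ[k] u')) =
      ((((betaCocycle ω v).toFun x y)⁻¹ : kˣ) : k) • ((u ⊗ₜ[k] u') ⊗ₜ[k] T y (T x z)) := by
  rw [comp_lin_apply, assoc_inv_apply hz hu hu', map_smul, comp_lin_apply, whiskerRight_lin_tmul, hf,
    comp_lin_apply, assoc_hom_apply hu (hT x v z hz) hu', map_smul, comp_lin_apply,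
    whiskerLeft_lin_tmul, hf', assoc_inv_apply hu hu' (hT y v _ (hT x v z hz)), smul_smul, smul_smul]
  congr 1
  simp only [betaCocycle, ← Units.val_mul]
  congr 1
  rw [div_eq_mul_inv, mul_inv, mul_inv, inv_inv]
  simp only [mul_assoc, mul_comm, mul_left_comm]

/-- Monoidality of the half-braiding at the simple objects `x` and `y`; the three associators
occurring there contribute `β_v(x, y)⁻¹`. -/
theorem centerOp_mul (Z : Center (GrVec ω)) (x y : G) {v : G} {z : Z.1.carrier}
    (hz : IsHomog v z) :
    centerOp Z y (centerOp Z x z) = ((betaCocycle ω v).toFun x y : k) • centerOp Z (x * y) z := by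
  have hx := isHomog_single (ω := ω) x (1 : k)
  have hy := isHomog_single (ω := ω) y (1 : k)
  have h := LinearMap.congr_fun (congrArg Hom.lin (Z.2.monoidal (single ω x) (single ω y)))
    (z ⊗ₜ[k] ((1 : k) ⊗ₜ[k] (1 : k)))
  rw [monoidal_rhs_apply _ _ (fun x z => centerOp Z x z) (fun x v z hz => centerOp_homog Z x hz)
    (fun z => halfBraiding_apply Z hx z) (fun z => halfBraiding_apply Z hy z) hz hx hy] at h
  have h2 := halfBraiding_apply Z (U := single ω x ⊗ single ω y) (hx.tmul hy) z
  have h3 := h2.symm.trans h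
  have h4 := congrArg (TensorProduct.lid k Z.1.carrier ∘
    TensorProduct.map (TensorProduct.lid k k).toLinearMap LinearMap.id) h3
  simp only [Function.comp_apply, map_smul, TensorProduct.map_tmul, LinearEquiv.coe_coe,
    TensorProduct.lid_tmul, one_smul, LinearMap.id_apply] at h4
  rw [h4, smul_smul, Units.mul_inv, one_smul]

/-- Data equivalent to a half-braiding on `X`: grading preserving operators which on `X_v` form a
projective action of `G` with multiplier `β_v`. -/
structure CentralAction (X : GrVec ω) where
  op : G → X.carrier ≃ₗ[k] X.carrier
  homog : ∀ x {v : G} {z : X.carrier}, IsHomog v z → IsHomog v (op x z)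
  mul : ∀ x y {v : G} {z : X.carrier}, IsHomog v z →
    op y (op x z) = ((betaCocycle ω v).toFun x y : k) • op (x * y) z

namespace CentralAction

variable {X : GrVec ω} (A : CentralAction X)

/-- The linear map underlying the half-braiding of a central action. -/
def braidLin (U : GrVec ω) : X.carrier ⊗[k] U.carrier →ₗ[k] U.carrier ⊗[k] X.carrier :=
  ∑ x : G, (TensorProduct.comm k _ _).toLinearMap ∘ₗ
    TensorProduct.map (A.op x).toLinearMap (U.proj x)

theorem braidLin_apply {U : GrVec ω} {x : G} {u : U.carrier} (hu : IsHomog x u) (z : X.carrier) :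
    A.braidLin U (z ⊗ₜ[k] u) = u ⊗ₜ[k] A.op x z := by
  classical
  rw [braidLin, LinearMap.sum_apply, Finset.sum_eq_single x]
  · simp [show U.proj x u = u from hu]
  · intro c _ hc
    simp [hu.proj_eq, hc]
  · simp

/-- The inverse of `braidLin`. -/
def braidInv (U : GrVec ω) : U.carrier ⊗[k] X.carrier →ₗ[k] X.carrier ⊗[k] U.carrier :=
  ∑ x : G, (TensorProduct.comm k _ _).toLinearMap ∘ₗ
    TensorProduct.map (U.proj x) (A.op x).symm.toLinearMap

theorem braidInv_apply {U : GrVec ω} {x : G} {u : U.carrier} (hu : IsHomog x u) (z : X.carrier) :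
    A.braidInv U (u ⊗ₜ[k] z) = (A.op x).symm z ⊗ₜ[k] u := by
  classical
  rw [braidInv, LinearMap.sum_apply, Finset.sum_eq_single x]
  · simp [show U.proj x u = u from hu]
  · intro c _ hc
    simp [hu.proj_eq, hc]
  · simp

/-- `braidLin` as a linear equivalence. -/
def braidEquiv (U : GrVec ω) : (tensor X U).carrier ≃ₗ[k] (tensor U X).carrier :=
  LinearEquiv.ofLinearMap (A.braidLin U) (A.braidInv U)
    (tensor_lin_ext fun a b u z hu _ => by
      rw [LinearMap.comp_apply, A.braidInv_apply hu, A.braidLin_apply hu,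
        LinearEquiv.apply_symm_apply]
      rfl)
    (tensor_lin_ext fun a b z u _ hu => by
      rw [LinearMap.comp_apply, A.braidLin_apply hu, A.braidInv_apply hu,
        LinearEquiv.symm_apply_apply]
      rfl)

/-- The isomorphism `X ⊗ U ≅ U ⊗ X` given by a central action. -/
def braidIso (U : GrVec ω) : X ⊗ U ≅ U ⊗ X :=
  mkIso (X := tensor X U) (Y := tensor U X) (A.braidEquiv U) (by
    classical
    intro g t ht
    suffices h : (tensor U X).proj g ∘ₗ A.braidLin U = A.braidLin U ∘ₗ (tensor X U).proj g by
      have := LinearMap.congr_fun h t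
      rw [LinearMap.comp_apply, LinearMap.comp_apply, ht] at this
      exact this
    refine tensor_lin_ext fun a b z u hz hu => ?_
    rw [LinearMap.comp_apply, LinearMap.comp_apply, (hz.tmul hu).proj_eq, A.braidLin_apply hu,
      (hu.tmul (A.homog b hz)).proj_eq, mul_comm a b]
    split_ifs
    · rw [A.braidLin_apply hu]
    · rw [map_zero])

theorem braidIso_hom_lin_apply {U : GrVec ω} {x : G} {u : U.carrier} (hu : IsHomog x u)
    (z : X.carrier) : (A.braidIso U).hom.lin (z ⊗ₜ[k] u) = u ⊗ₜ[k] A.op x z :=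
  A.braidLin_apply hu z

/-- The object of the center given by a central action. -/
def toCenter : Center (GrVec ω) :=
  ⟨X, { β := A.braidIso
        monoidal := fun U U' => by
          apply hom_ext
          refine tensor_lin_ext₃' fun v x y z u u' hz hu hu' => ?_
          rw [A.braidIso_hom_lin_apply (U := U ⊗ U') (hu.tmul hu'),
            monoidal_rhs_apply _ _ (fun x z => A.op x z) (fun x _ _ hz => A.homog x hz)
              (A.braidIso_hom_lin_apply hu) (A.braidIso_hom_lin_apply hu') hz hu hu', A.mul x y hz,
            TensorProduct.tmul_smul, smul_smul, Units.inv_mul, one_smul]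
        naturality := fun f => by
          apply hom_ext
          refine tensor_lin_ext fun a b z u hz hu => ?_
          rw [comp_lin_apply, comp_lin_apply, whiskerLeft_lin_tmul, A.braidIso_hom_lin_apply hu,
            whiskerRight_lin_tmul, A.braidIso_hom_lin_apply (hu.map f)] }⟩

theorem centerOp_toCenter (x : G) (z : X.carrier) : centerOp A.toCenter x z = A.op x z := by
  have h1 := (halfBraiding_single A.toCenter x z).symm.trans
    (A.braidIso_hom_lin_apply (U := single ω x) (isHomog_single x (1 : k)) z)
  have h2 := congrArg (TensorProduct.lid k X.carrier) h1
  exact (one_smul k _).symm.trans (h2.trans (one_smul k _))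

end CentralAction

/-- The central action given by an object of the center. -/
def centralAction (Z : Center (GrVec ω)) : CentralAction Z.1 where
  op := centerOp Z
  homog x _ _ hz := centerOp_homog Z x hz
  mul x y _ _ hz := centerOp_mul Z x y hz

/-- Morphisms of the center are the graded linear maps which commute with the operators. -/
def centerHom {Z W : Center (GrVec ω)} (f : Z.1 ⟶ W.1)
    (h : ∀ x z, f.lin (centerOp Z x z) = centerOp W x (f.lin z)) : Z ⟶ W where
  f := f
  comm U := by
    apply hom_ext
    refine tensor_lin_ext fun a x z u hz hu => ?_
    rw [comp_lin_apply, comp_lin_apply, halfBraiding_apply Z hu, whiskerLeft_lin_tmul,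
      whiskerRight_lin_tmul, halfBraiding_apply W hu, h]

theorem hom_centerOp {Z W : Center (GrVec ω)} (f : Z ⟶ W) (x : G) (z : Z.1.carrier) :
    f.f.lin (centerOp Z x z) = centerOp W x (f.f.lin z) := by
  have h := LinearMap.congr_fun (congrArg Hom.lin (f.comm (single ω x))) (z ⊗ₜ[k] (1 : k))
  rw [comp_lin_apply, comp_lin_apply, halfBraiding_single Z, whiskerLeft_lin_tmul,
      whiskerRight_lin_tmul, halfBraiding_single W] at h
  have h2 := congrArg (TensorProduct.lid k W.1.carrier) h
  exact ((one_smul k _).symm.trans (h2.trans (one_smul k _))).symm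

/-- Isomorphisms of the center from graded linear equivalences which commute with the operators. -/
def centerIso {Z W : Center (GrVec ω)} (e : Z.1.carrier ≃ₗ[k] W.1.carrier)
    (h : ∀ g x, IsHomog (X := Z.1) g x → IsHomog (X := W.1) g (e x))
    (h' : ∀ x z, e (centerOp Z x z) = centerOp W x (e z)) : Z ≅ W :=
  have : IsIso (mkIso e h).hom := inferInstance
  have : IsIso (centerHom (mkIso e h).hom h').f := this
  asIso (centerHom (mkIso e h).hom h')

theorem isIso_of_bijective {Z W : Center (GrVec ω)} (f : Z ⟶ W)
    (hf : Function.Bijective f.f.lin) : IsIso f := by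
  have e : f = (centerIso (LinearEquiv.ofBijective f.f.lin hf) (fun _ _ hx => hx.map f.f)
    (hom_centerOp f)).hom := by
    apply Center.ext
    rfl
  rw [e]
  infer_instance

/-- The isomorphism of carriers given by an isomorphism of graded vector spaces. -/
def isoEquiv {X Y : GrVec ω} (e : X ≅ Y) : X.carrier ≃ₗ[k] Y.carrier :=
  LinearEquiv.ofLinearMap e.hom.lin e.inv.lin (congrArg Hom.lin e.inv_hom_id)
    (congrArg Hom.lin e.hom_inv_id)

/-- The scalar collects the three associators in the half-braiding of a tensor product. -/
theorem centerOp_tensor (Z W : Center (GrVec ω)) (x : G) {v w : G} {z : Z.1.carrier}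
    {z' : W.1.carrier} (hz : IsHomog v z) (hz' : IsHomog w z') :
    centerOp (Z ⊗ W) x (z ⊗ₜ[k] z') =
      ((ω.toFun v w x * (ω.toFun v x w)⁻¹ * ω.toFun x v w : kˣ) : k) •
        (centerOp Z x z ⊗ₜ[k] centerOp W x z') := by
  have hx := isHomog_single (ω := ω) x (1 : k)
  have h : (((α_ Z.1 W.1 (single ω x)).hom ≫ Z.1 ◁ (W.2.β (single ω x)).hom ≫
      (α_ Z.1 (single ω x) W.1).inv ≫ (Z.2.β (single ω x)).hom ▷ W.1 ≫
      (α_ (single ω x) Z.1 W.1).hom)).lin ((z ⊗ₜ[k] z') ⊗ₜ[k] (1 : k)) =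
      (1 : k) ⊗ₜ[k] centerOp (Z ⊗ W) x (z ⊗ₜ[k] z') :=
    halfBraiding_single (Z ⊗ W) x (z ⊗ₜ[k] z')
  rw [comp_lin_apply, assoc_hom_apply hz hz' hx, map_smul, comp_lin_apply, whiskerLeft_lin_tmul,
    halfBraiding_single, comp_lin_apply, assoc_inv_apply hz hx (centerOp_homog W x hz'), map_smul,
    comp_lin_apply, whiskerRight_lin_tmul, halfBraiding_single,
    assoc_hom_apply hx (centerOp_homog Z x hz) (centerOp_homog W x hz'), smul_smul, smul_smul] at h
  have h2 := congrArg (TensorProduct.lid k (Z.1.carrier ⊗[k] W.1.carrier)) h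
  rw [map_smul, TensorProduct.lid_tmul, one_smul] at h2
  rw [Units.val_mul, Units.val_mul]
  exact ((one_smul k _).symm.trans h2.symm)

/-- The scalar comes from the unit constraints, since `ω` need not be normalized. These eigenvalues
trivialize `β_1`. -/
theorem centerOp_unit (x : G) (c : k) :
    centerOp (𝟙_ (Center (GrVec ω))) x c = ((ω.toFun 1 1 x * ω.toFun x 1 1)⁻¹ : kˣ).1 * c := by
  have hx := isHomog_single (ω := ω) x (1 : k)
  have h : ((λ_ (single ω x)).hom ≫ (ρ_ (single ω x)).inv).lin (c ⊗ₜ[k] (1 : k)) =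
      (1 : k) ⊗ₜ[k] centerOp (𝟙_ (Center (GrVec ω))) x c :=
    halfBraiding_single (𝟙_ (Center (GrVec ω))) x c
  have h1 : ∀ a : k, (ρ_ (single ω x)).inv.lin a = a ⊗ₜ[k] ((ω.toFun x 1 1)⁻¹ : kˣ).1 := fun a => by
    change (rightUnitEquiv (single ω x)).symm a = _
    rw [LinearEquiv.symm_apply_eq, rightUnitEquiv_apply (isHomog_single (ω := ω) x a)]
    change a = (ω.toFun x 1 1 : k) * (((ω.toFun x 1 1)⁻¹ : kˣ).1 * a)
    rw [Units.mul_inv_cancel_left]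
  have h0 : (λ_ (single ω x)).hom.lin (c ⊗ₜ[k] (1 : k)) = ((ω.toFun 1 1 x)⁻¹ : kˣ).1 * (c * 1) :=
    leftUnitEquiv_apply hx c
  rw [comp_lin_apply, h0, h1] at h
  have h2 := congrArg (TensorProduct.lid k k) h
  rw [TensorProduct.lid_tmul] at h2
  refine ((one_smul k _).symm.trans h2.symm).trans ?_
  rw [smul_eq_mul, mul_one, mul_inv, Units.val_mul]
  ring

end GrVec

/-- The multipliers `β_v` are multiplicative in `v` up to an explicit coboundary. -/
theorem betaCocycle_mul_index {G M : Type u} [CommGroup G] [CommGroup M] (ω : ThreeCocycle G M)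
    (v w x y : G) :
    (betaCocycle ω (v * w)).toFun x y *
        (ω.toFun v w (x * y) * (ω.toFun v (x * y) w)⁻¹ * ω.toFun (x * y) v w) =
      (ω.toFun v w x * (ω.toFun v x w)⁻¹ * ω.toFun x v w) *
        (ω.toFun v w y * (ω.toFun v y w)⁻¹ * ω.toFun y v w) *
        ((betaCocycle ω v).toFun x y * (betaCocycle ω w).toFun x y) := by
  -- The cocycle relations at the six shuffles of `(v, w)` with `(x, y)`; they are added below with
  -- the signs of the shuffles.
  have h1 := congrArg Additive.ofMul (ω.cocycle v w x y)
  have h2 := congrArg Additive.ofMul (ω.cocycle v x w y)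
  have h3 := congrArg Additive.ofMul (ω.cocycle v x y w)
  have h4 := congrArg Additive.ofMul (ω.cocycle x v w y)
  have h5 := congrArg Additive.ofMul (ω.cocycle x v y w)
  have h6 := congrArg Additive.ofMul (ω.cocycle x y v w)
  rw [mul_comm w x] at h1
  rw [mul_comm w y] at h2
  rw [mul_comm x v] at h4 h5
  rw [mul_comm y v] at h6
  apply Additive.ofMul.injective
  simp only [betaCocycle, ofMul_mul, ofMul_div, ofMul_inv] at h1 h2 h3 h4 h5 h6 ⊢
  rw [mul_comm y w] at h5
  rw [← sub_eq_zero] at h1 h2 h3 h4 h5 h6 ⊢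
  have h := congrArg₂ (· + ·) (congrArg₂ (· - ·) (congrArg₂ (· + ·) (congrArg₂ (· + ·)
    (congrArg₂ (· - ·) h1 h2) h3) h4) h5) h6
  simp only [sub_zero, add_zero] at h
  rw [← neg_eq_zero, ← h]
  abel

/-! ### Invertible central objects -/

namespace GrVec

variable {k G : Type u} [Field k] [CommGroup G] [Fintype G] {ω : ThreeCocycle G kˣ}

theorem IsHomog.eq_of_ne_zero {X : GrVec ω} {a b : G} {x : X.carrier} (ha : IsHomog a x)
    (hb : IsHomog b x) (hx : x ≠ 0) : a = b := by
  by_contra h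
  exact hx (ha.symm.trans ((congrArg (X.proj a) hb.symm).trans (X.proj_ne a b x h)))

theorem isHomog_zero (X : GrVec ω) (g : G) : IsHomog (X := X) g 0 := map_zero (X.proj g)

theorem exists_proj_ne_zero (X : GrVec ω) {x : X.carrier} (hx : x ≠ 0) : ∃ v, X.proj v x ≠ 0 := by
  by_contra! h
  exact hx ((X.sum_proj x).symm.trans (Finset.sum_eq_zero fun v _ => h v))

/-- The central action on the object `v` given by a trivialization of `β_v`. -/
def singleAction (v : G) (f : G → kˣ)
    (hf : ∀ x y, (betaCocycle ω v).toFun x y = f y * f x / f (x * y)) :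
    CentralAction (single ω v) where
  op x := LinearEquiv.smulOfUnit (f x)
  homog x _ _ hz := hz.smul (f x : k)
  mul x y w z hz := by
    by_cases h0 : z = 0
    · simp [h0]
    · rw [hz.eq_of_ne_zero (isHomog_single v z) h0, hf x y]
      change (f y : k) * ((f x : k) * z) = _ * ((f (x * y) : k) * z)
      rw [← mul_assoc, ← mul_assoc, ← Units.val_mul, ← Units.val_mul, div_mul_cancel]

/-- The object `v` of `C(G, ω)` with the central structure given by a trivialization of `β_v`. -/
def centerSingle (v : G) (f : G → kˣ)
    (hf : ∀ x y, (betaCocycle ω v).toFun x y = f y * f x / f (x * y)) : Center (GrVec ω) :=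
  (singleAction v f hf).toCenter

theorem centerOp_centerSingle (v : G) (f : G → kˣ)
    (hf : ∀ x y, (betaCocycle ω v).toFun x y = f y * f x / f (x * y)) (x : G) (c : k) :
    centerOp (centerSingle v f hf) x c = (f x : k) * c :=
  (singleAction v f hf).centerOp_toCenter x c

/-- The eigenvalues of a homogeneous common eigenvector of degree `v` trivialize `β_v`. -/
theorem exists_units_of_eigenvector (Z : Center (GrVec ω)) {v : G} {z : Z.1.carrier}
    (hz : IsHomog v z) (h0 : z ≠ 0) (c : G → k) (hc : ∀ x, centerOp Z x z = c x • z) :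
    ∃ f : G → kˣ, (∀ x, (f x : k) = c x) ∧
      ∀ x y, (betaCocycle ω v).toFun x y = f y * f x / f (x * y) := by
  have hne : ∀ x, c x ≠ 0 := fun x hx => by
    have h := hc x
    rw [hx, zero_smul] at h
    exact h0 ((LinearEquiv.map_eq_zero_iff _).1 h)
  refine ⟨fun x => Units.mk0 (c x) (hne x), fun _ => rfl, fun x y => ?_⟩
  have h := centerOp_mul Z x y hz
  rw [hc, hc, map_smul, hc, smul_smul, smul_smul] at h
  rw [eq_div_iff_mul_eq']
  apply Units.ext
  rw [Units.val_mul, Units.val_mul, mul_comm (Units.val (Units.mk0 (c y) _))]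
  exact (smul_left_injective k h0 h).symm

/-- The morphism from a one-dimensional central object given by a common eigenvector. -/
def centerSingleHom (Z : Center (GrVec ω)) {v : G} {z : Z.1.carrier} (hz : IsHomog v z)
    (f : G → kˣ) (hf : ∀ x y, (betaCocycle ω v).toFun x y = f y * f x / f (x * y))
    (hc : ∀ x, centerOp Z x z = (f x : k) • z) : centerSingle v f hf ⟶ Z :=
  centerHom (ofHomog hz) fun x (c : k) => by
    refine (congrArg (ofHomog hz).lin (centerOp_centerSingle v f hf x c)).trans ?_
    change ((f x : k) * (c : k)) • z = centerOp Z x ((c : k) • z)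
    refine Eq.trans ?_ (map_smul (centerOp Z x) (c : k) z).symm
    rw [hc, smul_smul, mul_comm]

theorem centerSingle_iso_of_finrank (Z : Center (GrVec ω)) (h : Module.finrank k Z.1.carrier = 1)
    {v : G} {z : Z.1.carrier} (hz : IsHomog v z) (h0 : z ≠ 0) (f : G → kˣ)
    (hf : ∀ x y, (betaCocycle ω v).toFun x y = f y * f x / f (x * y))
    (hc : ∀ x, centerOp Z x z = (f x : k) • z) : Nonempty (centerSingle v f hf ≅ Z) := by
  have : IsIso (centerSingleHom Z hz f hf hc) := isIso_of_bijective _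
    ⟨smul_left_injective k h0, (finrank_eq_one_iff_of_nonzero' _ h0).1 h⟩
  exact ⟨asIso (centerSingleHom Z hz f hf hc)⟩

theorem exists_centerSingle_iso (Z : Center (GrVec ω)) (h : Module.finrank k Z.1.carrier = 1) :
    ∃ v f hf, Nonempty (centerSingle (ω := ω) v f hf ≅ Z) := by
  have : Nontrivial Z.1.carrier := Module.nontrivial_of_finrank_pos (R := k) (by omega)
  obtain ⟨z', hz'⟩ := exists_ne (0 : Z.1.carrier)
  obtain ⟨v, hv⟩ := exists_proj_ne_zero Z.1 hz'
  have hz := Z.1.isHomog_proj v z'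
  choose c hc using fun x => (finrank_eq_one_iff_of_nonzero' _ hv).1 h (centerOp Z x (Z.1.proj v z'))
  obtain ⟨f, hf, hf'⟩ := exists_units_of_eigenvector Z hz hv c fun x => (hc x).symm
  exact ⟨v, f, hf', centerSingle_iso_of_finrank Z h hz hv f hf' fun x => by rw [hf, hc]⟩

theorem finrank_eq_of_iso {X Y : GrVec ω} (e : X ≅ Y) :
    Module.finrank k X.carrier = Module.finrank k Y.carrier := (isoEquiv e).finrank_eq

/-- Dimension is multiplicative for tensor products and the unit object has dimension `1`. -/
theorem finrank_eq_one_of_isInvertibleObj {Z : Center (GrVec ω)} (h : IsInvertibleObj Z) :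
    Module.finrank k Z.1.carrier = 1 := by
  obtain ⟨W, ⟨e⟩, -⟩ := h
  have h1 := finrank_eq_of_iso ((Center.forget (GrVec ω)).mapIso e)
  have h2 : Module.finrank k (Z.1.carrier ⊗[k] W.1.carrier) = 1 :=
    h1.trans (Module.finrank_self k)
  rw [Module.finrank_tensorProduct] at h2
  exact Nat.eq_one_of_mul_eq_one_right h2

theorem isInvertibleObj_of_iso {C : Type*} [Category C] [MonoidalCategory C] {X Y : C} (e : X ≅ Y)
    (h : IsInvertibleObj X) : IsInvertibleObj Y := by
  obtain ⟨W, ⟨a⟩, ⟨b⟩⟩ := h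
  exact ⟨W, ⟨(whiskerRightIso e W).symm ≪≫ a⟩, ⟨(whiskerLeftIso W e).symm ≪≫ b⟩⟩

/-- The inverse lives in degree `v⁻¹`. Its eigenvalues are forced by requiring the tensor product to
have those of the unit object, and `betaCocycle_mul_index` shows that they trivialize `β_{v⁻¹}`. -/
theorem isInvertibleObj_centerSingle (v : G) (f : G → kˣ)
    (hf : ∀ x y, (betaCocycle ω v).toFun x y = f y * f x / f (x * y)) :
    IsInvertibleObj (centerSingle v f hf) := by
  obtain ⟨f0, hf0, hf0'⟩ := exists_units_of_eigenvector (𝟙_ (Center (GrVec ω)))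
    (isHomog_single (ω := ω) 1 (1 : k)) (one_ne_zero (α := k)) _ fun x => centerOp_unit x 1
  let c : G → kˣ := fun x => ω.toFun v v⁻¹ x * (ω.toFun v x v⁻¹)⁻¹ * ω.toFun x v v⁻¹
  -- Solves `c x * f x * f' x = f0 x`, where `c` is the scalar of `centerOp_tensor` and `f0` the
  -- eigenvalue on the unit.
  let f' : G → kˣ := fun x => f0 x / (c x * f x)
  have hf' : ∀ x y, (betaCocycle ω v⁻¹).toFun x y = f' y * f' x / f' (x * y) := fun x y => by
    have h := betaCocycle_mul_index ω v v⁻¹ x y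
    rw [mul_inv_cancel, hf0' x y, hf x y] at h
    change _ * c (x * y) = c x * c y * _ at h
    simp only [f']
    have h' := congrArg Additive.ofMul h
    apply Additive.ofMul.injective
    simp only [ofMul_mul, ofMul_div] at h' ⊢
    rw [← sub_eq_zero] at h' ⊢
    rw [← neg_eq_zero, ← h']
    abel
  obtain ⟨e0⟩ := centerSingle_iso_of_finrank (𝟙_ (Center (GrVec ω))) (Module.finrank_self k)
    (isHomog_single (ω := ω) 1 (1 : k)) (one_ne_zero (α := k)) f0 hf0' fun x => by
      rw [hf0]
      exact centerOp_unit x 1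
  let Z := centerSingle v f hf ⊗ centerSingle v⁻¹ f' hf'
  have h1 : IsHomog (X := Z.1) (v * v⁻¹) ((1 : k) ⊗ₜ[k] (1 : k)) :=
    (isHomog_single (ω := ω) v (1 : k)).tmul (isHomog_single (ω := ω) v⁻¹ (1 : k))
  rw [mul_inv_cancel] at h1
  have h2 : Module.finrank k (k ⊗[k] k) = 1 := by
    rw [Module.finrank_tensorProduct, Module.finrank_self]
  have h3 : ((1 : k) ⊗ₜ[k] (1 : k) : k ⊗[k] k) ≠ 0 := fun h =>
    one_ne_zero (α := k) (by simpa using congrArg (TensorProduct.lid k k) h)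
  obtain ⟨e1⟩ := centerSingle_iso_of_finrank Z h2 h1 h3 f0 hf0' fun x => by
    refine (centerOp_tensor (centerSingle v f hf) (centerSingle v⁻¹ f' hf') x
      (isHomog_single (ω := ω) v (1 : k)) (isHomog_single (ω := ω) v⁻¹ (1 : k))).trans ?_
    have h4 : ∀ a b d : k, d • ((a * 1) ⊗ₜ[k] (b * 1)) = (d * (a * b)) • ((1 : k) ⊗ₜ[k] (1 : k)) :=
      fun a b d => by
        rw [← smul_eq_mul a, ← smul_eq_mul b, TensorProduct.smul_tmul_smul, smul_smul]
    change (c x : k) • (centerOp (centerSingle v f hf) x (1 : k) ⊗ₜ[k]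
      centerOp (centerSingle v⁻¹ f' hf') x (1 : k)) = _
    rw [centerOp_centerSingle, centerOp_centerSingle]
    refine (h4 _ _ _).trans ?_
    rw [← Units.val_mul, ← Units.val_mul]
    simp only [f']
    rw [← mul_assoc, mul_div_cancel]
    rfl
  -- The braiding of the center turns the right inverse into a left inverse.
  exact ⟨_, ⟨e1.symm ≪≫ e0⟩, ⟨β_ _ _ ≪≫ e1.symm ≪≫ e0⟩⟩

theorem exists_trivialization_of_iso_single (Z : Center (GrVec ω)) {v : G}
    (e : Z.1 ≅ single ω v) :
    ∃ f : G → kˣ, ∀ x y, (betaCocycle ω v).toFun x y = f y * f x / f (x * y) := by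
  have hz := (isHomog_single (ω := ω) v (1 : k)).map e.inv
  have h0 : e.inv.lin (1 : k) ≠ 0 := fun h =>
    one_ne_zero (α := k) ((LinearEquiv.map_eq_zero_iff (isoEquiv e).symm).1 h)
  have h1 : Module.finrank k Z.1.carrier = 1 := (finrank_eq_of_iso e).trans (Module.finrank_self k)
  choose c hc using fun x => (finrank_eq_one_iff_of_nonzero' _ h0).1 h1 (centerOp Z x _)
  obtain ⟨f, -, hf⟩ := exists_units_of_eigenvector Z hz h0 c fun x => (hc x).symm
  exact ⟨f, hf⟩

theorem exists_isInvertibleObj_iff (v : G) :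
    (∃ Z : Center (GrVec ω), IsInvertibleObj Z ∧
      Nonempty ((Center.forget (GrVec ω)).obj Z ≅ single ω v)) ↔ (betaCocycle ω v).cls = 0 := by
  rw [TwoCocycle.cls_eq_zero_iff]
  constructor
  · rintro ⟨Z, -, ⟨e⟩⟩
    exact exists_trivialization_of_iso_single Z e
  · rintro ⟨f, hf⟩
    exact ⟨centerSingle v f hf, isInvertibleObj_centerSingle v f hf, ⟨Iso.refl _⟩⟩

end GrVec

/-- A representation of a finite abelian group on a finite dimensional space is spanned by common
eigenvectors. -/
theorem span_common_eigenvectors {k : Type*} [Field k] [IsAlgClosed k] [CharZero k] {G W : Type*}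
    [CommGroup G] [Finite G] [AddCommGroup W] [Module k W] [FiniteDimensional k W]
    (ρ : G →* Module.End k W) :
    Submodule.span k {w : W | ∃ c : G → k, ∀ x, ρ x w = c x • w} = ⊤ := by
  -- Over an algebraically closed field, joint generalized eigenspaces of commuting operators span.
  rw [eq_top_iff, ← Module.End.iSup_iInf_maxGenEigenspace_eq_top_of_iSup_maxGenEigenspace_eq_top_of_commute
    (fun x => ρ x) (fun x y _ => (Commute.all x y).map ρ)
    (fun x => Module.End.iSup_maxGenEigenspace_eq_top (ρ x))]
  refine iSup_le fun χ w hw => Submodule.subset_span ⟨χ, fun x => ?_⟩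
  have hx := (Submodule.mem_iInf _).1 hw x
  -- Each operator is annihilated by `X ^ |G| - 1`, separable in characteristic `0`, so generalized
  -- eigenspaces are eigenspaces.
  have hss : (ρ x).IsSemisimple := by
    have : Squarefree (Polynomial.X ^ Nat.card G - 1 : Polynomial k) :=
      ((Polynomial.X_pow_sub_one_separable_iff).2 (Nat.cast_ne_zero.2 Nat.card_pos.ne')).squarefree
    refine Module.End.isSemisimple_of_squarefree_aeval_eq_zero this ?_
    rw [map_sub, map_pow, Polynomial.aeval_X, map_one, ← map_pow, pow_card_eq_one', map_one,
      sub_self]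
  rw [hss.isFinitelySemisimple.maxGenEigenspace_eq_eigenspace] at hx
  exact Module.End.mem_eigenspace_iff.1 hx

/-! ### Common eigenvectors, simple objects and pointedness -/

namespace GrVec

variable {k G : Type u} [Field k] [CommGroup G] [Fintype G] {ω : ThreeCocycle G kˣ}

/-- A trivialization of `β_v` turns the operators on the component of degree `v` into a
representation. -/
def componentRep (Z : Center (GrVec ω)) (v : G) (f : G → kˣ)
    (hf : ∀ x y, (betaCocycle ω v).toFun x y = f y * f x / f (x * y)) :
    G →* Module.End k (LinearMap.range (Z.1.proj v)) :=
  have hmul : ∀ (x y : G) (z : Z.1.carrier), IsHomog v z →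
      ((f (x * y))⁻¹ : kˣ).1 • centerOp Z (x * y) z =
        ((f x)⁻¹ : kˣ).1 • centerOp Z x (((f y)⁻¹ : kˣ).1 • centerOp Z y z) := fun x y z hz => by
    rw [map_smul, centerOp_mul Z y x hz, hf, smul_smul, smul_smul, mul_comm x y, ← Units.val_mul,
      ← Units.val_mul]
    congr 2
    rw [← mul_inv, ← mul_div_assoc, inv_mul_cancel, one_div]
  have hone : ∀ z : Z.1.carrier, IsHomog v z → ((f 1)⁻¹ : kˣ).1 • centerOp Z 1 z = z := fun z hz => by
    have h := hmul 1 1 z hz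
    rw [mul_one] at h
    exact ((centerOp Z 1).injective (((smul_right_injective _ (Units.ne_zero _)) h))).symm
  { toFun x := (((f x)⁻¹ : kˣ).1 • (centerOp Z x).toLinearMap).restrict
      (p := LinearMap.range (Z.1.proj v)) (q := LinearMap.range (Z.1.proj v)) (by
      rintro _ ⟨z, rfl⟩
      exact ⟨_, (centerOp_homog Z x (Z.1.isHomog_proj v z)).smul _⟩)
    map_one' := by
      ext ⟨_, z, rfl⟩
      exact hone _ (Z.1.isHomog_proj v z)
    map_mul' x y := by
      ext ⟨_, z, rfl⟩
      exact hmul x y _ (Z.1.isHomog_proj v z) }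

/-- Dividing by the trivialization `f` turns the operators on the component into a genuine
representation, which is spanned by eigenvectors; multiplying the eigenvalues by `f` goes back. -/
theorem mem_span_eigenvectors [IsAlgClosed k] [CharZero k] (Z : Center (GrVec ω)) {v : G}
    (f : G → kˣ) (hf : ∀ x y, (betaCocycle ω v).toFun x y = f y * f x / f (x * y))
    {z : Z.1.carrier} (hz : IsHomog v z) :
    z ∈ Submodule.span k {w : Z.1.carrier | IsHomog v w ∧ ∃ c : G → k, ∀ x, centerOp Z x w = c x • w} := by
  have h := Submodule.map_span (LinearMap.range (Z.1.proj v)).subtype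
    {w | ∃ c : G → k, ∀ x, componentRep Z v f hf x w = c x • w}
  rw [span_common_eigenvectors, Submodule.map_top, Submodule.range_subtype] at h
  have hz' : z ∈ LinearMap.range (Z.1.proj v) := ⟨z, hz⟩
  rw [h] at hz'
  refine Submodule.span_mono ?_ hz'
  rintro _ ⟨⟨_, w, rfl⟩, ⟨c, hc⟩, rfl⟩
  refine ⟨Z.1.isHomog_proj v w, fun x => f x * c x, fun x => ?_⟩
  have h1 : ((f x)⁻¹ : kˣ).1 • centerOp Z x (Z.1.proj v w) = c x • Z.1.proj v w :=
    congrArg Subtype.val (hc x)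
  change centerOp Z x (Z.1.proj v w) = (f x * c x : k) • Z.1.proj v w
  rw [mul_smul, ← h1, smul_smul, Units.mul_inv, one_smul]

theorem exists_eigenvector [IsAlgClosed k] [CharZero k] (Z : Center (GrVec ω)) {v : G}
    (f : G → kˣ) (hf : ∀ x y, (betaCocycle ω v).toFun x y = f y * f x / f (x * y))
    {z : Z.1.carrier} (hz : IsHomog v z) (h0 : z ≠ 0) :
    ∃ w : Z.1.carrier, IsHomog v w ∧ w ≠ 0 ∧ ∃ c : G → k, ∀ x, centerOp Z x w = c x • w := by
  by_contra! h
  have hs := mem_span_eigenvectors Z f hf hz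
  refine h0 ((Submodule.mem_bot k).1 ((Submodule.span_le.2 ?_) hs))
  rintro w ⟨hw, c, hc⟩
  by_contra hw0
  obtain ⟨x, hx⟩ := h w hw hw0 c
  exact hx (hc x)

theorem centerHom_ext {Z W : Center (GrVec ω)} {f g : Z ⟶ W}
    (h : ∀ z, f.f.lin z = g.f.lin z) : f = g := by
  apply Center.ext
  apply hom_ext
  exact LinearMap.ext h

theorem mono_of_injective {Z W : Center (GrVec ω)} (f : Z ⟶ W)
    (hf : Function.Injective f.f.lin) : Mono f where
  right_cancellation _ _ e := centerHom_ext fun z =>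
    hf (LinearMap.congr_fun (congrArg (fun a => Hom.lin (Center.Hom.f a)) e) z)

/-- A nonzero homogeneous component of a simple object contains a common eigenvector. It spans a
one-dimensional central subobject, which by simplicity is everything. -/
theorem isPointedCategory_of_trivial [IsAlgClosed k] [CharZero k]
    (h : ∀ v : G, ∃ f : G → kˣ, ∀ x y, (betaCocycle ω v).toFun x y = f y * f x / f (x * y)) :
    IsPointedCategory (Center (GrVec ω)) := by
  intro Z hZ
  have hne : (𝟙 Z : Z ⟶ Z) ≠ 0 := (Simple.mono_isIso_iff_nonzero (𝟙 Z)).1 inferInstance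
  obtain ⟨z, hz⟩ : ∃ z : Z.1.carrier, z ≠ 0 := by
    by_contra! h
    exact hne (centerHom_ext fun z => h z)
  obtain ⟨v, hv⟩ := exists_proj_ne_zero Z.1 hz
  obtain ⟨f, hf⟩ := h v
  obtain ⟨w, hw, hw0, c, hc⟩ := exists_eigenvector Z f hf (Z.1.isHomog_proj v z) hv
  obtain ⟨g, hg, hg'⟩ := exists_units_of_eigenvector Z hw hw0 c hc
  let F := centerSingleHom Z hw g hg' fun x => by rw [hg, hc]
  have hF : ∀ a : k, F.f.lin a = a • w := fun _ => rfl
  have : Mono F := mono_of_injective F (smul_left_injective k hw0)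
  have hF0 : F ≠ 0 := fun h0 => hw0 (by
    have h1 := hF 1
    rw [h0, one_smul] at h1
    exact h1.symm)
  have : IsIso F := isIso_of_mono_of_nonzero hF0
  exact isInvertibleObj_of_iso (asIso F) (isInvertibleObj_centerSingle v g hg')

/-- A graded subspace. -/
abbrev subobj (X : GrVec ω) (W : Submodule k X.carrier) (hW : ∀ g, ∀ w ∈ W, X.proj g w ∈ W) :
    GrVec ω where
  carrier := W
  proj g := (X.proj g).restrict (hW g)
  proj_self g x := Subtype.ext (X.proj_self g x)
  proj_ne g h x hgh := Subtype.ext (X.proj_ne g h x hgh)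
  sum_proj x := Subtype.ext (by
    rw [AddSubmonoidClass.coe_finsetSum]
    exact X.sum_proj x)

theorem subobj_isHomog {X : GrVec ω} {W : Submodule k X.carrier}
    {hW : ∀ g, ∀ w ∈ W, X.proj g w ∈ W} {g : G} {w : W} :
    IsHomog (X := X.subobj W hW) g w ↔ IsHomog (X := X) g w := Subtype.ext_iff

/-- The central action on a stable graded subspace. -/
def CentralAction.restrict {X : GrVec ω} (A : CentralAction X) (W : Submodule k X.carrier)
    (hW : ∀ g, ∀ w ∈ W, X.proj g w ∈ W) (hW' : ∀ x, ∀ w ∈ W, A.op x w ∈ W) :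
    CentralAction (X.subobj W hW) where
  op x := LinearEquiv.ofInjectiveEndo ((A.op x).toLinearMap.restrict (hW' x))
    fun _ _ h => Subtype.ext ((A.op x).injective (congrArg Subtype.val h))
  homog x _ _ hz := subobj_isHomog.2 (A.homog x (subobj_isHomog.1 hz))
  mul x y _ _ hz := Subtype.ext (A.mul x y (subobj_isHomog.1 hz))

/-- The kernel of the linear map is graded and stable under the operators, hence a central object.
Its inclusion is killed by `f`, so it is zero. -/
theorem injective_of_mono {Y Z : Center (GrVec ω)} (f : Y ⟶ Z) [Mono f] :
    Function.Injective f.f.lin := by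
  let A := (centralAction Y).restrict (LinearMap.ker f.f.lin)
    (fun g w hw => by
      rw [LinearMap.mem_ker] at hw ⊢
      rw [f.f.comm, hw, map_zero])
    (fun x w hw => by
      rw [LinearMap.mem_ker] at hw ⊢
      exact (hom_centerOp f x w).trans (by rw [hw, map_zero]))
  let i : A.toCenter ⟶ Y := centerHom ⟨(LinearMap.ker f.f.lin).subtype, fun _ _ => rfl⟩
    fun x w => congrArg Subtype.val (A.centerOp_toCenter x w)
  have hi : i ≫ f = 0 ≫ f := centerHom_ext fun w => w.2.trans (map_zero f.f.lin).symm
  have h0 : i = 0 := (cancel_mono f).1 hi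
  rw [← LinearMap.ker_eq_bot, eq_bot_iff]
  intro w hw
  exact LinearMap.congr_fun (congrArg (fun a => Hom.lin (Center.Hom.f a)) h0)
    (⟨w, hw⟩ : LinearMap.ker f.f.lin)

/-- A multiple of the simple object `v`. -/
abbrev concentrated (ω : ThreeCocycle G kˣ) (v : G) (W : Type u) [AddCommGroup W] [Module k W]
    [Module.Finite k W] : GrVec ω where
  carrier := W
  proj := open Classical in fun h => if h = v then LinearMap.id else 0
  proj_self h x := by split_ifs <;> simp
  proj_ne h h' x hh := by
    split_ifs with h1 h2
    · exact absurd (h1.trans h2.symm) hh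
    all_goals simp
  sum_proj x := by
    rw [Finset.sum_eq_single v]
    · simp
    · intro b _ hb; simp [hb]
    · simp

theorem isHomog_concentrated {v : G} {W : Type u} [AddCommGroup W] [Module k W]
    [Module.Finite k W] (w : W) : IsHomog (X := concentrated ω v W) v w := by
  classical
  change (if v = v then LinearMap.id else 0 : W →ₗ[k] W) w = w
  rw [if_pos rfl, LinearMap.id_apply]

/-- The operators of a central action on a graded space concentrated in one degree. -/
def concentratedAction (v : G) {W : Type u} [AddCommGroup W] [Module k W] [Module.Finite k W]
    (T : G → W ≃ₗ[k] W)
    (hT : ∀ x y w, T y (T x w) = ((betaCocycle ω v).toFun x y : k) • T (x * y) w) :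
    CentralAction (concentrated ω v W) where
  op := T
  homog x a w hw := by
    by_cases h0 : w = 0
    · rw [h0, map_zero]
      exact isHomog_zero _ _
    · rw [hw.eq_of_ne_zero (isHomog_concentrated w) h0]
      exact isHomog_concentrated _
  mul x y a w hw := by
    by_cases h0 : w = 0
    · rw [h0, map_zero, map_zero, map_zero, smul_zero]
    · rw [hw.eq_of_ne_zero (isHomog_concentrated w) h0]
      exact hT x y w

/-- The twisted regular representation of `G` with multiplier `β_v`. -/
def regularOp (ω : ThreeCocycle G kˣ) (v x : G) : (G → k) ≃ₗ[k] (G → k) where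
  toFun h g := ((betaCocycle ω v).toFun x g : k) * h (x * g)
  invFun h g := (((betaCocycle ω v).toFun x (x⁻¹ * g))⁻¹ : kˣ).1 * h (x⁻¹ * g)
  map_add' h h' := by ext g; simp [mul_add]
  map_smul' c h := by ext g; simp [mul_left_comm]
  left_inv h := by ext g; simp
  right_inv h := by ext g; simp

theorem regularOp_regularOp (v x y : G) (h : G → k) :
    regularOp ω v y (regularOp ω v x h) =
      ((betaCocycle ω v).toFun x y : k) • regularOp ω v (x * y) h := by
  funext g
  change ((betaCocycle ω v).toFun y g : k) * (((betaCocycle ω v).toFun x (y * g) : k) *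
    h (x * (y * g))) = ((betaCocycle ω v).toFun x y : k) *
    (((betaCocycle ω v).toFun (x * y) g : k) * h (x * y * g))
  have e := congrArg Units.val ((betaCocycle ω v).cocycle x y g)
  push_cast at e
  rw [mul_assoc x y g]
  linear_combination h (x * (y * g)) * e

/-- Every degree supports a simple central object. -/
theorem exists_simple_concentrated (ω : ThreeCocycle G kˣ) (v : G) :
    ∃ Z : Center (GrVec ω), Simple Z ∧ ∀ z : Z.1.carrier, IsHomog v z := by
  classical
  -- A nonzero central object of minimal dimension in degree `v` is simple; the twisted regular
  -- representation shows that one exists.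
  let P : ℕ → Prop := fun n => ∃ Z : Center (GrVec ω), (∀ z : Z.1.carrier, IsHomog v z) ∧
    Nontrivial Z.1.carrier ∧ Module.finrank k Z.1.carrier = n
  have hP : ∃ n, P n := ⟨_, (concentratedAction v (regularOp ω v) (regularOp_regularOp v)).toCenter,
    fun w => isHomog_concentrated (W := G → k) w, (inferInstance : Nontrivial (G → k)), rfl⟩
  obtain ⟨Z, hZ, hnt, hn⟩ := Nat.find_spec hP
  refine ⟨Z, ⟨fun {Y} f _ => ⟨fun hf h0 => ?_, fun hf => ?_⟩⟩, hZ⟩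
  · obtain ⟨z, hz⟩ := exists_ne (0 : Z.1.carrier)
    have h1 : 𝟙 Z = 0 := (IsIso.inv_hom_id f).symm.trans
      ((congrArg (fun a => inv f ≫ a) h0).trans Limits.comp_zero)
    exact hz (LinearMap.congr_fun (congrArg (fun a => Hom.lin (Center.Hom.f a)) h1) z)
  · have hinj := injective_of_mono f
    have hY : ∀ y : Y.1.carrier, IsHomog v y := fun y => hinj (by
      rw [f.f.comm]
      exact hZ _)
    have hYnt : Nontrivial Y.1.carrier := by
      by_contra hnt
      rw [not_nontrivial_iff_subsingleton] at hnt
      refine hf (centerHom_ext fun y => ?_)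
      rw [Subsingleton.elim y 0, map_zero, map_zero]
    have h1 : Module.finrank k Z.1.carrier ≤ Module.finrank k Y.1.carrier := by
      rw [hn]
      exact Nat.find_min' hP ⟨Y, hY, hYnt, rfl⟩
    have h2 := le_antisymm (LinearMap.finrank_le_finrank_of_injective hinj) h1
    exact isIso_of_bijective f ⟨hinj, (LinearMap.injective_iff_surjective_of_finrank_eq_finrank h2).1 hinj⟩

/-- If the center is pointed, a simple object in degree `v` is one-dimensional, so its operators are
scalars and these trivialize `β_v`. -/
theorem isPointedCategory_iff [IsAlgClosed k] [CharZero k] :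
    IsPointedCategory (Center (GrVec ω)) ↔ ∀ v : G, (betaCocycle ω v).cls = 0 := by
  simp only [TwoCocycle.cls_eq_zero_iff]
  refine ⟨fun h v => ?_, isPointedCategory_of_trivial⟩
  obtain ⟨Z, hZ, hv⟩ := exists_simple_concentrated ω v
  have h1 := finrank_eq_one_of_isInvertibleObj (h Z hZ)
  have : Nontrivial Z.1.carrier := Module.nontrivial_of_finrank_pos (R := k) (by omega)
  obtain ⟨z, h0⟩ := exists_ne (0 : Z.1.carrier)
  choose c hc using fun x => (finrank_eq_one_iff_of_nonzero' _ h0).1 h1 (centerOp Z x z)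
  obtain ⟨f, -, hf⟩ := exists_units_of_eigenvector Z (hv z) h0 c fun x => (hc x).symm
  exact ⟨f, hf⟩

end GrVec

/-! ### Direct sums of invertible objects -/

namespace GrVec

variable {k G : Type u} [Field k] [CommGroup G] [Fintype G] {ω : ThreeCocycle G kˣ}

/-- The coordinate of a vector of a central object with respect to a basis of homogeneous common
eigenvectors, as a morphism. -/
def eigenCoord (Z : Center (GrVec ω)) {ι : Type} [Finite ι]
    (e : Module.Basis ι k Z.1.carrier) {v : G} (hv : ∀ z : Z.1.carrier, IsHomog v z)
    (f : ι → G → kˣ)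
    (hf : ∀ i x y, (betaCocycle ω v).toFun x y = f i y * f i x / f i (x * y))
    (hc : ∀ i x, centerOp Z x (e i) = (f i x : k) • e i) (i : ι) :
    Z ⟶ centerSingle v (f i) (hf i) :=
  centerHom ⟨e.coord i, fun g z => by
    classical
    rw [(hv z).proj_eq]
    refine Eq.trans ?_ ((isHomog_single (ω := ω) v (e.coord i z)).proj_eq g).symm
    split_ifs
    · rfl
    · exact map_zero _⟩ fun x z => by
    refine Eq.trans ?_ (centerOp_centerSingle v (f i) (hf i) x _).symm
    have h : e.coord i ∘ₗ (centerOp Z x).toLinearMap = (f i x : k) • e.coord i := by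
      classical
      refine e.ext fun j => ?_
      rw [LinearMap.comp_apply, LinearEquiv.coe_coe, hc, map_smul, LinearMap.smul_apply,
        Module.Basis.coord_apply, Module.Basis.repr_self, Finsupp.single_apply]
      split_ifs with hij
      · rw [hij]
      · rw [smul_zero, smul_zero]
    exact LinearMap.congr_fun h z

/-- A finite sum of morphisms of the center. -/
def sumHom {X Y : Center (GrVec ω)} {ι : Type} [Fintype ι] (f : ι → (X ⟶ Y)) : X ⟶ Y :=
  centerHom ⟨∑ i, (f i).f.lin, fun g x => by
    rw [LinearMap.sum_apply, LinearMap.sum_apply, map_sum]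
    exact Finset.sum_congr rfl fun i _ => (f i).f.comm g x⟩ fun x z => by
    change (∑ i, (f i).f.lin) _ = centerOp Y x ((∑ i, (f i).f.lin) z)
    rw [LinearMap.sum_apply, LinearMap.sum_apply, map_sum]
    exact Finset.sum_congr rfl fun i _ => hom_centerOp (f i) x z

theorem sumHom_lin {X Y : Center (GrVec ω)} {ι : Type} [Fintype ι] (f : ι → (X ⟶ Y))
    (x : X.1.carrier) : (sumHom f).f.lin x = ∑ i, (f i).f.lin x := LinearMap.sum_apply _ _ _

/-- A bicone whose projections and inclusions decompose the identity is a biproduct. -/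
theorem isBilimit_of_sum {ι : Type} [Fintype ι] {Y : ι → Center (GrVec ω)} (B : Limits.Bicone Y)
    (h : ∀ z : B.pt.1.carrier, ∑ i, (B.ι i).f.lin ((B.π i).f.lin z) = z) :
    Nonempty B.IsBilimit := by
  classical
  refine ⟨⟨Limits.Fan.IsLimit.mk _ (fun s => sumHom fun i => s.proj i ≫ B.ι i) (fun s j => ?_)
    (fun s m hm => ?_), Limits.Cofan.IsColimit.mk _ (fun s => sumHom fun i => B.π i ≫ s.inj i)
    (fun s j => ?_) (fun s m hm => ?_)⟩⟩
  · refine centerHom_ext fun z => ?_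
    refine (congrArg (B.π j).f.lin (sumHom_lin _ z)).trans ?_
    rw [map_sum, Finset.sum_eq_single j]
    · change ((s.proj j ≫ B.ι j ≫ B.π j).f).lin z = _
      rw [B.ι_π, dif_pos rfl, eqToHom_refl, Category.comp_id]
    · intro i _ hi
      change ((s.proj i ≫ B.ι i ≫ B.π j).f).lin z = _
      rw [B.ι_π, dif_neg hi, Limits.comp_zero]
      rfl
    · simp
  · refine centerHom_ext fun z => ?_
    rw [sumHom_lin, ← h (m.f.lin z)]
    refine Finset.sum_congr rfl fun i _ => ?_
    rw [← hm i]
    rfl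
  · refine centerHom_ext fun z => ?_
    refine (sumHom_lin _ _).trans ?_
    rw [Finset.sum_eq_single j]
    · change ((B.ι j ≫ B.π j ≫ s.inj j).f).lin z = _
      rw [← Category.assoc, B.ι_π, dif_pos rfl, eqToHom_refl, Category.id_comp]
    · intro i _ hi
      change ((B.ι j ≫ B.π i ≫ s.inj i).f).lin z = _
      rw [← Category.assoc, B.ι_π, dif_neg hi.symm, Limits.zero_comp]
      rfl
    · simp
  · refine centerHom_ext fun z => ?_
    rw [sumHom_lin]
    refine ((congrArg m.f.lin (h z).symm).trans (map_sum m.f.lin _ _)).trans ?_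
    refine Finset.sum_congr rfl fun i _ => ?_
    rw [← hm i]
    rfl

/-- A central object concentrated in a degree `v` with trivializable `β_v` is a direct sum of
invertible objects. -/
theorem pointedPart_of_concentrated [IsAlgClosed k] [CharZero k] (Z : Center (GrVec ω)) {v : G}
    (hv : ∀ z : Z.1.carrier, IsHomog v z) (g : G → kˣ)
    (hg : ∀ x y, (betaCocycle ω v).toFun x y = g y * g x / g (x * y)) :
    pointedPart (Center (GrVec ω)) Z := by
  classical
  have hs : ⊤ ≤ Submodule.span k
      {w : Z.1.carrier | IsHomog v w ∧ ∃ c : G → k, ∀ x, centerOp Z x w = c x • w} :=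
    fun z _ => mem_span_eigenvectors Z g hg (hv z)
  -- A basis of common eigenvectors, extracted from the spanning set; its coordinate maps and
  -- inclusions form the biproduct.
  let e' := Module.Basis.ofSpan hs
  let e : Module.Basis (Fin (Module.finrank k Z.1.carrier)) k Z.1.carrier :=
    e'.reindex (Fintype.equivFinOfCardEq (Module.finrank_eq_card_basis e').symm)
  have he : ∀ i, IsHomog v (e i) ∧ ∃ c : G → k, ∀ x, centerOp Z x (e i) = c x • e i := fun i =>
    Module.Basis.ofSpan_subset hs (by
      rw [Module.Basis.reindex_apply]
      exact ⟨_, rfl⟩)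
  choose c hc using fun i => (he i).2
  choose f hf hf' using fun i => exists_units_of_eigenvector Z (he i).1 (e.ne_zero i) (c i) (hc i)
  have hc' : ∀ i x, centerOp Z x (e i) = (f i x : k) • e i := fun i x => by rw [hf, hc]
  let B : Limits.Bicone fun i => centerSingle v (f i) (hf' i) :=
    { pt := Z
      π := eigenCoord Z e hv f hf' hc'
      ι := fun i => centerSingleHom Z (hv (e i)) (f i) (hf' i) (hc' i)
      ι_π := fun i j => by
        split_ifs with hij
        · subst hij
          refine centerHom_ext fun (a : k) => ?_
          change e.coord i (a • e i) = a
          rw [map_smul, Module.Basis.coord_apply, Module.Basis.repr_self, Finsupp.single_eq_same]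
          exact mul_one _
        · refine centerHom_ext fun (a : k) => ?_
          change e.coord j (a • e i) = 0
          rw [map_smul, Module.Basis.coord_apply, Module.Basis.repr_self,
            Finsupp.single_eq_of_ne (Ne.symm hij), smul_zero] }
  exact ⟨_, _, B, fun i => isInvertibleObj_centerSingle v (f i) (hf' i),
    isBilimit_of_sum B fun z => e.sum_repr z, ⟨Iso.refl _⟩⟩

theorem pointedPart_of_isInvertibleObj {Z : Center (GrVec ω)} (h : IsInvertibleObj Z) :
    pointedPart (Center (GrVec ω)) Z :=
  ⟨1, fun _ => Z, (Limits.limitBiconeOfUnique fun _ : Fin 1 => Z).bicone, fun _ => h,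
    ⟨(Limits.limitBiconeOfUnique fun _ : Fin 1 => Z).isBilimit⟩, ⟨Iso.refl _⟩⟩

/-- The projection to the component of degree `v`, as an endomorphism of a central object. -/
def projHom (Z : Center (GrVec ω)) (v : G) : Z ⟶ Z :=
  centerHom ⟨Z.1.proj v, fun g z => by
    by_cases hg : v = g
    · rw [hg]
    · rw [Z.1.proj_ne _ _ _ hg, Z.1.proj_ne _ _ _ (Ne.symm hg)]⟩ fun x z => by
    classical
    have h : Z.1.proj v ∘ₗ (centerOp Z x).toLinearMap =
        (centerOp Z x).toLinearMap ∘ₗ Z.1.proj v := lin_ext fun g z hz => by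
      rw [LinearMap.comp_apply, LinearMap.comp_apply, LinearEquiv.coe_coe, hz.proj_eq,
        (centerOp_homog Z x hz).proj_eq]
      split_ifs
      · rfl
      · rw [map_zero]
    exact LinearMap.congr_fun h z

theorem identitySupported_of_iso {Z W : Center (GrVec ω)} (e : Z ≅ W)
    (h : identitySupported ω W) : identitySupported ω Z := fun z => by
  have h1 : Function.Injective e.hom.f.lin :=
    (isoEquiv ((Center.forget (GrVec ω)).mapIso e)).injective
  apply h1
  rw [e.hom.f.comm]
  exact h _

/-- The projection to degree `1` is an endomorphism of central objects that agrees with the identity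
after every biproduct projection. -/
theorem identitySupported_of_isBilimit {ι : Type} {Y : ι → Center (GrVec ω)} {B : Limits.Bicone Y}
    (hB : B.IsBilimit) (h : ∀ i, identitySupported ω (Y i)) : identitySupported ω B.pt := by
  have h1 : projHom B.pt 1 = 𝟙 B.pt := hB.isLimit.hom_ext fun j => by
    refine centerHom_ext fun z => ?_
    refine (((B.π j.as).f.comm 1 z).trans (h j.as _)).trans ?_
    rfl
  exact fun z => LinearMap.congr_fun (congrArg (fun a => Hom.lin (Center.Hom.f a)) h1) z

/-- A trivial `β_v` yields an invertible object in degree `v`, which must be degree `1` if the two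
subcategories agree. Conversely, if only `β_1` is trivial, all invertible objects sit in degree `1`,
and every object there is a sum of eigenlines. -/
theorem pointedPart_eq_identitySupported_iff [IsAlgClosed k] [CharZero k] :
    pointedPart (Center (GrVec ω)) = identitySupported ω ↔
      ∀ v : G, (betaCocycle ω v).cls = 0 → v = 1 := by
  constructor
  · intro h v hv
    obtain ⟨f, hf⟩ := (TwoCocycle.cls_eq_zero_iff _).1 hv
    have h1 : identitySupported ω (centerSingle v f hf) := by
      rw [← h]
      exact pointedPart_of_isInvertibleObj (isInvertibleObj_centerSingle v f hf)
    exact (isHomog_single (ω := ω) v (1 : k)).eq_of_ne_zero (h1 (1 : k)) one_ne_zero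
  · intro h
    funext Z
    refine propext ⟨?_, fun hZ => ?_⟩
    · rintro ⟨m, Y, B, hY, ⟨hB⟩, ⟨e⟩⟩
      refine identitySupported_of_iso e (identitySupported_of_isBilimit hB fun i => ?_)
      obtain ⟨v, f, hf, ⟨e'⟩⟩ := exists_centerSingle_iso _ (finrank_eq_one_of_isInvertibleObj (hY i))
      obtain rfl := h v ((TwoCocycle.cls_eq_zero_iff _).2 ⟨f, hf⟩)
      exact identitySupported_of_iso e'.symm (isHomog_single (ω := ω) 1)
    · obtain ⟨f, -, hf⟩ := exists_units_of_eigenvector (𝟙_ (Center (GrVec ω)))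
        (isHomog_single (ω := ω) 1 (1 : k)) (one_ne_zero (α := k)) _ fun x => centerOp_unit x 1
      exact pointedPart_of_concentrated Z hZ f hf

end GrVec

/-! ### Representations as central objects of degree `1` -/

namespace GrVec

variable {k G : Type u} [Field k] [CommGroup G] [Fintype G] (ω : ThreeCocycle G kˣ)

/-- The eigenvalue of the operator `x` on the unit object; it is `1` if `ω` is normalized. -/
def unitScalar (x : G) : kˣ := (ω.toFun 1 1 x * ω.toFun x 1 1)⁻¹

/-- The eigenvalues on the unit object trivialize `β_1`. -/
theorem betaCocycle_one_eq (x y : G) : (betaCocycle ω 1).toFun x y =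
    unitScalar ω y * unitScalar ω x / unitScalar ω (x * y) := by
  obtain ⟨f, hf, hf'⟩ := exists_units_of_eigenvector (𝟙_ (Center (GrVec ω)))
    (isHomog_single (ω := ω) 1 (1 : k)) (one_ne_zero (α := k)) _ fun x => centerOp_unit x 1
  have h : f = unitScalar ω := funext fun x => Units.ext (hf x)
  rw [hf', h]

/-- The operators on the central object given by a representation. -/
def repOp (V : FDRep k G) (x : G) : V ≃ₗ[k] V :=
  LinearEquiv.ofLinearMap ((unitScalar ω x : k) • V.ρ x) (((unitScalar ω x)⁻¹ : kˣ).1 • V.ρ x⁻¹)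
    (by
      rw [LinearMap.smul_comp, LinearMap.comp_smul, smul_smul, Units.mul_inv, one_smul]
      change V.ρ x * V.ρ x⁻¹ = 1
      rw [← map_mul, mul_inv_cancel, map_one])
    (by
      rw [LinearMap.smul_comp, LinearMap.comp_smul, smul_smul, Units.inv_mul, one_smul]
      change V.ρ x⁻¹ * V.ρ x = 1
      rw [← map_mul, inv_mul_cancel, map_one])

theorem repOp_apply (V : FDRep k G) (x : G) (w : V) :
    repOp ω V x w = (unitScalar ω x : k) • V.ρ x w := rfl

theorem repOp_repOp (V : FDRep k G) (x y : G) (w : V) :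
    repOp ω V y (repOp ω V x w) =
      ((betaCocycle ω 1).toFun x y : k) • repOp ω V (x * y) w := by
  rw [repOp_apply, repOp_apply, repOp_apply, map_smul, smul_smul, smul_smul, betaCocycle_one_eq,
    ← Units.val_mul, ← Units.val_mul, div_mul_cancel, mul_comm x y, map_mul]
  rfl

/-- The central object supported in degree `1` given by a representation. -/
def repCenter (V : FDRep k G) : Center (GrVec ω) :=
  (concentratedAction 1 (repOp ω V) (repOp_repOp ω V)).toCenter

theorem centerOp_repCenter (V : FDRep k G) (x : G) (w : V) :
    centerOp (repCenter ω V) x w = (unitScalar ω x : k) • V.ρ x w :=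
  (concentratedAction 1 (repOp ω V) (repOp_repOp ω V)).centerOp_toCenter x w

theorem isHomog_repCenter (V : FDRep k G) (w : V) : IsHomog (X := (repCenter ω V).1) 1 w :=
  isHomog_concentrated (W := V) w

/-- A graded map between objects supported in degree `1`. -/
def homOfSupported {X Y : GrVec ω} (hX : ∀ x : X.carrier, IsHomog 1 x)
    (hY : ∀ y : Y.carrier, IsHomog 1 y) (f : X.carrier →ₗ[k] Y.carrier) : X ⟶ Y :=
  ⟨f, fun g x => by
    classical
    rw [(hX x).proj_eq, (hY (f x)).proj_eq]
    split_ifs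
    · rfl
    · rw [map_zero]⟩

/-- The action of `FDRep k G ⥤ Z(C(G, ω))` on morphisms. -/
def repMap {V W : FDRep k G} (f : V ⟶ W) : repCenter ω V ⟶ repCenter ω W :=
  centerHom (homOfSupported ω (isHomog_repCenter ω V) (isHomog_repCenter ω W) f.hom.hom.hom)
    fun x (w : V) => by
      refine (congrArg f.hom.hom.hom (centerOp_repCenter ω V x w)).trans
        (((map_smul f.hom.hom.hom _ _).trans ?_).trans (centerOp_repCenter ω W x _).symm)
      congr 1
      exact LinearMap.congr_fun (congrArg (fun a => ModuleCat.Hom.hom (InducedCategory.Hom.hom a))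
        (f.comm x)) w

/-- The functor from representations of `G` to central objects supported in degree `1`. -/
def repFunctor : FDRep k G ⥤ (identitySupported ω).FullSubcategory where
  obj V := ⟨repCenter ω V, isHomog_repCenter ω V⟩
  map f := ObjectProperty.homMk (repMap ω f)
  map_id V := by
    ext1
    exact centerHom_ext fun _ => rfl
  map_comp f g := by
    ext1
    exact centerHom_ext fun _ => rfl

instance : (repFunctor ω).Faithful where
  map_injective {V W f g} h := by
    apply Action.hom_ext
    apply FGModuleCat.hom_ext
    exact congrArg (fun a => Hom.lin (Center.Hom.f (InducedCategory.Hom.hom a))) h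

instance : (repFunctor ω).Full where
  map_surjective {V W} f := by
    let l : V →ₗ[k] W := f.hom.f.lin
    refine ⟨⟨InducedCategory.homMk (ModuleCat.ofHom l), fun x => ?_⟩, ?_⟩
    · apply FGModuleCat.hom_ext
      refine LinearMap.ext fun v => ?_
      have h := hom_centerOp f.hom x v
      have h1 := ((congrArg l (centerOp_repCenter ω V x v)).symm.trans h).trans
        (centerOp_repCenter ω W x (l v))
      rw [map_smul] at h1
      exact smul_right_injective W (Units.ne_zero _) h1
    · ext1
      exact centerHom_ext fun _ => rfl

instance : (repFunctor ω).EssSurj where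
  mem_essImage Z := by
    -- Dividing by `unitScalar` removes the multiplier `β_1` and leaves an honest representation.
    let T : G → Z.obj.1.carrier →ₗ[k] Z.obj.1.carrier := fun x =>
      ((unitScalar ω x)⁻¹ : kˣ).1 • (centerOp Z.obj x).toLinearMap
    have hmul : ∀ x y z, T (x * y) z = T x (T y z) := fun x y z => by
      change ((unitScalar ω (x * y))⁻¹ : kˣ).1 • centerOp Z.obj (x * y) z =
        ((unitScalar ω x)⁻¹ : kˣ).1 • centerOp Z.obj x (((unitScalar ω y)⁻¹ : kˣ).1 •
          centerOp Z.obj y z)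
      rw [map_smul, centerOp_mul Z.obj y x (Z.property z), betaCocycle_one_eq, smul_smul, smul_smul,
        mul_comm x y, ← Units.val_mul, ← Units.val_mul]
      congr 2
      rw [← mul_inv, ← mul_div_assoc, inv_mul_cancel, one_div]
    have hone : ∀ z, T 1 z = z := fun z => by
      have h := hmul 1 1 z
      rw [mul_one] at h
      exact ((centerOp Z.obj 1).injective (((smul_right_injective _ (Units.ne_zero _)) h))).symm
    let ρ : Representation k G Z.obj.1.carrier :=
      { toFun := T
        map_one' := LinearMap.ext hone
        map_mul' := fun x y => LinearMap.ext (hmul x y) }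
    refine ⟨FDRep.of ρ, ⟨ObjectProperty.isoMk _ ?_⟩⟩
    refine centerIso (Z := repCenter ω (FDRep.of ρ)) (LinearEquiv.refl k Z.obj.1.carrier)
      (fun g x hx => ?_) fun x z => ?_
    · by_cases h0 : x = 0
      · rw [h0]
        exact isHomog_zero _ _
      · rw [hx.eq_of_ne_zero (isHomog_repCenter ω (FDRep.of ρ) x) h0]
        exact Z.property x
    · refine (centerOp_repCenter ω (FDRep.of ρ) x z).trans ?_
      exact (smul_smul _ _ _).trans ((congrArg (fun a : k => a • centerOp Z.obj x z)
        (Units.mul_inv _)).trans (one_smul k _))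

instance : (repFunctor ω).IsEquivalence where

end GrVec

/-- Forced by the cocycle relation even without normalization. It makes the associator and the unit
constraints trivial in degree `1`. -/
theorem ThreeCocycle.toFun_one_one_one {G M : Type u} [Group G] [CommGroup M]
    (ω : ThreeCocycle G M) : ω.toFun 1 1 1 = 1 := by
  have h := ω.cocycle 1 1 1 1
  simp only [mul_one] at h
  exact mul_left_cancel (h.trans (mul_one _).symm)

theorem ThreeCocycle.toFun_one_mid {G M : Type u} [Group G] [CommGroup M]
    (ω : ThreeCocycle G M) (x : G) : ω.toFun 1 x 1 = 1 := by
  have h := ω.cocycle 1 1 x 1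
  simp only [mul_one, one_mul] at h
  exact mul_left_cancel ((mul_right_cancel h).trans (mul_one _).symm)

/-! ### Monoidal and braided structure of the equivalence -/

namespace GrVec

variable {k G : Type u} [Field k] [CommGroup G] [Fintype G] (ω : ThreeCocycle G kˣ)

theorem unitScalar_one : unitScalar ω 1 = 1 := by
  rw [unitScalar, ω.toFun_one_one_one, mul_one, inv_one]

/-- Isomorphisms between central objects supported in degree `1`. -/
def isoOfSupported {X Y : (identitySupported ω).FullSubcategory}
    (e : X.obj.1.carrier ≃ₗ[k] Y.obj.1.carrier)
    (h : ∀ x z, e (centerOp X.obj x z) = centerOp Y.obj x (e z)) : X ≅ Y :=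
  ObjectProperty.isoMk _ (centerIso e (fun g z hz => by
    by_cases h0 : z = 0
    · rw [h0, map_zero]
      exact isHomog_zero _ _
    · rw [hz.eq_of_ne_zero (X.property z) h0]
      exact Y.property _) h)

/-- The unit isomorphism of the functor from representations to central objects. -/
def repUnitIso : 𝟙_ (identitySupported ω).FullSubcategory ≅
    (repFunctor ω).obj (𝟙_ (FDRep k G)) :=
  isoOfSupported ω (LinearEquiv.refl k k) fun x (c : k) =>
    (centerOp_unit x c).trans (centerOp_repCenter ω (𝟙_ (FDRep k G)) x c).symm

/-- At `v = w = 1` the scalar of `centerOp_tensor` is `(unitScalar ω x)⁻¹`, because `ω(1, x, 1) =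
1`. It cancels one of the two factors `unitScalar ω x` coming from `V` and `W`. -/
theorem repTensor_aux (V W : FDRep k G) (x : G) (t : V ⊗[k] W) :
    centerOp (repCenter ω V ⊗ repCenter ω W) x t = centerOp (repCenter ω (V ⊗ W)) x t := by
  refine Eq.trans ?_ (centerOp_repCenter ω (V ⊗ W) x t).symm
  induction t using TensorProduct.induction_on with
  | zero =>
    exact (map_zero (centerOp (repCenter ω V ⊗ repCenter ω W) x)).trans
      ((smul_zero _).symm.trans (congrArg _ (map_zero ((V ⊗ W).ρ x)).symm))
  | add s t hs ht =>
    refine (map_add (centerOp (repCenter ω V ⊗ repCenter ω W) x) s t).trans ?_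
    refine (congrArg₂ (· + ·) hs ht).trans ?_
    exact (smul_add _ _ _).symm.trans (congrArg _ (map_add ((V ⊗ W).ρ x) s t).symm)
  | tmul v w =>
    refine (centerOp_tensor (repCenter ω V) (repCenter ω W) x (isHomog_repCenter ω V v)
      (isHomog_repCenter ω W w)).trans ?_
    have h1 : ∀ (a b c d : k) (v : V) (w : W), c * (a * b) = d → c • ((a • v) ⊗ₜ[k] (b • w)) =
      d • (v ⊗ₜ[k] w) := fun a b c d v w h => by
        rw [TensorProduct.smul_tmul_smul, smul_smul, h]
    refine (congrArg₂ (fun (a : V) (b : W) => _ • (a ⊗ₜ[k] b)) (centerOp_repCenter ω V x v)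
      (centerOp_repCenter ω W x w)).trans ?_
    refine h1 _ _ _ _ (V.ρ x v) (W.ρ x w) ?_
    rw [← Units.val_mul, ← Units.val_mul]
    congr 1
    rw [ω.toFun_one_mid, unitScalar, inv_one, mul_one, mul_inv_cancel_left]

/-- The tensor isomorphism of the functor from representations to central objects. -/
def repTensorIso (V W : FDRep k G) :
    (repFunctor ω).obj V ⊗ (repFunctor ω).obj W ≅ (repFunctor ω).obj (V ⊗ W) :=
  isoOfSupported ω (LinearEquiv.refl k (V ⊗[k] W)) (repTensor_aux ω V W)

theorem ext_tmul {V W : FDRep k G} {Y : (identitySupported ω).FullSubcategory}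
    {f g : (repFunctor ω).obj V ⊗ (repFunctor ω).obj W ⟶ Y}
    (h : ∀ (v : V) (w : W), f.hom.f.lin (v ⊗ₜ[k] w) = g.hom.f.lin (v ⊗ₜ[k] w)) : f = g := by
  ext1
  apply Center.ext
  apply hom_ext
  exact TensorProduct.ext' h

theorem ext_unit_tmul {V : FDRep k G} {Y : (identitySupported ω).FullSubcategory}
    {f g : 𝟙_ _ ⊗ (repFunctor ω).obj V ⟶ Y}
    (h : ∀ (c : k) (v : V), f.hom.f.lin (c ⊗ₜ[k] v) = g.hom.f.lin (c ⊗ₜ[k] v)) : f = g := by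
  ext1
  apply Center.ext
  apply hom_ext
  exact TensorProduct.ext' h

theorem ext_tmul_unit {V : FDRep k G} {Y : (identitySupported ω).FullSubcategory}
    {f g : (repFunctor ω).obj V ⊗ 𝟙_ _ ⟶ Y}
    (h : ∀ (v : V) (c : k), f.hom.f.lin (v ⊗ₜ[k] c) = g.hom.f.lin (v ⊗ₜ[k] c)) : f = g := by
  ext1
  apply Center.ext
  apply hom_ext
  exact TensorProduct.ext' h

/-- The monoidal structure on the functor from representations to central objects. -/
def repCoreMonoidal : (repFunctor ω).CoreMonoidal where
  εIso := repUnitIso ω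
  μIso := repTensorIso ω
  μIso_hom_natural_left f X := ext_tmul ω fun v w => rfl
  μIso_hom_natural_right X f := ext_tmul ω fun v w => rfl
  associativity X Y Z := by
    ext1
    apply Center.ext
    apply hom_ext
    refine TensorProduct.ext_threefold fun x y z => ?_
    have h := assoc_hom_apply (isHomog_repCenter ω X x) (isHomog_repCenter ω Y y)
      (isHomog_repCenter ω Z z)
    rw [ω.toFun_one_one_one, Units.val_one, one_smul] at h
    exact (congrArg ((repFunctor ω).obj X ◁ (repTensorIso ω Y Z).hom ≫
      (repTensorIso ω X (Y ⊗ Z)).hom).hom.f.lin h).symm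
  left_unitality X := ext_unit_tmul ω fun c x => by
    refine (leftUnitEquiv_apply (isHomog_repCenter ω X x) c).trans ?_
    rw [ω.toFun_one_one_one, inv_one, Units.val_one, one_smul]
    rfl
  right_unitality X := ext_tmul_unit ω fun x c => by
    refine (rightUnitEquiv_apply (isHomog_repCenter ω X x) c).trans ?_
    rw [ω.toFun_one_one_one, Units.val_one, one_smul]
    rfl

instance : (repFunctor ω).Monoidal := (repCoreMonoidal ω).toMonoidal

/-- The braiding of the center is the half-braiding. On vectors of degree `1` it involves only the
operator at `1`, the identity here since `unitScalar ω 1 = 1`; so it is the flip, as for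
representations. -/
instance : (repFunctor ω).Braided where
  braided X Y := ext_tmul ω fun v w => by
    have h : (β_ (repCenter ω X) (repCenter ω Y)).hom.f.lin (v ⊗ₜ[k] w) =
        w ⊗ₜ[k] centerOp (repCenter ω X) 1 v :=
      halfBraiding_apply (repCenter ω X) (isHomog_repCenter ω Y w) v
    have h1 : centerOp (repCenter ω X) 1 v = v := by
      refine (centerOp_repCenter ω X 1 v).trans ?_
      rw [unitScalar_one, Units.val_one, one_smul, map_one]
      rfl
    rw [h1] at h
    exact h.symm

end GrVec

end

/-! ### Assembly of the two halves -/

theorem mainTheorem7 {p : ℕ} [Fact p.Prime] {k : Type u} [Field k] [IsAlgClosed k] [CharZero k]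
    {ξ : kˣ} (hξ : IsPrimitiveRoot ξ p) {n : ℕ} {V : Type u} [AddCommGroup V] [Module (ZMod p) V]
    [Fintype V] (b : Module.Basis (Fin n) (ZMod p) V)
    (ω : ThreeCocycle (Multiplicative V) kˣ) :
    ∃ φ : ⋀[ZMod p]^3 (Module.Dual (ZMod p) V),
      (∀ ψ, IsAltPart b hξ ω.cls ψ ↔ ψ = φ) ∧
      (∃ Θ : ⋀[ZMod p]^2 (Module.Dual (ZMod p) V) ≃+
          groupCohomology.H2 (trivRep (Multiplicative V) kˣ),
        (∀ x y, Θ (wedge₂ x y) = (bilinCocycle hξ x y).cls) ∧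
        ∀ v : V, (betaCocycle ω (Multiplicative.ofAdd v)).cls = Θ (interiorDerivation v φ)) ∧
      (∀ v : V, (∃ Z : Center (GrVec ω), IsInvertibleObj Z ∧
          Nonempty ((Center.forget (GrVec ω)).obj Z ≅ GrVec.single ω (Multiplicative.ofAdd v))) ↔
        v ∈ Rad φ) ∧
      (IsPointedCategory (Center (GrVec ω)) ↔ φ = 0) ∧
      (∃ E : FDRep k (Multiplicative V) ≌ (GrVec.identitySupported ω).FullSubcategory,
        Nonempty E.functor.Braided) ∧
      (pointedPart (Center (GrVec ω)) = GrVec.identitySupported ω ↔ Nondegenerate₃ φ) := by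
  obtain ⟨φ, h1, h2, Θ, h3, h4⟩ := exists_altPart b hξ ω
  have hRad : ∀ v : V, (betaCocycle ω (Multiplicative.ofAdd v)).cls = 0 ↔ v ∈ Rad φ := fun v => by
    rw [h4, mem_Rad, map_eq_zero_iff Θ Θ.injective]
  refine ⟨φ, h1, ⟨Θ, h3, h4⟩, fun v => (GrVec.exists_isInvertibleObj_iff _).trans (hRad v), ?_,
    ⟨(GrVec.repFunctor ω).asEquivalence, ⟨(inferInstance : (GrVec.repFunctor ω).Braided)⟩⟩, ?_⟩
  · rw [GrVec.isPointedCategory_iff]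
    constructor
    · intro h
      -- A coboundary `β_u` is symmetric in its arguments, so the alternation of `ω` is trivial.
      refine h2 fun u v w => ?_
      obtain ⟨f, hf⟩ := (TwoCocycle.cls_eq_zero_iff _).1 (h u)
      rw [ThreeCocycle.alternation, hf, hf, mul_comm v w, mul_comm (f v), div_self']
    · rintro rfl v
      exact (hRad v.toAdd).2 ((mem_Rad _ _).2 (map_zero _))
  · rw [GrVec.pointedPart_eq_identitySupported_iff, Nondegenerate₃, Submodule.eq_bot_iff]
    exact ⟨fun h v hv => h (Multiplicative.ofAdd v) ((hRad v).2 hv),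
      fun h v hv => h v.toAdd ((hRad v.toAdd).1 hv)⟩
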